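/- Let $\mathbb R^+=(0,\infty)$. Write $L^2=L^2(\mathbb R^+)$, let $H^1=H^1(\mathbb R^+)$ be normed by $\|w\|_{H^1}^2=\|w\|_{L^2}^2+\|w_x\|_{L^2}^2$, and let $\hat H^{-1}=\hat H^{-1}(\mathbb R^+)$ be the space of distributions $\partial_x p$ on $\mathbb R^+$ with $p\in L^2$ real valued, normed by $\|\partial_x p\|_{\hat H^{-1}}=\|p\|_{L^2}$. Consider, for complex-valued $u$ and real-valued $n$, the Zakharov system on the half line with zero boundary value for $u$, $$ \begin{cases} iu_t+u_{xx}=nu,\quad n_{tt}-n_{xx}=(|u|^2)_{xx}, & x>0,\\ u(x,0)=g(x),\quad n(x,0)=n_0(x),\quad n_t(x,0)=n_1(x),\\ u(0,t)=0,\quad n(0,t)=f(t), \end{cases} $$ with data $g\in H^1$, $n_0\in L^2$, $n_1\in\hat H^{-1}$, $f\in L^2$ (where $n_0,f$ are real valued). A solution on $[0,T]$, $T>0$, in the energy class is a pair $(u,n)$ with $$ u\in C([0,T];H^1),\qquad n\in C([0,T];L^2)\cap C([0,\infty)_x;L^2((0,T)_t)),\qquad n_t\in C([0,T];\hat H^{-1}),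 $$ that satisfies the two equations in the sense of distributions, the initial conditions, $u(0,t)=0$ for all $t\in[0,T]$ and $n(0,t)=f(t)$ for almost every $t\in(0,T)$. **Proposition 6.1.** There is a function $C:\mathbb R^4\to\mathbb R$, nondecreasing in each argument, such that for all data as above, all $T>0$ and every solution $(u,n)$ on $[0,T]$ in the energy class, $$ \|u(t)\|_{H^1}+\|n(t)\|_{L^2}+\|n_t(t)\|_{\hat H^{-1}}\le C\big(\|g\|_{H^1},\|n_0\|_{L^2},\|n_1\|_{\hat H^{-1}},\|f\|_{L^2}\big)\qquad\text{for all }t\in[0,T]. $$ In particular the bound does not depend on $t$ or $T$. -/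

import Mathlib

open Set Filter Topology MeasureTheory
open scoped ENNReal Distributions

noncomputable section

namespace Zakharov

/-- The open half line `ℝ⁺ = (0, ∞)`. Test functions on it are the elements of `𝓓(halfLine, ℝ)`
and distributions on it those of `𝓓'(halfLine, ℝ)`. -/
def halfLine : TopologicalSpace.Opens ℝ := ⟨Ioi 0, isOpen_Ioi⟩

section Spaces

variable {E : Type*} [NormedAddCommGroup E] [NormedSpace ℝ E]

/-- `w ∈ L²(ℝ⁺)`; only the values of `w` on `(0, ∞)` matter. -/
def MemL2 (w : ℝ → E) : Prop := MemLp w 2 (volume.restrict (Ioi 0))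

/-- The norm of `L²(ℝ⁺)`. -/
def l2Norm (w : ℝ → E) : ℝ := (eLpNorm w 2 (volume.restrict (Ioi 0))).toReal

/-- `w'` is the weak derivative of `w` on `(0, ∞)`. -/
def HasWeakDeriv (w w' : ℝ → E) : Prop :=
  ∀ φ : 𝓓(halfLine, ℝ), ∫ x in Ioi 0, deriv φ x • w x = -∫ x in Ioi 0, φ x • w' x

/-- `w ∈ H¹(ℝ⁺)`: both `w` and its weak derivative are square integrable on `(0, ∞)`. -/
def MemH1 (w : ℝ → E) : Prop := MemL2 w ∧ ∃ w' : ℝ → E, MemL2 w' ∧ HasWeakDeriv w w'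

/-- The norm `(‖w‖² + ‖w'‖²)^{1/2}` of `H¹(ℝ⁺)`, norms on the right being those of `L²(ℝ⁺)`. For
`w ∈ H¹(ℝ⁺)` the weak derivative `w'` is unique up to null sets, so that the infimum is over one
number. -/
def h1Norm (w : ℝ → E) : ℝ :=
  sInf {r | ∃ w' : ℝ → E, MemL2 w' ∧ HasWeakDeriv w w' ∧ r = √(l2Norm w ^ 2 + l2Norm w' ^ 2)}

end Spaces

/-- The distribution `S` on `(0, ∞)` is the derivative `∂ₓ p` of the function `p ∈ L²(ℝ⁺)`. -/
def IsL2Primitive (p : ℝ → ℝ) (S : 𝓓'(halfLine, ℝ)) : Prop :=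
  MemL2 p ∧ ∀ φ : 𝓓(halfLine, ℝ), S φ = -∫ x in Ioi 0, p x * deriv φ x

/-- `S ∈ Ĥ⁻¹(ℝ⁺) = {∂ₓ p : p ∈ L²(ℝ⁺)}`. -/
def MemHatHm1 (S : 𝓓'(halfLine, ℝ)) : Prop := ∃ p : ℝ → ℝ, IsL2Primitive p S

/-- The norm of `Ĥ⁻¹(ℝ⁺)`, given by `‖∂ₓ p‖ = ‖p‖_{L²(ℝ⁺)}`. A distribution on `(0, ∞)` has at most
one primitive in `L²(ℝ⁺)` up to null sets, so that the infimum is over one number. -/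
def hatHm1Norm (S : 𝓓'(halfLine, ℝ)) : ℝ := sInf {r | ∃ p : ℝ → ℝ, IsL2Primitive p S ∧ r = l2Norm p}

/-- The curve `w` is continuous on the set `I` with respect to the norm `N`. -/
def ContinuousInNorm {V : Type*} [Sub V] (N : V → ℝ) (I : Set ℝ) (w : ℝ → V) : Prop :=
  ∀ t₀ ∈ I, Tendsto (fun t => N (w t - w t₀)) (𝓝[I] t₀) (𝓝 0)

/-- `(u, n)`, with `n_t` the time derivative of `n`, is a solution in the energy class, on the time
interval `[0, T]`, of the initial boundary value problem for the Zakharov system on the half line: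

* `i u_t + u_xx = n u`, `n_tt - n_xx = (|u|²)_xx` for `x > 0`;
* `u(x, 0) = g(x)`, `n(x, 0) = n₀(x)`, `n_t(x, 0) = n₁(x)`;
* `u(0, t) = h(t)`, `n(0, t) = f(t)`.

The first argument of `u`, `n` and `nt` is the time. The equations hold in the sense of
distributions in `x`. -/
structure IsEnergySolution (g : ℝ → ℂ) (n₀ : ℝ → ℝ) (n₁ : 𝓓'(halfLine, ℝ)) (h : ℝ → ℂ)
    (f : ℝ → ℝ) (T : ℝ) (u : ℝ → ℝ → ℂ) (n : ℝ → ℝ → ℝ) (nt : ℝ → 𝓓'(halfLine, ℝ)) : Prop where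
  /-- `u ∈ C([0, T]; H¹(ℝ⁺))` -/
  u_mem : ∀ t ∈ Icc 0 T, MemH1 (u t)
  u_cont : ContinuousInNorm h1Norm (Icc 0 T) u
  /-- `u(·, t)` is the continuous representative, which gives a meaning to its value at `x = 0`. -/
  u_space_cont : ∀ t ∈ Icc 0 T, ContinuousOn (u t) (Ici 0)
  /-- `n ∈ C([0, T]; L²(ℝ⁺))` -/
  n_mem : ∀ t ∈ Icc 0 T, MemL2 (n t)
  n_cont : ContinuousInNorm l2Norm (Icc 0 T) n
  /-- `n` is measurable in space-time, and `n ∈ C([0, ∞)_x; L²((0, T)_t))`, which gives a meaning to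
  its trace on `x = 0`. -/
  n_meas : AEStronglyMeasurable (Function.uncurry n) (volume.restrict (Ioo 0 T ×ˢ Ioi 0))
  n_trace_mem : ∀ x ∈ Ici 0, MemLp (fun t => n t x) 2 (volume.restrict (Ioo 0 T))
  n_trace_cont : ContinuousInNorm (fun w => (eLpNorm w 2 (volume.restrict (Ioo 0 T))).toReal)
    (Ici 0) (fun x t => n t x)
  /-- `n_t ∈ C([0, T]; Ĥ⁻¹(ℝ⁺))` -/
  nt_mem : ∀ t ∈ Icc 0 T, MemHatHm1 (nt t)
  nt_cont : ContinuousInNorm hatHm1Norm (Icc 0 T) nt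
  /-- `nt` is the time derivative of `n`. -/
  nt_eq : ∀ t ∈ Icc 0 T, ∀ φ : 𝓓(halfLine, ℝ),
    HasDerivWithinAt (fun s => ∫ x in Ioi 0, n s x * φ x) (nt t φ) (Icc 0 T) t
  /-- `i u_t = n u - u_xx` -/
  schrodinger : ∀ t ∈ Icc 0 T, ∀ φ : 𝓓(halfLine, ℝ),
    HasDerivWithinAt (fun s => Complex.I * ∫ x in Ioi 0, u s x * (φ x : ℂ))
      ((∫ x in Ioi 0, (n t x : ℂ) * u t x * (φ x : ℂ)) -
        ∫ x in Ioi 0, u t x * ((deriv (deriv φ) x : ℝ) : ℂ)) (Icc 0 T) t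
  /-- `n_tt = n_xx + (|u|²)_xx` -/
  wave : ∀ t ∈ Icc 0 T, ∀ φ : 𝓓(halfLine, ℝ),
    HasDerivWithinAt (fun s => nt s φ)
      ((∫ x in Ioi 0, n t x * deriv (deriv φ) x) +
        ∫ x in Ioi 0, ‖u t x‖ ^ 2 * deriv (deriv φ) x) (Icc 0 T) t
  /-- initial conditions -/
  u_init : u 0 =ᵐ[volume.restrict (Ioi 0)] g
  n_init : n 0 =ᵐ[volume.restrict (Ioi 0)] n₀
  nt_init : nt 0 = n₁
  /-- boundary conditions -/
  u_boundary : ∀ t ∈ Icc 0 T, u t 0 = h t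
  n_boundary : (fun t => n t 0) =ᵐ[volume.restrict (Ioo 0 T)] f

end Zakharov

end

open Set Filter Topology MeasureTheory
open scoped ENNReal Distributions

noncomputable section

namespace Zakharov

/-! Write n_t = p_x, so that the wave equation becomes the first order system n_t = p_x, p_t = n_x +
(|u|²)_x. As u vanishes at x = 0, the mass of u is conserved, and the energy E = ‖u_x‖² + ∫ n|u|² +
(‖n‖² + ‖p‖²)/2 changes only through the boundary: formally dE/dt = -n(0,t) p(0,t). Here n(0,t) =
f(t) is given, but p(0,t) is not.

The momenta control p(0,t). The wave momentum ∫ n p changes at the rate -(n(0)² + p(0)²)/2 + ∫ n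
(|u|²)_x. The momentum Im ∫ ū u_x changes at the rate |u_x(0)|² + ∫ n (|u|²)_x, with the same
coupling and a boundary term of favourable sign. Subtracting gives ∫ p(0,t)² dt ≤ 2 (M(τ) + M(0)),
whatever the length of the time interval, where M is quadratic in the energy norms. With -n p ≤ 4 n²
+ p²/16 this yields E(τ) ≤ E(0) + 4 ‖f‖² + (M(τ) + M(0))/8. The inequality ‖v‖₄⁴ ≤ 2 ‖v‖³ ‖v'‖ and
the conserved mass bound ∫ n|u|², and the term M(τ)/8 is absorbed on the left (`norm_sq_bound`).

Since p has no trace, boundary terms are produced by the weight χ = 1 - exp(-r x), which vanishes at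
0, with r → ∞: they are integrals against χ' = r exp(-r x). For n² these are bounded in the limit by
‖f‖² (`flux_le`); wherever χ' or 1 - χ meets u they tend to zero (`norm_dX_val_le`, `tendsto_W`).

The solution is too rough for direct differentiation. The energy of u is treated by difference
quotients in time (`energyU_increment`). The momentum of u and the wave identities use the operator
(1 - δ∂)⁻¹, which needs no boundary condition at 0 (`momentum_increment`, `wave_energy_increment`,
`wave_momentum_increment`). All equations are read in the dual of H¹₀ (`IsSystem`). -/

/-- `f` is on `[0, ∞)` the primitive of `f'` with value `c` at `0`. -/
structure IsPrim (c : ℝ) (f f' : ℝ → ℝ) : Prop where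
  locInt : ∀ x, 0 ≤ x → IntervalIntegrable f' volume 0 x
  eq : ∀ x, 0 ≤ x → f x = c + ∫ y in 0..x, f' y

/-! ### Primitives of locally integrable functions on the half line -/

namespace IsPrim

variable {c d : ℝ} {f f' g g' : ℝ → ℝ}

theorem abs_cont (h : IsPrim c f f') {x : ℝ} (hx : 0 ≤ x) :
    AbsolutelyContinuousOnInterval (fun x => c + ∫ y in 0..x, f' y) 0 x := by
  refine AbsolutelyContinuousOnInterval.fun_add ?_
    ((h.locInt x hx).absolutelyContinuousOnInterval_intervalIntegral (by simp))
  exact ((LipschitzWith.const c).lipschitzOnWith).absolutelyContinuousOnInterval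

theorem continuousOn (h : IsPrim c f f') : ContinuousOn f (Ici 0) := by
  intro x hx
  have h1 : ContinuousOn (fun x => c + ∫ y in 0..x, f' y) (Icc 0 (x + 1)) := by
    have := (h.abs_cont (x := x + 1) (by simp at hx; linarith)).continuousOn
    rwa [uIcc_of_le (by simp at hx; linarith)] at this
  have h2 : ContinuousOn f (Icc 0 (x + 1)) := h1.congr fun y hy => h.eq y hy.1
  refine (h2 x ⟨hx, by linarith⟩).mono_of_mem_nhdsWithin ?_
  rw [← Ici_inter_Iic, inter_comm]
  exact inter_mem_nhdsWithin' x (Iic_mem_nhds (by linarith))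
where
  inter_mem_nhdsWithin' (x : ℝ) {s t : Set ℝ} (h : t ∈ 𝓝 x) : t ∩ s ∈ 𝓝[s] x :=
    inter_mem (mem_nhdsWithin_of_mem_nhds h) self_mem_nhdsWithin

theorem mul (hf : IsPrim c f f') (hg : IsPrim d g g') :
    IsPrim (c * d) (fun x => f x * g x) (fun x => f' x * g x + f x * g' x) := by
  have cont : ∀ {c f f'}, IsPrim c f f' → ∀ x, 0 ≤ x → ContinuousOn f (uIcc 0 x) := by
    intro c f f' h x hx
    rw [uIcc_of_le hx]
    exact h.continuousOn.mono Icc_subset_Ici_self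
  refine ⟨fun x hx => ((hf.locInt x hx).mul_continuousOn (cont hg x hx)).add
    ((hg.locInt x hx).continuousOn_mul (cont hf x hx)), fun x hx => ?_⟩
  have key := (hf.abs_cont hx).integral_deriv_mul_eq_sub (hg.abs_cont hx)
  have : ∫ y in 0..x, (f' y * g y + f y * g' y) = f x * g x - c * d := by
    rw [hf.eq x hx, hg.eq x hx]
    simp only [intervalIntegral.integral_same, add_zero] at key
    rw [← key]
    refine intervalIntegral.integral_congr_ae ?_
    filter_upwards [(hf.locInt x hx).ae_hasDerivAt_integral,
      (hg.locInt x hx).ae_hasDerivAt_integral] with y h1 h2 hy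
    have hy' : y ∈ uIcc 0 x := uIoc_subset_uIcc hy
    have hy0 : 0 ≤ y := by rw [uIcc_of_le hx] at hy'; exact hy'.1
    rw [((h1 hy' 0 (by simp)).const_add c).deriv, ((h2 hy' 0 (by simp)).const_add d).deriv,
      hf.eq y hy0, hg.eq y hy0]
  rw [this]; ring

theorem of_hasDerivAt (h : ∀ x, HasDerivAt f (f' x) x) (hc : Continuous f') :
    IsPrim (f 0) f f' :=
  ⟨fun _ _ => hc.intervalIntegrable _ _, fun x _ => by
    rw [intervalIntegral.integral_eq_sub_of_hasDerivAt (fun y _ => h y)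
      (hc.intervalIntegrable _ _)]; ring⟩

theorem add (hf : IsPrim c f f') (hg : IsPrim d g g') :
    IsPrim (c + d) (fun x => f x + g x) (fun x => f' x + g' x) :=
  ⟨fun x hx => (hf.locInt x hx).add (hg.locInt x hx), fun x hx => by
    rw [hf.eq x hx, hg.eq x hx,
      intervalIntegral.integral_add (hf.locInt x hx) (hg.locInt x hx)]; ring⟩

theorem const_mul (hf : IsPrim c f f') (r : ℝ) :
    IsPrim (r * c) (fun x => r * f x) (fun x => r * f' x) :=
  ⟨fun x hx => (hf.locInt x hx).const_mul r, fun x hx => by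
    rw [hf.eq x hx, intervalIntegral.integral_const_mul]; ring⟩

theorem congr_deriv (hf : IsPrim c f f') (h : f' =ᵐ[volume.restrict (Ioi 0)] g') :
    IsPrim c f g' := by
  have h' : ∀ x, 0 ≤ x → f' =ᵐ[volume.restrict (uIoc 0 x)] g' := fun x hx => by
    rw [uIoc_of_le hx]
    exact ae_restrict_of_ae_restrict_of_subset Ioc_subset_Ioi_self h
  refine ⟨fun x hx => (hf.locInt x hx).congr_ae (h' x hx), fun x hx => ?_⟩
  rw [hf.eq x hx, intervalIntegral.integral_congr_ae_restrict (h' x hx)]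

/-- An integrable function with integrable derivative vanishes at infinity. -/
theorem integral_deriv (hf : IsPrim c f f') (hi : IntegrableOn f (Ioi 0))
    (hi' : IntegrableOn f' (Ioi 0)) : ∫ x in Ioi 0, f' x = -c := by
  have h1 := intervalIntegral_tendsto_integral_Ioi 0 hi' tendsto_id
  have h2 : Tendsto f atTop (𝓝 (c + ∫ x in Ioi 0, f' x)) := by
    refine (h1.const_add c).congr' ?_
    filter_upwards [eventually_ge_atTop 0] with x hx
    rw [hf.eq x hx]; rfl
  -- `f` has a limit at infinity, and a nonzero limit would contradict integrability.
  have h3 : c + ∫ x in Ioi 0, f' x = 0 := by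
    by_contra hL
    set L := c + ∫ x in Ioi 0, f' x
    have : ∀ᶠ x in atTop, |L| / 2 < ‖f x‖ := by
      have := h2.norm
      exact this.eventually (lt_mem_nhds (by
        rw [Real.norm_eq_abs]; have := abs_pos.2 hL; linarith))
    obtain ⟨X, hX⟩ := (this.and (eventually_ge_atTop 0)).exists_forall_of_atTop
    have hfin : IntegrableOn (fun _ : ℝ => |L| / 2) (Ioi X) := by
      refine Integrable.mono (hi.mono_set (Ioi_subset_Ioi (hX X le_rfl).2))
        aestronglyMeasurable_const ?_
      filter_upwards [ae_restrict_mem measurableSet_Ioi] with x hx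
      rw [Real.norm_of_nonneg (by positivity)]
      exact (hX x (le_of_lt hx)).1.le
    rw [integrableOn_const_iff] at hfin
    simp [hL] at hfin
  linarith

end IsPrim

/-! ### Test functions on the half line -/

section TestFunctions

theorem test_support (φ : 𝓓(halfLine, ℝ)) :
    ∃ a b : ℝ, 0 < a ∧ a ≤ b ∧ ∀ x, x ∉ Icc a b → φ x = 0 := by
  rcases (tsupport φ).eq_empty_or_nonempty with h | h
  · exact ⟨1, 1, one_pos, le_rfl, fun x _ => by
      have := tsupport_eq_empty_iff.1 h
      rw [this]; rfl⟩
  · have hc : IsCompact (tsupport φ) := φ.hasCompactSupport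
    obtain ⟨a, ha, ha'⟩ := hc.exists_isLeast h
    obtain ⟨b, hb, hb'⟩ := hc.exists_isGreatest h
    refine ⟨a, b, φ.tsupport_subset ha, ha' hb, fun x hx => ?_⟩
    by_contra hne
    have : x ∈ tsupport φ := subset_tsupport _ hne
    exact hx ⟨ha' this, hb' this⟩

/-- A smooth function supported in a compact subset of the half line, as a test function. -/
def mkTest (f : ℝ → ℝ) (hf : ContDiff ℝ (⊤ : ℕ∞) f) (a b : ℝ) (ha : 0 < a)
    (h : ∀ x, x ∉ Icc a b → f x = 0) : 𝓓(halfLine, ℝ) where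
  toFun := f
  contDiff' := hf
  hasCompactSupport' := HasCompactSupport.intro isCompact_Icc (fun x hx => h x hx)
  tsupport_subset' := by
    have : tsupport f ⊆ Icc a b := closure_minimal
      (fun x hx => by by_contra hn; exact hx (h x hn)) isClosed_Icc
    exact this.trans fun x hx => ha.trans_le hx.1

theorem coe_mkTest (f : ℝ → ℝ) (hf a b ha h) :
    (mkTest f hf a b ha h : ℝ → ℝ) = f := rfl

theorem test_differentiable (φ : 𝓓(halfLine, ℝ)) : Differentiable ℝ φ :=
  φ.contDiff.differentiable (by simp)

theorem test_contDiff_deriv (φ : 𝓓(halfLine, ℝ)) : ContDiff ℝ (⊤ : ℕ∞) (deriv φ) := by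
  have := φ.contDiff
  exact (contDiff_infty_iff_deriv.1 this).2

theorem test_deriv_zero {φ : 𝓓(halfLine, ℝ)} {a b : ℝ} (h : ∀ x, x ∉ Icc a b → φ x = 0) :
    ∀ x, x ∉ Icc a b → deriv φ x = 0 := by
  intro x hx
  have : φ =ᶠ[𝓝 x] fun _ => 0 := by
    filter_upwards [isClosed_Icc.isOpen_compl.mem_nhds hx] with y hy using h y hy
  rw [this.deriv_eq, deriv_const]

/-- The derivative of a test function. -/
def derivTest (φ : 𝓓(halfLine, ℝ)) : 𝓓(halfLine, ℝ) :=
  mkTest (deriv φ) (test_contDiff_deriv φ) (test_support φ).choose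
    (test_support φ).choose_spec.choose (test_support φ).choose_spec.choose_spec.1
    (test_deriv_zero (test_support φ).choose_spec.choose_spec.2.2)

theorem coe_derivTest (φ : 𝓓(halfLine, ℝ)) : (derivTest φ : ℝ → ℝ) = deriv φ := rfl

theorem test_zero (φ : 𝓓(halfLine, ℝ)) {x : ℝ} (hx : x ≤ 0) : φ x = 0 := by
  obtain ⟨a, b, ha, -, h⟩ := test_support φ
  exact h x fun hx' => by linarith [hx'.1]

theorem test_isPrim (φ : 𝓓(halfLine, ℝ)) : IsPrim 0 φ (deriv φ) := by
  have := IsPrim.of_hasDerivAt (f := φ) (f' := deriv φ)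
    (fun x => (test_differentiable φ x).hasDerivAt) (test_contDiff_deriv φ).continuous
  rwa [test_zero φ le_rfl] at this

theorem test_integrable (φ : 𝓓(halfLine, ℝ)) : Integrable φ :=
  φ.continuous.integrable_of_hasCompactSupport φ.hasCompactSupport

theorem test_memL2 (φ : 𝓓(halfLine, ℝ)) : MemLp φ 2 (volume.restrict (Ioi 0)) :=
  (φ.continuous.memLp_of_hasCompactSupport φ.hasCompactSupport).restrict _

theorem setIntegral_test_mul (φ : 𝓓(halfLine, ℝ)) (g : ℝ → ℝ) :
    ∫ x in Ioi 0, φ x * g x = ∫ x, φ x * g x := by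
  refine setIntegral_eq_integral_of_forall_compl_eq_zero fun x hx => ?_
  rw [test_zero φ (not_lt.1 hx), zero_mul]

theorem setIntegral_test (φ : 𝓓(halfLine, ℝ)) : ∫ x in Ioi 0, φ x = ∫ x, φ x := by
  refine setIntegral_eq_integral_of_forall_compl_eq_zero fun x hx => ?_
  rw [test_zero φ (not_lt.1 hx)]

/-- The primitive from 0 vanishes to the left of the support, and to the right of it because the
total integral is zero; hence its support is again compact in the open half line. -/
theorem exists_antideriv (φ : 𝓓(halfLine, ℝ)) (h0 : ∫ x in Ioi 0, φ x = 0) :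
    ∃ Φ : 𝓓(halfLine, ℝ), deriv Φ = φ := by
  obtain ⟨a, b, ha, hab, h⟩ := test_support φ
  have hd : ∀ x, HasDerivAt (fun x => ∫ y in 0..x, φ y) (φ x) x := fun x =>
    intervalIntegral.integral_hasDerivAt_right (φ.continuous.intervalIntegrable _ _)
      (φ.continuous.stronglyMeasurableAtFilter _ _) φ.continuous.continuousAt
  have hde : deriv (fun x => ∫ y in 0..x, φ y) = φ := funext fun x => (hd x).deriv
  refine ⟨mkTest (fun x => ∫ y in 0..x, φ y) ?_ a b ha ?_, ?_⟩
  · rw [contDiff_infty_iff_deriv, hde]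
    exact ⟨fun x => (hd x).differentiableAt, φ.contDiff⟩
  · intro x hx
    rcases lt_or_ge x a with h1 | h1
    · refine intervalIntegral.integral_zero_ae (Eventually.of_forall fun y hy => h y fun hy' => ?_)
      have : y ≤ max 0 x := hy.2
      rcases le_max_iff.1 this with h2 | h2 <;> linarith [hy'.1]
    · have hxb : b < x := by by_contra hn; exact hx ⟨h1, not_lt.1 hn⟩
      have hx0 : 0 ≤ x := by linarith
      rw [intervalIntegral.integral_of_le hx0]
      refine Eq.trans (setIntegral_eq_of_subset_of_forall_sdiff_eq_zero measurableSet_Ioi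
        Ioc_subset_Ioi_self fun y hy => h y fun hy' => hy.2 ⟨hy.1, ?_⟩).symm h0
      exact hy'.2.trans hxb.le
  · rw [coe_mkTest, hde]

theorem exists_test_integral_one : ∃ θ : 𝓓(halfLine, ℝ), ∫ x in Ioi 0, θ x = 1 := by
  let B : ContDiffBump (2 : ℝ) := ⟨1 / 2, 1, by norm_num, by norm_num⟩
  have hsm : ContDiff ℝ (⊤ : ℕ∞) (B.normed volume) := B.contDiff_normed
  refine ⟨mkTest (B.normed volume) hsm 1 3 one_pos ?_, ?_⟩
  · intro x hx
    have : x ∉ Function.support (B.normed volume) := by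
      rw [B.support_normed_eq]
      intro hx'
      rw [Real.ball_eq_Ioo] at hx'
      exact hx ⟨by have := hx'.1; simp [B] at this; linarith,
        by have := hx'.2; simp [B] at this; linarith⟩
    simpa using this
  · rw [setIntegral_test]
    exact B.integral_normed

/-- A test function rescaled so as to preserve the integral. -/
def scaleTest (θ : 𝓓(halfLine, ℝ)) (R : ℝ) (hR : 0 < R) : 𝓓(halfLine, ℝ) :=
  mkTest (fun x => R⁻¹ * θ (R⁻¹ * x))
    (contDiff_const.mul (θ.contDiff.comp (contDiff_const.mul contDiff_id)))
    (R * (test_support θ).choose) (R * (test_support θ).choose_spec.choose)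
    (mul_pos hR (test_support θ).choose_spec.choose_spec.1) (by
      intro x hx
      rw [(test_support θ).choose_spec.choose_spec.2.2, mul_zero]
      intro hx'
      apply hx
      have e : x = R * (R⁻¹ * x) := by field_simp
      rw [e]
      exact ⟨mul_le_mul_of_nonneg_left hx'.1 hR.le, mul_le_mul_of_nonneg_left hx'.2 hR.le⟩)

theorem integral_scaleTest (θ : 𝓓(halfLine, ℝ)) (R : ℝ) (hR : 0 < R) :
    ∫ x in Ioi 0, scaleTest θ R hR x = ∫ x in Ioi 0, θ x := by
  rw [setIntegral_test, setIntegral_test]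
  change ∫ x, R⁻¹ * θ (R⁻¹ * x) = _
  rw [integral_const_mul, Measure.integral_comp_mul_left]
  simp [abs_of_pos hR]
  field_simp

theorem deriv_scaleTest (θ : 𝓓(halfLine, ℝ)) (R : ℝ) (hR : 0 < R) (x : ℝ) :
    deriv (scaleTest θ R hR) x = R⁻¹ * (R⁻¹ * deriv θ (R⁻¹ * x)) := by
  have h1 : HasDerivAt θ (deriv θ (R⁻¹ * x)) (R⁻¹ * x) := (test_differentiable θ _).hasDerivAt
  have h2 : HasDerivAt (fun x => R⁻¹ * x) R⁻¹ x := by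
    simpa using (hasDerivAt_id x).const_mul R⁻¹
  have := (h1.comp x h2).const_mul R⁻¹
  rw [show (scaleTest θ R hR : ℝ → ℝ) = fun x => R⁻¹ * θ (R⁻¹ * x) from rfl]
  rw [show (fun x => R⁻¹ * θ (R⁻¹ * x)) = fun x => R⁻¹ * (⇑θ ∘ fun x => R⁻¹ * x) x from rfl,
    this.deriv]
  ring

theorem test_mul_integrableOn (φ : 𝓓(halfLine, ℝ)) {g : ℝ → ℝ}
    (hg : ∀ x, 0 ≤ x → IntervalIntegrable g volume 0 x) :
    IntegrableOn (fun x => φ x * g x) (Ioi 0) := by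
  obtain ⟨a, b, ha, hab, hs⟩ := test_support φ
  have h1 : IntegrableOn g (Ioc 0 b) :=
    (intervalIntegrable_iff_integrableOn_Ioc_of_le (by linarith)).1 (hg b (by linarith))
  have h2 : IntegrableOn (fun x => φ x * g x) (Ioc 0 b) := by
    obtain ⟨C, hC⟩ := φ.continuous.bounded_above_of_compact_support φ.hasCompactSupport
    exact h1.bdd_mul φ.continuous.aestronglyMeasurable (Eventually.of_forall hC)
  refine h2.of_forall_sdiff_eq_zero measurableSet_Ioi fun x hx => ?_
  rw [hs x fun hx' => hx.2 ⟨hx.1, hx'.2⟩, zero_mul]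

end TestFunctions

/-! ### Functions with a weak derivative -/

/-- Du Bois-Reymond: a function with vanishing weak derivative is constant. -/
theorem ae_const_of_weakDeriv_zero {g : ℝ → ℝ} (hg : ∀ x, 0 ≤ x → IntervalIntegrable g volume 0 x)
    (h : ∀ φ : 𝓓(halfLine, ℝ), ∫ x in Ioi 0, deriv φ x * g x = 0) :
    ∃ c, g =ᵐ[volume.restrict (Ioi 0)] fun _ => c := by
  have hloc : LocallyIntegrableOn g (Ioi 0) := by
    rw [locallyIntegrableOn_iff isOpen_Ioi.isLocallyClosed]
    intro k hk hkc
    obtain ⟨b, hb⟩ := hkc.bddAbove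
    have := (intervalIntegrable_iff_integrableOn_Ioc_of_le (le_max_left 0 b)).1
      (hg (max 0 b) (le_max_left _ _))
    exact this.mono_set fun x hx => ⟨hk hx, (hb hx).trans (le_max_right _ _)⟩
  have hint : ∀ φ : 𝓓(halfLine, ℝ), IntegrableOn (fun x => φ x * g x) (Ioi 0) :=
    fun φ => test_mul_integrableOn φ hg
  obtain ⟨θ, hθ⟩ := exists_test_integral_one
  set c := ∫ x in Ioi 0, θ x * g x with hc
  refine ⟨c, ?_⟩
  -- Subtracting a multiple of the unit mass function `θ` makes the mean zero, so that the
  -- difference is the derivative of a test function.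
  have hmean : ∀ η : 𝓓(halfLine, ℝ), ∫ x in Ioi 0, η x * (g x - c) = 0 := by
    intro η
    set m := ∫ x in Ioi 0, η x
    have hζ0 : ∫ x in Ioi 0, (η - m • θ) x = 0 := by
      simp only [FunLike.coe_sub, FunLike.coe_smul, Pi.sub_apply, Pi.smul_apply,
        smul_eq_mul]
      rw [integral_sub (test_integrable η).integrableOn
        ((test_integrable θ).integrableOn.const_mul m), integral_const_mul, hθ]
      simp [m]
    obtain ⟨Φ, hΦ⟩ := exists_antideriv _ hζ0
    have h1 := h Φ
    rw [hΦ] at h1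
    have h2 : ∫ x in Ioi 0, (η x * g x - m * (θ x * g x)) = 0 := by
      refine Eq.trans (integral_congr_ae (Eventually.of_forall fun x => ?_)) h1
      simp only [FunLike.coe_sub, FunLike.coe_smul, Pi.sub_apply, Pi.smul_apply,
        smul_eq_mul]
      ring
    rw [integral_sub (hint η) ((hint θ).const_mul m), integral_const_mul, ← hc] at h2
    simp_rw [mul_sub]
    rw [integral_sub (hint η) ((test_integrable η).integrableOn.mul_const c), integral_mul_const]
    exact h2
  have := isOpen_Ioi.ae_eq_zero_of_integral_contDiff_smul_eq_zero (μ := volume)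
    (f := fun x => g x - c) (hloc.sub ((locallyIntegrable_const c).locallyIntegrableOn _)) (by
      intro η h1 h2 h3
      let η' : 𝓓(halfLine, ℝ) := ⟨η, h1, h2, h3⟩
      have := hmean η'
      rw [setIntegral_test_mul] at this
      exact this)
  rw [EventuallyEq, ae_restrict_iff' measurableSet_Ioi]
  filter_upwards [this] with x hx hx0
  linarith [hx hx0]

/-- A function with a locally integrable weak derivative is a primitive of it. -/
theorem ae_eq_prim_of_weakDeriv {z z' : ℝ → ℝ}
    (hz : ∀ x, 0 ≤ x → IntervalIntegrable z volume 0 x)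
    (hz' : ∀ x, 0 ≤ x → IntervalIntegrable z' volume 0 x)
    (h : ∀ φ : 𝓓(halfLine, ℝ), ∫ x in Ioi 0, deriv φ x * z x = -∫ x in Ioi 0, φ x * z' x) :
    ∃ c, z =ᵐ[volume.restrict (Ioi 0)] fun x => c + ∫ y in 0..x, z' y := by
  have hP : IsPrim 0 (fun x => ∫ y in 0..x, z' y) z' := ⟨hz', fun x _ => by simp⟩
  have hPint : ∀ x, 0 ≤ x → IntervalIntegrable (fun x => ∫ y in 0..x, z' y) volume 0 x := by
    intro x hx
    refine (hP.continuousOn.mono ?_).intervalIntegrable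
    rw [uIcc_of_le hx]; exact Icc_subset_Ici_self
  have hb : ∀ (φ : 𝓓(halfLine, ℝ)) (w : ℝ → ℝ),
      (∀ x, 0 ≤ x → IntervalIntegrable w volume 0 x) →
      IntegrableOn (fun x => φ x * w x) (Ioi 0) := fun φ w hw => test_mul_integrableOn φ hw
  obtain ⟨c, hc⟩ := ae_const_of_weakDeriv_zero (g := fun x => z x - ∫ y in 0..x, z' y)
    (fun x hx => (hz x hx).sub (hPint x hx)) (fun φ => by
      have h1 := ((test_isPrim φ).mul hP).integral_deriv (hb φ _ hPint)
        ((hb (derivTest φ) _ hPint).add (hb φ _ hz'))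
      replace h1 := (integral_add (hb (derivTest φ) _ hPint) (hb φ _ hz')).symm.trans h1
      simp_rw [mul_sub]
      refine (integral_sub (hb (derivTest φ) _ hz) (hb (derivTest φ) _ hPint)).trans ?_
      simp only [coe_derivTest] at h1 ⊢
      rw [h φ]
      linarith)
  refine ⟨c, ?_⟩
  filter_upwards [hc] with x hx
  linarith

/-! ### The spaces L² and H¹₀ -/

/-- Lebesgue measure on the half line. -/
abbrev hlMeasure : Measure ℝ := volume.restrict (Ioi (0 : ℝ))

/-- Real valued square integrable functions on the half line. -/
abbrev L2 : Type := Lp ℝ 2 hlMeasure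

theorem memLp_locInt {w : ℝ → ℝ} (hw : MemLp w 2 hlMeasure) {x : ℝ} (hx : 0 ≤ x) :
    IntervalIntegrable w volume 0 x := by
  rw [intervalIntegrable_iff_integrableOn_Ioc_of_le hx]
  have h : MemLp w 2 (volume.restrict (Ioc 0 x)) :=
    hw.mono_measure (Measure.restrict_mono Ioc_subset_Ioi_self le_rfl)
  exact h.integrable (by norm_num)

theorem L2.locInt (w : L2) {x : ℝ} (hx : 0 ≤ x) : IntervalIntegrable w volume 0 x :=
  memLp_locInt (Lp.memLp w) hx

theorem L2.inner_eq (f g : L2) : inner ℝ f g = ∫ x in Ioi 0, f x * g x := by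
  rw [L2.inner_def]
  refine integral_congr_ae (Eventually.of_forall fun x => ?_)
  simp [mul_comm]

theorem L2.integrable_mul (f g : L2) : IntegrableOn (fun x => f x * g x) (Ioi 0) :=
  (Lp.memLp f).integrable_mul (Lp.memLp g)

theorem L2.norm_sq (f : L2) : ‖f‖ ^ 2 = ∫ x in Ioi 0, f x ^ 2 := by
  rw [← real_inner_self_eq_norm_sq, L2.inner_eq]
  simp only [sq]

theorem L2.integral_abs_mul_le (f g : L2) : ∫ x in Ioi 0, |f x * g x| ≤ ‖f‖ * ‖g‖ := by
  have h := real_inner_le_norm |f| |g|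
  rw [norm_abs_eq_norm, norm_abs_eq_norm, L2.inner_eq] at h
  refine le_trans (le_of_eq (integral_congr_ae ?_)) h
  filter_upwards [Lp.coeFn_abs f, Lp.coeFn_abs g] with x h1 h2
  rw [h1, h2, abs_mul]

/-- `H¹₀` of the half line, as the space of pairs `(v, v')` of square integrable functions such that
`v` is the primitive of `v'` vanishing at `0`. -/
def h10 : Submodule ℝ (L2 × L2) where
  carrier := {v | v.1 =ᵐ[hlMeasure] fun x => ∫ y in 0..x, v.2 y}
  zero_mem' := by
    have h0 : (fun y => (0 : L2) y) =ᵐ[hlMeasure] fun _ => 0 := Lp.coeFn_zero _ _ _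
    have : IsPrim 0 (fun _ => 0) (fun y => (0 : L2) y) := by
      refine IsPrim.congr_deriv (f' := fun _ => 0) ⟨fun x _ => by simp, fun x _ => by simp⟩ h0.symm
    filter_upwards [h0, ae_restrict_mem measurableSet_Ioi] with x hx hx0
    have h := this.eq x (le_of_lt hx0)
    simp only [Prod.fst_zero, Prod.snd_zero]
    rw [hx]; simpa using h
  add_mem' := by
    rintro ⟨a, a'⟩ ⟨b, b'⟩ ha hb
    simp only [mem_ofPred_eq, Prod.mk_add_mk] at *
    have h := (IsPrim.add (c := 0) (d := 0) ⟨fun x hx => a'.locInt hx, fun x _ => (zero_add _).symm⟩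
      ⟨fun x hx => b'.locInt hx, fun x _ => (zero_add _).symm⟩).congr_deriv
        (Lp.coeFn_add a' b').symm
    filter_upwards [ha, hb, Lp.coeFn_add a b, ae_restrict_mem measurableSet_Ioi] with x h1 h2 h3 hx0
    have := h.eq x (le_of_lt hx0)
    rw [h3, Pi.add_apply, h1, h2]; simpa using this
  smul_mem' := by
    rintro r ⟨a, a'⟩ ha
    simp only [mem_ofPred_eq, Prod.smul_mk] at *
    have h := (IsPrim.const_mul (c := 0)
      ⟨fun x hx => a'.locInt hx, fun x _ => (zero_add _).symm⟩ r).congr_deriv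
        (Lp.coeFn_smul r a').symm
    filter_upwards [ha, Lp.coeFn_smul r a, ae_restrict_mem measurableSet_Ioi] with x h1 h3 hx0
    have := h.eq x (le_of_lt hx0)
    rw [h3, Pi.smul_apply, h1]; simpa using this

/-- The normed space `H¹₀` of the half line. -/
def H10 : Type := h10

instance : NormedAddCommGroup H10 := inferInstanceAs (NormedAddCommGroup h10)
instance : NormedSpace ℝ H10 := inferInstanceAs (NormedSpace ℝ h10)

/-- The element of `H¹₀` given by a pair of square integrable functions. -/
def H10.mk (z z' : L2) (h : (z, z') ∈ h10) : H10 := ⟨(z, z'), h⟩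

/-- `z ∈ L²` is the primitive of `z' ∈ L²` with value `c` at `0`. -/
def HasPrim (c : ℝ) (z z' : L2) : Prop := z =ᵐ[hlMeasure] fun x => c + ∫ y in 0..x, z' y

theorem L2.isPrim (c : ℝ) (z' : L2) : IsPrim c (fun x => c + ∫ y in 0..x, z' y) z' :=
  ⟨fun _ hx => z'.locInt hx, fun _ _ => rfl⟩

theorem mem_h10_iff (z z' : L2) : (z, z') ∈ h10 ↔ HasPrim 0 z z' := by
  unfold HasPrim
  simp only [zero_add]; rfl

theorem hasPrim_of_isPrim {c : ℝ} {z z' : L2} {f f' : ℝ → ℝ} (h : IsPrim c f f')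
    (hz : z =ᵐ[hlMeasure] f) (hz' : z' =ᵐ[hlMeasure] f') : HasPrim c z z' := by
  have := h.congr_deriv hz'.symm
  filter_upwards [hz, ae_restrict_mem measurableSet_Ioi] with x h1 hx0
  rw [h1, this.eq x (le_of_lt hx0)]

/-- The product of the two primitives is integrable with integrable derivative, so it vanishes at
infinity and only its value `c * d` at 0 remains. -/
theorem HasPrim.weakDeriv_aux {c d : ℝ} {z z' v v' : L2} (hz : HasPrim c z z')
    (hv : HasPrim d v v') : inner ℝ z v' = -inner ℝ z' v - c * d := by
  have h := (L2.isPrim c z').mul (L2.isPrim d v')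
  have e : (fun x => z' x * v x + z x * v' x) =ᵐ[hlMeasure]
      (fun x => z' x * (d + ∫ y in 0..x, v' y) + (c + ∫ y in 0..x, z' y) * v' x) := by
    filter_upwards [hz, hv] with x h1 h2
    rw [h1, h2]
  have e2 : (fun x => z x * v x) =ᵐ[hlMeasure]
      (fun x => (c + ∫ y in 0..x, z' y) * (d + ∫ y in 0..x, v' y)) := by
    filter_upwards [hz, hv] with x h1 h2
    rw [h1, h2]
  have i1 := L2.integrable_mul z' v
  have i2 := L2.integrable_mul z v'
  have key := h.integral_deriv ((L2.integrable_mul z v).congr e2) ((i1.add i2).congr e)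
  rw [← integral_congr_ae e, integral_add i1 i2, ← L2.inner_eq, ← L2.inner_eq] at key
  linarith

/-- The inclusion of `H¹₀` in `L²`. -/
def H10.val : H10 →L[ℝ] L2 :=
  ((ContinuousLinearMap.fst ℝ L2 L2).comp h10.subtypeL : h10 →L[ℝ] L2)

/-- The derivative on `H¹₀`. -/
def H10.D : H10 →L[ℝ] L2 :=
  ((ContinuousLinearMap.snd ℝ L2 L2).comp h10.subtypeL : h10 →L[ℝ] L2)

open H10 in
theorem H10.hasPrim (v : H10) : HasPrim 0 (val v) (D v) := (mem_h10_iff _ _).1 v.2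

@[simp] theorem H10.val_mk (z z' : L2) (h : (z, z') ∈ h10) : H10.val (H10.mk z z' h) = z := rfl
@[simp] theorem H10.D_mk (z z' : L2) (h : (z, z') ∈ h10) : H10.D (H10.mk z z' h) = z' := rfl

theorem H10.ext {v w : H10} (h1 : H10.val v = H10.val w) (h2 : H10.D v = H10.D w) : v = w :=
  Subtype.ext (Prod.ext h1 h2)

theorem H10.norm_val_le (v : H10) : ‖H10.val v‖ ≤ ‖v‖ := norm_fst_le v.1
theorem H10.norm_D_le (v : H10) : ‖H10.D v‖ ≤ ‖v‖ := norm_snd_le v.1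
theorem H10.norm_le_of {v : H10} {C : ℝ} (h1 : ‖H10.val v‖ ≤ C) (h2 : ‖H10.D v‖ ≤ C) : ‖v‖ ≤ C :=
  max_le h1 h2

/-- Because `v` vanishes at 0, the boundary value `c` does not enter. This makes H¹₀ the right test
space for quantities without controlled boundary values. -/
theorem HasPrim.inner_D {c : ℝ} {z z' : L2} (h : HasPrim c z z') (v : H10) :
    inner ℝ z (H10.D v) = -inner ℝ z' (H10.val v) := by
  simpa using h.weakDeriv_aux v.hasPrim

theorem H10.inner_val_D_self (v : H10) : inner ℝ (H10.val v) (H10.D v) = 0 := by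
  have := v.hasPrim.inner_D v
  rw [real_inner_comm (H10.val v) (H10.D v)] at this
  linarith

/-- The element of `L²` given by a test function. -/
def testL2 (φ : 𝓓(halfLine, ℝ)) : L2 := (test_memL2 φ).toLp φ

theorem coeFn_testL2 (φ : 𝓓(halfLine, ℝ)) : testL2 φ =ᵐ[hlMeasure] φ := MemLp.coeFn_toLp _

/-- The element of `H¹₀` given by a test function. -/
def testH (φ : 𝓓(halfLine, ℝ)) : H10 :=
  H10.mk (testL2 φ) (testL2 (derivTest φ)) ((mem_h10_iff _ _).2
    (hasPrim_of_isPrim (test_isPrim φ) (coeFn_testL2 φ) (coeFn_testL2 (derivTest φ))))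

@[simp] theorem val_testH (φ : 𝓓(halfLine, ℝ)) : H10.val (testH φ) = testL2 φ := rfl
@[simp] theorem D_testH (φ : 𝓓(halfLine, ℝ)) : H10.D (testH φ) = testL2 (derivTest φ) := rfl

theorem inner_testL2 (f : L2) (φ : 𝓓(halfLine, ℝ)) :
    inner ℝ f (testL2 φ) = ∫ x in Ioi 0, f x * φ x := by
  rw [L2.inner_eq]
  refine integral_congr_ae ?_
  filter_upwards [coeFn_testL2 φ] with x hx
  rw [hx]

/-- Square integrable functions with square integrable weak derivative are primitives. -/
theorem exists_hasPrim {z z' : L2}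
    (h : ∀ φ : 𝓓(halfLine, ℝ), inner ℝ z (H10.D (testH φ)) = -inner ℝ z' (H10.val (testH φ))) :
    ∃ c, HasPrim c z z' := by
  refine ae_eq_prim_of_weakDeriv (fun x hx => z.locInt hx) (fun x hx => z'.locInt hx) fun φ => ?_
  have := h φ
  rw [val_testH, D_testH, inner_testL2, inner_testL2] at this
  simp_rw [mul_comm _ (z _), mul_comm _ (z' _)]
  exact this

/-- The square of `v` is the integral of 2 v v' from 0; Cauchy–Schwarz does the rest. -/
theorem H10.sq_le (v : H10) {x : ℝ} (hx : 0 ≤ x) :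
    (∫ y in 0..x, H10.D v y) ^ 2 ≤ 2 * ‖H10.val v‖ * ‖H10.D v‖ := by
  have h := ((L2.isPrim 0 (H10.D v)).mul (L2.isPrim 0 (H10.D v))).eq x hx
  simp only [zero_add, mul_zero] at h
  rw [sq, h, intervalIntegral.integral_of_le hx]
  have e : ∀ᵐ x ∂hlMeasure, (H10.D v x * ∫ y in 0..x, H10.D v y) +
      (∫ y in 0..x, H10.D v y) * H10.D v x = 2 * (H10.val v x * H10.D v x) := by
    filter_upwards [v.hasPrim] with x hx
    rw [zero_add] at hx
    rw [hx]; ring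
  rw [integral_congr_ae (ae_restrict_of_ae_restrict_of_subset Ioc_subset_Ioi_self e),
    integral_const_mul, mul_assoc]
  refine mul_le_mul_of_nonneg_left ?_ zero_le_two
  refine le_trans ?_ (L2.integral_abs_mul_le (H10.val v) (H10.D v))
  refine (le_abs_self _).trans (abs_integral_le_integral_abs.trans ?_)
  exact setIntegral_mono_set (L2.integrable_mul _ _).abs
    (Eventually.of_forall fun x => abs_nonneg _) Ioc_subset_Ioi_self.eventuallyLE

theorem H10.ae_sq_le (v : H10) :
    ∀ᵐ x ∂hlMeasure, (H10.val v x) ^ 2 ≤ 2 * ‖H10.val v‖ * ‖H10.D v‖ := by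
  filter_upwards [v.hasPrim, ae_restrict_mem measurableSet_Ioi] with x h1 hx
  rw [h1, zero_add]
  exact v.sq_le (le_of_lt hx)

theorem H10.ae_abs_le (v : H10) : ∀ᵐ x ∂hlMeasure, ‖H10.val v x‖ ≤ √2 * ‖v‖ := by
  filter_upwards [v.ae_sq_le] with x h
  rw [Real.norm_eq_abs]
  refine abs_le_of_sq_le_sq ?_ (by positivity)
  rw [mul_pow, Real.sq_sqrt zero_le_two]
  refine h.trans ?_
  rw [mul_assoc, sq]
  exact mul_le_mul_of_nonneg_left (mul_le_mul v.norm_val_le v.norm_D_le (norm_nonneg _)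
    (norm_nonneg _)) zero_le_two

theorem H10.memLp_top (v : H10) : MemLp (H10.val v) ∞ hlMeasure :=
  memLp_top_of_bound (Lp.aestronglyMeasurable _) _ v.ae_abs_le

/-- The embedding of `H¹₀` in `L^∞`. -/
def H10.toLinf : H10 →L[ℝ] Lp ℝ ∞ hlMeasure :=
  LinearMap.mkContinuous
    { toFun := fun v => v.memLp_top.toLp _
      map_add' := fun v w => by
        refine Lp.ext ?_
        filter_upwards [(v + w).memLp_top.coeFn_toLp, v.memLp_top.coeFn_toLp,
          w.memLp_top.coeFn_toLp, Lp.coeFn_add (v.memLp_top.toLp _) (w.memLp_top.toLp _),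
          Lp.coeFn_add (H10.val v) (H10.val w)] with x h1 h2 h3 h4 h5
        rw [h1, h4, map_add, h5, Pi.add_apply, Pi.add_apply, h2, h3]
      map_smul' := fun r v => by
        refine Lp.ext ?_
        filter_upwards [(r • v).memLp_top.coeFn_toLp, v.memLp_top.coeFn_toLp,
          Lp.coeFn_smul r (v.memLp_top.toLp _), Lp.coeFn_smul r (H10.val v)] with x h1 h2 h4 h5
        rw [h1, RingHom.id_apply, h4, map_smul, h5, Pi.smul_apply, Pi.smul_apply, h2] }
    (√2) fun v => by
      change ‖v.memLp_top.toLp _‖ ≤ _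
      rw [Lp.norm_toLp]
      refine ENNReal.toReal_le_of_le_ofReal (by positivity) ?_
      rw [eLpNorm_exponent_top]
      exact eLpNormEssSup_le_of_ae_bound v.ae_abs_le

theorem H10.coeFn_toLinf (v : H10) : H10.toLinf v =ᵐ[hlMeasure] H10.val v :=
  v.memLp_top.coeFn_toLp

/-! ### Multiplication operators and the product on H¹₀ -/

/-- Multiplication of a square integrable function with a bounded function. -/
def mulL : Lp ℝ ∞ hlMeasure →L[ℝ] L2 →L[ℝ] L2 :=
  (ContinuousLinearMap.mul ℝ ℝ).holderL hlMeasure ∞ 2 2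

theorem coeFn_mulL (m : Lp ℝ ∞ hlMeasure) (y : L2) :
    mulL m y =ᵐ[hlMeasure] fun x => m x * y x :=
  (ContinuousLinearMap.mul ℝ ℝ).coeFn_holder m y

theorem inner_mulL (m : Lp ℝ ∞ hlMeasure) (y z : L2) :
    inner ℝ (mulL m y) z = inner ℝ y (mulL m z) := by
  rw [L2.inner_eq, L2.inner_eq]
  refine integral_congr_ae ?_
  filter_upwards [coeFn_mulL m y, coeFn_mulL m z] with x h1 h2
  rw [h1, h2]; ring

theorem mulL_comm (m k : Lp ℝ ∞ hlMeasure) (y : L2) :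
    mulL m (mulL k y) = mulL k (mulL m y) := by
  refine Lp.ext ?_
  filter_upwards [coeFn_mulL m y, coeFn_mulL k y, coeFn_mulL m (mulL k y),
    coeFn_mulL k (mulL m y)] with x h1 h2 h3 h4
  rw [h3, h4, h1, h2]; ring

/-- Multiplication of a square integrable function with an element of `H¹₀`. -/
def mulV : H10 →L[ℝ] L2 →L[ℝ] L2 := mulL.comp H10.toLinf

theorem mulV_eq (v : H10) : mulV v = mulL (H10.toLinf v) := rfl

theorem coeFn_mulV (v : H10) (y : L2) : mulV v y =ᵐ[hlMeasure] fun x => H10.val v x * y x := by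
  filter_upwards [coeFn_mulL (H10.toLinf v) y, v.coeFn_toLinf] with x h1 h2
  rw [mulV_eq, h1, h2]

theorem mulV_val_comm (v w : H10) : mulV v (H10.val w) = mulV w (H10.val v) := by
  refine Lp.ext ?_
  filter_upwards [coeFn_mulV v (H10.val w), coeFn_mulV w (H10.val v)] with x h1 h2
  rw [h1, h2, mul_comm]

theorem prod_mem (v w : H10) :
    (mulV v (H10.val w), mulV v (H10.D w) + mulV w (H10.D v)) ∈ h10 := by
  rw [mem_h10_iff]
  have h := (L2.isPrim 0 (H10.D v)).mul (L2.isPrim 0 (H10.D w))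
  rw [mul_zero] at h
  refine hasPrim_of_isPrim h ?_ ?_
  · filter_upwards [coeFn_mulV v (H10.val w), v.hasPrim, w.hasPrim] with x h1 h2 h3
    rw [h1, h2, h3]
  · filter_upwards [Lp.coeFn_add (mulV v (H10.D w)) (mulV w (H10.D v)), coeFn_mulV v (H10.D w),
      coeFn_mulV w (H10.D v), v.hasPrim, w.hasPrim] with x h0 h1 h2 h3 h4
    rw [h0, Pi.add_apply, h1, h2, h3, h4]; ring

/-- The product on `H¹₀`. -/
def prodV : H10 →L[ℝ] H10 →L[ℝ] H10 :=
  LinearMap.mkContinuous₂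
    (LinearMap.mk₂ ℝ (fun v w => H10.mk _ _ (prod_mem v w))
      (fun v v' w => H10.ext (by simp) (by simp; abel))
      (fun r v w => H10.ext (by simp) (by simp))
      (fun v w w' => H10.ext (by simp) (by simp; abel))
      (fun r v w => H10.ext (by simp) (by simp)))
    (2 * ‖mulV‖) (fun v w => by
      have h : ∀ (v : H10) (y : L2), ‖mulV v y‖ ≤ ‖mulV‖ * ‖v‖ * ‖y‖ := mulV.le_opNorm₂
      refine H10.norm_le_of ?_ ?_
      · change ‖mulV v (H10.val w)‖ ≤ _
        refine (h _ _).trans ?_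
        have := mul_le_mul_of_nonneg_left w.norm_val_le (by positivity : 0 ≤ ‖mulV‖ * ‖v‖)
        have h2 : 0 ≤ ‖mulV‖ * ‖v‖ * ‖w‖ := by positivity
        linarith
      · change ‖mulV v (H10.D w) + mulV w (H10.D v)‖ ≤ _
        refine (norm_add_le _ _).trans ((add_le_add (h _ _) (h _ _)).trans ?_)
        have h1 := mul_le_mul_of_nonneg_left w.norm_D_le (by positivity : 0 ≤ ‖mulV‖ * ‖v‖)
        have h2 := mul_le_mul_of_nonneg_left v.norm_D_le (by positivity : 0 ≤ ‖mulV‖ * ‖w‖)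
        linarith)

@[simp] theorem val_prodV (v w : H10) : H10.val (prodV v w) = mulV v (H10.val w) := rfl
@[simp] theorem D_prodV (v w : H10) :
    H10.D (prodV v w) = mulV v (H10.D w) + mulV w (H10.D v) := rfl

/-! ### Exponential weights concentrating at the boundary -/

section Weights

/-- The rate of the exponential weight. -/
def rate (k : ℕ) : ℝ := k + 1

theorem rate_pos (k : ℕ) : 0 < rate k := by unfold rate; positivity

theorem ae_expWeight_le (k : ℕ) : ∀ᵐ x ∂hlMeasure, ‖Real.exp (-(rate k * x))‖ ≤ 1 := by
  filter_upwards [ae_restrict_mem measurableSet_Ioi] with x hx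
  have hx : 0 < x := hx
  rw [Real.norm_of_nonneg (Real.exp_pos _).le, Real.exp_le_one_iff]
  have := mul_pos (rate_pos k) hx
  linarith

theorem expWeight_memLp (k : ℕ) : MemLp (fun x => Real.exp (-(rate k * x))) ∞ hlMeasure :=
  memLp_top_of_bound (by fun_prop) 1 (ae_expWeight_le k)

/-- Multiplication with the weight `exp (-rate k * x)`. -/
def W (k : ℕ) : L2 →L[ℝ] L2 := mulL ((expWeight_memLp k).toLp _)

theorem W_eq (k : ℕ) : W k = mulL ((expWeight_memLp k).toLp _) := rfl

theorem coeFn_W (k : ℕ) (y : L2) :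
    W k y =ᵐ[hlMeasure] fun x => Real.exp (-(rate k * x)) * y x := by
  filter_upwards [coeFn_mulL ((expWeight_memLp k).toLp _) y,
    (expWeight_memLp k).coeFn_toLp] with x h1 h2
  rw [W_eq, h1, h2]

theorem inner_W (k : ℕ) (y z : L2) : inner ℝ (W k y) z = inner ℝ y (W k z) := inner_mulL _ _ _

theorem W_mulV (k : ℕ) (v : H10) (y : L2) : W k (mulV v y) = mulV v (W k y) := mulL_comm _ _ _

theorem norm_W_le (k : ℕ) (y : L2) : ‖W k y‖ ≤ ‖y‖ := by
  refine Lp.norm_le_norm_of_ae_le ?_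
  filter_upwards [coeFn_W k y, ae_expWeight_le k] with x h1 h2
  rw [h1, norm_mul]
  exact mul_le_of_le_one_left (norm_nonneg _) h2

theorem inner_W_eq (k : ℕ) (y z : L2) :
    inner ℝ (W k y) z = ∫ x in Ioi 0, Real.exp (-(rate k * x)) * (y x * z x) := by
  rw [L2.inner_eq]
  refine integral_congr_ae ?_
  filter_upwards [coeFn_W k y] with x h1
  rw [h1, mul_assoc]

theorem inner_W_self_nonneg (k : ℕ) (y : L2) : 0 ≤ inner ℝ (W k y) y := by
  rw [inner_W_eq]
  refine integral_nonneg fun x => ?_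
  have := mul_self_nonneg (y x)
  positivity

theorem HasPrim.W {c : ℝ} {z z' : L2} (h : HasPrim c z z') (k : ℕ) :
    HasPrim c (W k z) (W k z' - rate k • W k z) := by
  have he : IsPrim 1 (fun x => Real.exp (-(rate k * x)))
      (fun x => Real.exp (-(rate k * x)) * -rate k) := by
    have h1 := IsPrim.of_hasDerivAt (f := fun x => Real.exp (-(rate k * x)))
      (f' := fun x => Real.exp (-(rate k * x)) * -rate k) (fun x => by
        have := ((hasDerivAt_id x).const_mul (rate k)).neg.exp
        simpa using this) (by fun_prop)
    simpa using h1
  have h2 := he.mul (L2.isPrim c z')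
  rw [one_mul] at h2
  refine hasPrim_of_isPrim h2 ?_ ?_
  · filter_upwards [h, coeFn_W k z] with x h1 h2
    rw [h2, h1]
  · filter_upwards [h, coeFn_W k z, coeFn_W k z', Lp.coeFn_sub (Zakharov.W k z') (rate k • Zakharov.W k z),
      Lp.coeFn_smul (rate k) (Zakharov.W k z)] with x h1 h2 h3 h4 h5
    rw [h4, Pi.sub_apply, h5, h3, Pi.smul_apply, h2, h1, smul_eq_mul]
    ring

theorem HasPrim.sub {c d : ℝ} {z z' y y' : L2} (h : HasPrim c z z') (h' : HasPrim d y y') :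
    HasPrim (c - d) (z - y) (z' - y') := by
  have h2 := (L2.isPrim c z').add ((L2.isPrim d y').const_mul (-1))
  rw [show c + -1 * d = c - d by ring] at h2
  refine hasPrim_of_isPrim h2 ?_ ?_
  · filter_upwards [h, h', Lp.coeFn_sub z y] with x h1 h2 h3
    rw [h3, Pi.sub_apply, h1, h2]; ring
  · filter_upwards [Lp.coeFn_sub z' y'] with x h3
    rw [h3, Pi.sub_apply]; ring

/-- Multiplication with the weight `1 - exp (-rate k * x)`, which vanishes at `0`. -/
def X (k : ℕ) : L2 →L[ℝ] L2 := ContinuousLinearMap.id ℝ L2 - W k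

/-- Multiplication with the derivative of the weight `1 - exp (-rate k * x)`. -/
def dX (k : ℕ) : L2 →L[ℝ] L2 := rate k • W k

theorem X_apply (k : ℕ) (y : L2) : X k y = y - W k y := rfl
theorem dX_apply (k : ℕ) (y : L2) : dX k y = rate k • W k y := rfl

theorem inner_X (k : ℕ) (y z : L2) : inner ℝ (X k y) z = inner ℝ y (X k z) := by
  rw [X_apply, X_apply, inner_sub_left, inner_sub_right, inner_W]

theorem inner_dX (k : ℕ) (y z : L2) : inner ℝ (dX k y) z = inner ℝ y (dX k z) := by
  rw [dX_apply, dX_apply, real_inner_smul_left, real_inner_smul_right, inner_W]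

theorem X_mulV (k : ℕ) (v : H10) (y : L2) : X k (mulV v y) = mulV v (X k y) := by
  rw [X_apply, X_apply, map_sub, W_mulV]

theorem dX_mulV (k : ℕ) (v : H10) (y : L2) : dX k (mulV v y) = mulV v (dX k y) := by
  rw [dX_apply, dX_apply, map_smul, W_mulV]

theorem inner_dX_self_nonneg (k : ℕ) (y : L2) : 0 ≤ inner ℝ (dX k y) y := by
  rw [dX_apply, real_inner_smul_left]
  exact mul_nonneg (rate_pos k).le (inner_W_self_nonneg k y)

theorem norm_X_le (k : ℕ) (y : L2) : ‖X k y‖ ≤ ‖y‖ := by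
  refine Lp.norm_le_norm_of_ae_le ?_
  filter_upwards [coeFn_W k y, ae_expWeight_le k, Lp.coeFn_sub y (W k y)] with x h1 h2 h3
  rw [X_apply, h3, Pi.sub_apply, h1, ← one_sub_mul, norm_mul]
  refine mul_le_of_le_one_left (norm_nonneg _) ?_
  rw [Real.norm_of_nonneg (Real.exp_pos _).le] at h2
  rw [Real.norm_of_nonneg (by linarith)]
  linarith [Real.exp_pos (-(rate k * x))]

/-- The boundary value `c` cancels between `z` and `W k z`, since both have the same value at 0. -/
theorem HasPrim.X {c : ℝ} {z z' : L2} (h : HasPrim c z z') (k : ℕ) :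
    (X k z, dX k z + X k z') ∈ h10 := by
  rw [mem_h10_iff]
  have := h.sub (h.W k)
  rw [sub_self] at this
  have e : dX k z + Zakharov.X k z' = z' - (Zakharov.W k z' - rate k • Zakharov.W k z) := by
    rw [dX_apply, X_apply]; abel
  rw [e]
  exact this

theorem dX_mem (k : ℕ) (v : H10) :
    (dX k (H10.val v), dX k (H10.D v) - rate k • dX k (H10.val v)) ∈ h10 := by
  have h1 := h10.smul_mem (rate k) ((mem_h10_iff _ _).2 (v.hasPrim.W k))
  rwa [Prod.smul_mk, smul_sub] at h1

/-- Multiplication of elements of `H¹₀` with the weight `1 - exp (-rate k * x)`. -/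
def XV (k : ℕ) : H10 →L[ℝ] H10 :=
  (((X k).comp H10.val).prod ((dX k).comp H10.val + (X k).comp H10.D)).codRestrict h10
    fun v => v.hasPrim.X k

/-- Multiplication of elements of `H¹₀` with the derivative of the weight
`1 - exp (-rate k * x)`. -/
def dXV (k : ℕ) : H10 →L[ℝ] H10 :=
  (((dX k).comp H10.val).prod ((dX k).comp H10.D - rate k • (dX k).comp H10.val)).codRestrict h10
    fun v => dX_mem k v

@[simp] theorem val_XV (k : ℕ) (v : H10) : H10.val (XV k v) = X k (H10.val v) := rfl
@[simp] theorem D_XV (k : ℕ) (v : H10) :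
    H10.D (XV k v) = dX k (H10.val v) + X k (H10.D v) := rfl
@[simp] theorem val_dXV (k : ℕ) (v : H10) : H10.val (dXV k v) = dX k (H10.val v) := rfl
@[simp] theorem D_dXV (k : ℕ) (v : H10) :
    H10.D (dXV k v) = dX k (H10.D v) - rate k • dX k (H10.val v) := rfl

/-- The flux of momentum through the weight is nonnegative. -/
theorem momentum_flux_nonneg (k : ℕ) (v : H10) :
    0 ≤ inner ℝ (dX k (H10.D v)) (H10.D v) + inner ℝ (H10.D (dXV k v)) (H10.D v) := by
  have h1 := (dXV k v).hasPrim.inner_D v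
  -- Since χ'' = -r χ', integration by parts gives r ⟨χ'v, v⟩ = 2 ⟨χ'v, v'⟩, and the flux is exactly
  -- twice the weighted square of v' - (r/2) v.
  have h2 := inner_dX_self_nonneg k (H10.D v - (rate k / 2) • H10.val v)
  rw [val_dXV, D_dXV] at h1
  rw [D_dXV]
  simp only [map_sub, map_smul, inner_sub_left, inner_sub_right, real_inner_smul_left,
    real_inner_smul_right] at h1 h2 ⊢
  have e : inner ℝ (dX k (H10.D v)) (H10.val v) = inner ℝ (dX k (H10.val v)) (H10.D v) := by
    rw [inner_dX, real_inner_comm]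
  rw [e] at h1 h2
  have h3 : rate k * inner ℝ (dX k (H10.val v)) (H10.val v) =
    2 * inner ℝ (dX k (H10.val v)) (H10.D v) := by linarith
  have h4 : rate k / 2 * (rate k / 2 * inner ℝ (dX k (H10.val v)) (H10.val v)) =
    rate k / 2 * inner ℝ (dX k (H10.val v)) (H10.D v) := by rw [div_mul_eq_mul_div _ _ (inner ℝ _ _), h3]; ring
  rw [h4] at h2
  linarith

end Weights

/-! ### The resolvent of the derivative and its adjoint -/

section Resolvent

/-- `v` and v' are orthogonal because `v` vanishes at 0. This gives uniqueness for v + δ v' = φ and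
a bound on the resolvent independent of δ. -/
theorem norm_sq_val_add_D (δ : ℝ) (v : H10) :
    ‖H10.val v + δ • H10.D v‖ ^ 2 = ‖H10.val v‖ ^ 2 + δ ^ 2 * ‖H10.D v‖ ^ 2 := by
  rw [norm_add_sq_real, real_inner_smul_right, H10.inner_val_D_self, norm_smul, mul_pow,
    Real.norm_eq_abs, sq_abs]
  ring

/-- Variation of constants gives the solution; the point is its square integrability. -/
theorem exists_resolvent {δ : ℝ} (hδ : 0 < δ) (φ : L2) :
    ∃ v : H10, H10.val v + δ • H10.D v = φ := by
  have hE : IsPrim 1 (fun x => Real.exp (-(δ⁻¹ * x)))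
      (fun x => Real.exp (-(δ⁻¹ * x)) * -δ⁻¹) := by
    have h1 := IsPrim.of_hasDerivAt (f := fun x => Real.exp (-(δ⁻¹ * x)))
      (f' := fun x => Real.exp (-(δ⁻¹ * x)) * -δ⁻¹) (fun x => by
        have := ((hasDerivAt_id x).const_mul δ⁻¹).neg.exp
        simpa using this) (by fun_prop)
    simpa using h1
  have hI : IsPrim 0 (fun x => ∫ y in 0..x, Real.exp (δ⁻¹ * y) * (δ⁻¹ * φ y))
      (fun y => Real.exp (δ⁻¹ * y) * (δ⁻¹ * φ y)) :=
    ⟨fun x hx => ((φ.locInt hx).const_mul _).continuousOn_mul (by fun_prop),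
      fun x _ => (zero_add _).symm⟩
  set f : ℝ → ℝ := fun x => Real.exp (-(δ⁻¹ * x)) *
    ∫ y in 0..x, Real.exp (δ⁻¹ * y) * (δ⁻¹ * φ y) with hf
  have hP : IsPrim 0 f (fun x => δ⁻¹ * (φ x - f x)) := by
    have := hE.mul hI
    rw [mul_zero] at this
    convert this using 2 with x
    have e : Real.exp (-(δ⁻¹ * x)) * Real.exp (δ⁻¹ * x) = 1 := by
      rw [← Real.exp_add]; simp
    linear_combination (-δ⁻¹ * φ x) * e
  have hcont : ContinuousOn f (Ici 0) := hP.continuousOn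
  have hfi : ∀ x, 0 ≤ x → IntervalIntegrable f volume 0 x := fun x hx =>
    (hcont.mono (by rw [uIcc_of_le hx]; exact Icc_subset_Ici_self)).intervalIntegrable
  have hf2i : ∀ x, 0 ≤ x → IntervalIntegrable (fun y => f y ^ 2) volume 0 x := fun x hx =>
    ((hcont.pow 2).mono (by rw [uIcc_of_le hx]; exact Icc_subset_Ici_self)).intervalIntegrable
  have hφ2 : IntegrableOn (fun y => φ y ^ 2) (Ioi 0) := (Lp.memLp φ).integrable_sq
  have hbound : ∀ x, 0 ≤ x → ∫ y in 0..x, f y ^ 2 ≤ ‖φ‖ ^ 2 := by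
    intro x hx
    have h1 := (hP.mul hP).eq x hx
    have hφx : IntervalIntegrable (fun y => φ y ^ 2) volume 0 x := by
      rw [intervalIntegrable_iff_integrableOn_Ioc_of_le hx]
      exact hφ2.mono_set Ioc_subset_Ioi_self
    -- The derivative of f² is 2 δ⁻¹ f (φ - f) ≤ δ⁻¹ (φ² - f²). As f² starts at 0 and is
    -- nonnegative, ∫ f² ≤ ∫ φ² on every interval from 0.
    have h2 : δ⁻¹ * (∫ y in 0..x, (φ y ^ 2 - f y ^ 2)) ≥ f x * f x := by
      rw [h1, ← intervalIntegral.integral_const_mul]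
      have := hP.mul hP
      simp only [mul_zero, zero_add]
      refine intervalIntegral.integral_mono_on hx (this.locInt x hx)
        ((hφx.sub (hf2i x hx)).const_mul _) fun y _ => ?_
      have : 0 < δ⁻¹ := inv_pos.2 hδ
      nlinarith [mul_nonneg this.le (sq_nonneg (φ y - f y))]
    rw [intervalIntegral.integral_sub hφx (hf2i x hx)] at h2
    have h3 : 0 ≤ (∫ y in 0..x, φ y ^ 2) - ∫ y in 0..x, f y ^ 2 := by
      by_contra hn
      have := mul_neg_of_pos_of_neg (inv_pos.2 hδ) (not_le.1 hn)
      nlinarith [mul_self_nonneg (f x)]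
    have h4 : ∫ y in 0..x, φ y ^ 2 ≤ ‖φ‖ ^ 2 := by
      rw [L2.norm_sq, intervalIntegral.integral_of_le hx]
      exact setIntegral_mono_set hφ2 (Eventually.of_forall fun _ => sq_nonneg _)
        Ioc_subset_Ioi_self.eventuallyLE
    linarith
  have hmem : MemLp f 2 hlMeasure := by
    refine (memLp_two_iff_integrable_sq
      ((hcont.mono Ioi_subset_Ici_self).aestronglyMeasurable measurableSet_Ioi)).2 ?_
    refine integrableOn_Ioi_of_intervalIntegral_norm_bounded (‖φ‖ ^ 2) 0
      (l := atTop) (b := id) (fun x => ?_) tendsto_id ?_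
    · rcases le_or_gt 0 x with hx | hx
      · exact (intervalIntegrable_iff_integrableOn_Ioc_of_le hx).1 (hf2i x hx)
      · simp [Ioc_eq_empty_of_le hx.le]
    · filter_upwards [eventually_ge_atTop 0] with x hx
      simpa using hbound x hx
  have hz : hmem.toLp f =ᵐ[hlMeasure] f := hmem.coeFn_toLp
  refine ⟨H10.mk (hmem.toLp f) (δ⁻¹ • (φ - hmem.toLp f)) ((mem_h10_iff _ _).2
    (hasPrim_of_isPrim hP hz ?_)), ?_⟩
  · filter_upwards [hz, Lp.coeFn_smul δ⁻¹ (φ - hmem.toLp f),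
      Lp.coeFn_sub φ (hmem.toLp f)] with x h1 h2 h3
    rw [h2, Pi.smul_apply, h3, Pi.sub_apply, h1, smul_eq_mul]
  · rw [H10.val_mk, H10.D_mk, smul_inv_smul₀ hδ.ne']; abel

/-- The parameters of the approximation of the identity. -/
def del (j : ℕ) : ℝ := 1 / (j + 1)

theorem del_pos (j : ℕ) : 0 < del j := by unfold del; positivity

theorem tendsto_del : Tendsto del atTop (𝓝 0) := tendsto_one_div_add_atTop_nhds_zero_nat

theorem resolvent_unique {δ : ℝ} (hδ : 0 < δ) {v w : H10}
    (h : H10.val v + δ • H10.D v = H10.val w + δ • H10.D w) : v = w := by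
  have h1 : H10.val (v - w) + δ • H10.D (v - w) = 0 := by
    rw [map_sub, map_sub, smul_sub]
    rw [← sub_eq_zero] at h
    rw [← h]; abel
  have h2 := norm_sq_val_add_D δ (v - w)
  rw [h1, norm_zero] at h2
  have h3 : ‖H10.val (v - w)‖ ^ 2 = 0 := by
    nlinarith [sq_nonneg ‖H10.val (v - w)‖, mul_nonneg (sq_nonneg δ) (sq_nonneg ‖H10.D (v - w)‖)]
  have h4 : H10.val (v - w) = 0 := by simpa using h3
  have h5 : H10.D (v - w) = 0 := by
    rw [h4, zero_add] at h1
    exact (smul_eq_zero_iff_right hδ.ne').1 h1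
  exact sub_eq_zero.1 (H10.ext (by rw [h4, map_zero]) (by rw [h5, map_zero]))

/-- The linear map `φ ↦ v` where `v + δ v' = φ` and `v ∈ H¹₀`, for `δ = del j`. -/
def K (j : ℕ) : L2 →L[ℝ] H10 :=
  LinearMap.mkContinuous
    { toFun := fun φ => (exists_resolvent (del_pos j) φ).choose
      map_add' := fun φ ψ => by
        refine resolvent_unique (del_pos j) ?_
        rw [(exists_resolvent (del_pos j) (φ + ψ)).choose_spec, map_add, map_add, smul_add]
        conv_lhs => rw [← (exists_resolvent (del_pos j) φ).choose_spec,
          ← (exists_resolvent (del_pos j) ψ).choose_spec]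
        abel
      map_smul' := fun r φ => by
        refine resolvent_unique (del_pos j) ?_
        rw [(exists_resolvent (del_pos j) (r • φ)).choose_spec, map_smul, map_smul, smul_comm,
          ← smul_add, RingHom.id_apply]
        conv_lhs => rw [← (exists_resolvent (del_pos j) φ).choose_spec] }
    (max 1 (del j)⁻¹) fun φ => by
      set v : H10 := (exists_resolvent (del_pos j) φ).choose with hv
      have h := (exists_resolvent (del_pos j) φ).choose_spec
      rw [← hv] at h
      have h2 := norm_sq_val_add_D (del j) v
      rw [h] at h2
      have hd := del_pos j
      change ‖v‖ ≤ _
      refine H10.norm_le_of ?_ ?_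
      · refine le_trans ?_ (mul_le_mul_of_nonneg_right (le_max_left _ _) (norm_nonneg _))
        rw [one_mul]
        refine abs_le_of_sq_le_sq' ?_ (norm_nonneg _) |>.2
        nlinarith [mul_nonneg (sq_nonneg (del j)) (sq_nonneg ‖H10.D v‖)]
      · refine le_trans ?_ (mul_le_mul_of_nonneg_right (le_max_right _ _) (norm_nonneg _))
        rw [inv_mul_eq_div, le_div_iff₀ hd]
        refine abs_le_of_sq_le_sq' ?_ (norm_nonneg _) |>.2
        rw [mul_pow]
        nlinarith [sq_nonneg ‖H10.val v‖]

theorem val_K_add (j : ℕ) (φ : L2) : H10.val (K j φ) + del j • H10.D (K j φ) = φ :=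
  (exists_resolvent (del_pos j) φ).choose_spec

/-- The resolvent as an operator on `L²`. -/
def R (j : ℕ) : L2 →L[ℝ] L2 := H10.val.comp (K j)

@[simp] theorem val_K (j : ℕ) (φ : L2) : H10.val (K j φ) = R j φ := rfl

theorem R_add (j : ℕ) (φ : L2) : R j φ + del j • H10.D (K j φ) = φ := val_K_add j φ

theorem D_K (j : ℕ) (φ : L2) : H10.D (K j φ) = (del j)⁻¹ • (φ - R j φ) := by
  rw [eq_inv_smul_iff₀ (del_pos j).ne', eq_sub_iff_add_eq, add_comm]
  exact R_add j φ

theorem K_val (j : ℕ) (v : H10) : K j (H10.val v) = v - del j • K j (H10.D v) := by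
  refine resolvent_unique (del_pos j) ?_
  rw [val_K_add, map_sub, map_sub, map_smul, map_smul]
  conv_lhs => rw [← add_zero (H10.val v)]
  rw [smul_sub, ← sub_eq_zero]
  have h := R_add j (H10.D v)
  have : H10.D v - del j • H10.D (K j (H10.D v)) = R j (H10.D v) := by
    nth_rewrite 1 [← h]; abel
  rw [← smul_sub, this, val_K]; abel

theorem D_K_val (j : ℕ) (v : H10) : H10.D (K j (H10.val v)) = R j (H10.D v) := by
  have h := R_add j (H10.D v)
  rw [K_val, map_sub, map_smul]
  nth_rewrite 1 [← h]; abel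

theorem R_val (j : ℕ) (v : H10) : R j (H10.val v) = H10.val v - del j • R j (H10.D v) := by
  rw [← val_K, K_val, map_sub, map_smul, val_K]

theorem norm_R_le (j : ℕ) (φ : L2) : ‖R j φ‖ ≤ ‖φ‖ := by
  have h2 := norm_sq_val_add_D (del j) (K j φ)
  rw [val_K_add, val_K] at h2
  refine abs_le_of_sq_le_sq' ?_ (norm_nonneg _) |>.2
  nlinarith [mul_nonneg (sq_nonneg (del j)) (sq_nonneg ‖H10.D (K j φ)‖)]

/-- A function orthogonal to all test functions has zero weak derivative, so it is a constant, and
pairing with a test function of integral one shows that the constant is zero. -/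
theorem dense_range_val : DenseRange H10.val := by
  have h : (LinearMap.range (H10.val : H10 →ₗ[ℝ] L2)).topologicalClosure = ⊤ := by
    rw [Submodule.topologicalClosure_eq_top_iff, Submodule.eq_bot_iff]
    intro y hy
    have hy' : ∀ φ : 𝓓(halfLine, ℝ), ∫ x in Ioi 0, y x * φ x = 0 := fun φ => by
      rw [← inner_testL2, ← val_testH, real_inner_comm]
      exact (Submodule.mem_orthogonal _ _).1 hy _ ⟨testH φ, rfl⟩
    obtain ⟨c, hc⟩ := ae_const_of_weakDeriv_zero (g := y) (fun x hx => y.locInt hx) fun φ => by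
      have := hy' (derivTest φ)
      simp_rw [mul_comm (y _)] at this
      exact this
    obtain ⟨θ, hθ⟩ := exists_test_integral_one
    have h1 : ∫ x in Ioi 0, y x * θ x = ∫ x in Ioi 0, c * θ x := by
      refine integral_congr_ae ?_
      filter_upwards [hc] with x hx
      rw [hx]
    rw [hy', integral_const_mul, hθ, mul_one] at h1
    refine Lp.ext ?_
    filter_upwards [hc, Lp.coeFn_zero ℝ 2 hlMeasure] with x h2 h3
    rw [h2, h3, ← h1]; rfl
  rw [← Submodule.dense_iff_topologicalClosure_eq_top] at h
  exact h

/-- On H¹₀ the error is δ R v', which is of order δ; density and the uniform bound `norm_R_le`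
extend the convergence to L². -/
theorem tendsto_R (φ : L2) : Tendsto (fun j => R j φ) atTop (𝓝 φ) := by
  rw [Metric.tendsto_atTop]
  intro ε hε
  obtain ⟨v, hv⟩ := dense_range_val.exists_dist_lt φ (show 0 < ε / 4 by positivity)
  have h1 : Tendsto (fun j => del j * ‖H10.D v‖) atTop (𝓝 0) := by
    simpa using tendsto_del.mul_const ‖H10.D v‖
  obtain ⟨N, hN⟩ := eventually_atTop.1 (h1.eventually (gt_mem_nhds (show 0 < ε / 4 by positivity)))
  refine ⟨N, fun j hj => ?_⟩
  rw [dist_eq_norm] at hv ⊢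
  have e : R j φ - φ = R j (φ - H10.val v) - (φ - H10.val v) - del j • R j (H10.D v) := by
    rw [map_sub, R_val]; abel
  rw [e]
  have h2 : ‖del j • R j (H10.D v)‖ ≤ del j * ‖H10.D v‖ := by
    rw [norm_smul, Real.norm_of_nonneg (del_pos j).le]
    exact mul_le_mul_of_nonneg_left (norm_R_le _ _) (del_pos j).le
  have h3 := norm_R_le j (φ - H10.val v)
  have h4 := norm_sub_le (R j (φ - H10.val v) - (φ - H10.val v)) (del j • R j (H10.D v))
  have h5 := norm_sub_le (R j (φ - H10.val v)) (φ - H10.val v)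
  linarith [hN j hj]

/-- The adjoint of the resolvent. -/
def Ra (j : ℕ) : L2 →L[ℝ] L2 := ContinuousLinearMap.adjoint (R j)

theorem inner_Ra (j : ℕ) (y z : L2) : inner ℝ (Ra j y) z = inner ℝ y (R j z) :=
  ContinuousLinearMap.adjoint_inner_left _ _ _

theorem inner_R (j : ℕ) (y z : L2) : inner ℝ (R j y) z = inner ℝ y (Ra j z) :=
  (ContinuousLinearMap.adjoint_inner_right _ _ _).symm

theorem norm_Ra_le (j : ℕ) (y : L2) : ‖Ra j y‖ ≤ ‖y‖ := by
  refine (ContinuousLinearMap.le_opNorm _ _).trans ?_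
  refine mul_le_of_le_one_left (norm_nonneg _) ?_
  rw [Ra, LinearIsometryEquiv.norm_map]
  exact ContinuousLinearMap.opNorm_le_bound _ zero_le_one fun φ => by
    rw [one_mul]; exact norm_R_le j φ

/-- As `Ra j` is a contraction, ‖Ra y - y‖² ≤ 2‖y‖² - 2⟨y, R y⟩, and the right side tends to zero.
-/
theorem tendsto_Ra (y : L2) : Tendsto (fun j => Ra j y) atTop (𝓝 y) := by
  rw [tendsto_iff_norm_sub_tendsto_zero]
  have h1 : Tendsto (fun j => √(2 * ‖y‖ ^ 2 - 2 * inner ℝ y (R j y))) atTop (𝓝 0) := by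
    have : Tendsto (fun j => inner ℝ y (R j y)) atTop (𝓝 (inner ℝ y y)) :=
      tendsto_const_nhds.inner (tendsto_R y)
    have h2 := ((this.const_mul 2).const_sub (2 * ‖y‖ ^ 2)).sqrt
    rwa [real_inner_self_eq_norm_sq, sub_self, Real.sqrt_zero] at h2
  refine squeeze_zero (fun _ => norm_nonneg _) (fun j => ?_) h1
  refine Real.le_sqrt_of_sq_le ?_
  rw [norm_sub_sq_real, inner_Ra]
  have := norm_Ra_le j y
  nlinarith [norm_nonneg (Ra j y), norm_nonneg y]

/-- Thus (Ra v - v)/δ = Ra v': on H¹₀ the operator `Ra j` plays the role of a shift in space, and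
its difference quotient converges to v' in L². -/
theorem Ra_val (j : ℕ) (v : H10) : Ra j (H10.val v) = H10.val v + del j • Ra j (H10.D v) := by
  refine ext_inner_right ℝ fun φ => ?_
  have h := v.hasPrim.inner_D (K j φ)
  rw [val_K] at h
  rw [inner_add_left, real_inner_smul_left, inner_Ra, inner_Ra]
  conv_rhs => rw [← R_add j φ]
  rw [inner_add_right, real_inner_smul_right, h, R_add]; ring

/-- `Ra j` inverts 1 - δ∂ without a boundary condition at 0, so the regularized function has a
derivative in L² but an unknown boundary value `c`. Multiplication with `X k` removes the latter. -/
theorem Ra_hasPrim (j : ℕ) (y : L2) : ∃ c, HasPrim c (Ra j y) ((del j)⁻¹ • (Ra j y - y)) := by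
  refine exists_hasPrim fun φ => ?_
  have h := D_K j (H10.val (testH φ))
  rw [D_K_val] at h
  rw [inner_Ra, h, real_inner_smul_right, real_inner_smul_left, inner_sub_left, inner_sub_right,
    inner_Ra]
  ring

/-- For `F ∈ H¹₀` the derivative of `Ra F` is `Ra F'`. -/
theorem Ra_hasPrim_val (j : ℕ) (v : H10) :
    (del j)⁻¹ • (Ra j (H10.val v) - H10.val v) = Ra j (H10.D v) := by
  rw [Ra_val, add_sub_cancel_left, inv_smul_smul₀ (del_pos j).ne']

theorem XRa_mem (k j : ℕ) (y : L2) :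
    (X k (Ra j y), dX k (Ra j y) + X k ((del j)⁻¹ • (Ra j y - y))) ∈ h10 := by
  obtain ⟨c, hc⟩ := Ra_hasPrim j y
  exact hc.X k

/-- The map `y ↦ χ Ra y` where `χ` is the weight vanishing at `0`. -/
def XRa (k j : ℕ) : L2 →L[ℝ] H10 :=
  (((X k).comp (Ra j)).prod ((dX k).comp (Ra j) +
    (X k).comp ((del j)⁻¹ • (Ra j - ContinuousLinearMap.id ℝ L2)))).codRestrict h10
    fun y => XRa_mem k j y

@[simp] theorem val_XRa (k j : ℕ) (y : L2) : H10.val (XRa k j y) = X k (Ra j y) := rfl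
theorem D_XRa (k j : ℕ) (y : L2) :
    H10.D (XRa k j y) = dX k (Ra j y) + X k ((del j)⁻¹ • (Ra j y - y)) := rfl
theorem D_XRa_val (k j : ℕ) (v : H10) :
    H10.D (XRa k j (H10.val v)) = dX k (Ra j (H10.val v)) + X k (Ra j (H10.D v)) := by
  rw [D_XRa, Ra_hasPrim_val]

end Resolvent

/-! ### Density of test functions and of their derivatives in H¹₀ -/

section Density

/-- Hahn–Banach extends the functional to L² × L², where Riesz representation applies to each
factor. -/
theorem exists_dual_repr (ℓ : H10 →L[ℝ] ℝ) :
    ∃ y z : L2, ∀ v : H10, ℓ v = inner ℝ y (H10.val v) + inner ℝ z (H10.D v) := by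
  obtain ⟨g, hg, -⟩ := exists_extension_norm_eq h10 ℓ
  refine ⟨(InnerProductSpace.toDual ℝ L2).symm (g.comp (ContinuousLinearMap.inl ℝ L2 L2)),
    (InnerProductSpace.toDual ℝ L2).symm (g.comp (ContinuousLinearMap.inr ℝ L2 L2)), fun v => ?_⟩
  rw [InnerProductSpace.toDual_symm_apply, InnerProductSpace.toDual_symm_apply]
  refine (hg v).symm.trans ?_
  simp only [ContinuousLinearMap.comp_apply, ← map_add]
  congr 1
  refine Prod.ext ?_ ?_ <;> simp <;> rfl

/-- Vanishing on test functions says that `y` is the weak derivative of `z`; then the two terms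
cancel on all of H¹₀ because elements of H¹₀ vanish at 0. -/
theorem dual_eq_zero_of_test {ℓ : H10 →L[ℝ] ℝ} (h : ∀ φ, ℓ (testH φ) = 0) : ℓ = 0 := by
  obtain ⟨y, z, hyz⟩ := exists_dual_repr ℓ
  obtain ⟨c, hc⟩ := exists_hasPrim (z := z) (z' := y) fun φ => by
    have := h φ
    rw [hyz] at this
    linarith
  ext v
  rw [hyz, hc.inner_D v]
  simp

theorem norm_testL2_sq (φ : 𝓓(halfLine, ℝ)) : ‖testL2 φ‖ ^ 2 = ∫ x in Ioi 0, φ x ^ 2 := by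
  rw [L2.norm_sq]
  refine integral_congr_ae ?_
  filter_upwards [coeFn_testL2 φ] with x hx
  rw [hx]

theorem setIntegral_comp_scale (g : ℝ → ℝ) {r : ℝ} (hr : 0 < r) :
    ∫ x in Ioi 0, g (r * x) = r⁻¹ * ∫ x in Ioi 0, g x := by
  rw [integral_comp_mul_left_Ioi g 0 hr, mul_zero, smul_eq_mul]

/-- Spreading out at scale R = m + 1 keeps the integral, while the L² norm decays like R^(-1/2).
Hence the mean value is not continuous for the norm of H¹₀, which is why functions of mean zero are
already dense. -/
theorem tendsto_testH_scale (θ : 𝓓(halfLine, ℝ)) :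
    Tendsto (fun m : ℕ => testH (scaleTest θ (m + 1) (by positivity))) atTop (𝓝 0) := by
  rw [tendsto_zero_iff_norm_tendsto_zero]
  set C := ‖testL2 θ‖ + ‖testL2 (derivTest θ)‖
  have h0 : Tendsto (fun m : ℕ => √(1 / ((m : ℝ) + 1)) * C) atTop (𝓝 0) := by
    simpa using (tendsto_one_div_add_atTop_nhds_zero_nat (𝕜 := ℝ)).sqrt.mul_const C
  refine squeeze_zero (fun _ => norm_nonneg _) (fun m => ?_) h0
  set r : ℝ := ((m : ℝ) + 1)⁻¹ with hr
  have hr0 : 0 < r := by positivity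
  have hr1 : r ≤ 1 := inv_le_one_of_one_le₀ (by simp)
  have key : ∀ (φ ψ : 𝓓(halfLine, ℝ)) (s : ℝ), 0 ≤ s → s ≤ 1 →
      (∀ x, φ x = s * (r * ψ (r * x))) → ‖testL2 φ‖ ≤ √r * ‖testL2 ψ‖ := by
    intro φ ψ s hs0 hs1 h
    refine abs_le_of_sq_le_sq' ?_ (by positivity) |>.2
    rw [mul_pow, Real.sq_sqrt hr0.le, norm_testL2_sq, norm_testL2_sq]
    have e : ∀ x, φ x ^ 2 = s ^ 2 * r ^ 2 * (fun y => ψ y ^ 2) (r * x) := fun x => by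
      rw [h x]; ring
    simp_rw [e]
    rw [integral_const_mul, setIntegral_comp_scale (fun y => ψ y ^ 2) hr0]
    have hI : 0 ≤ ∫ x in Ioi 0, ψ x ^ 2 := integral_nonneg fun x => sq_nonneg _
    have : s ^ 2 * r ^ 2 * (r⁻¹ * ∫ x in Ioi 0, ψ x ^ 2) = s ^ 2 * (r * ∫ x in Ioi 0, ψ x ^ 2) := by
      field_simp
    rw [this]
    refine mul_le_of_le_one_left (by positivity) (pow_le_one₀ hs0 hs1)
  rw [one_div, ← hr]
  refine H10.norm_le_of ?_ ?_
  · rw [val_testH]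
    refine (key _ θ 1 zero_le_one le_rfl fun x => by rw [one_mul]; rfl).trans ?_
    exact mul_le_mul_of_nonneg_left (le_add_of_nonneg_right (norm_nonneg _)) (Real.sqrt_nonneg _)
  · rw [D_testH]
    refine (key _ (derivTest θ) r hr0.le hr1 fun x => ?_).trans ?_
    · rw [coe_derivTest, deriv_scaleTest, coe_derivTest]
    exact mul_le_mul_of_nonneg_left (le_add_of_nonneg_left (norm_nonneg _)) (Real.sqrt_nonneg _)

theorem testH_sub_smul (η θ : 𝓓(halfLine, ℝ)) (r : ℝ) :
    testH (η - r • θ) = testH η - r • testH θ := by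
  have key : ∀ η θ φ : 𝓓(halfLine, ℝ), (∀ x, φ x = η x - r * θ x) →
      testL2 φ = testL2 η - r • testL2 θ := fun η θ φ h => by
    refine Lp.ext ?_
    filter_upwards [coeFn_testL2 φ, coeFn_testL2 η, coeFn_testL2 θ,
      Lp.coeFn_sub (testL2 η) (r • testL2 θ), Lp.coeFn_smul r (testL2 θ)] with x h1 h2 h3 h4 h5
    rw [h1, h4, Pi.sub_apply, h5, Pi.smul_apply, h2, h3, h x, smul_eq_mul]
  refine H10.ext ?_ ?_
  · rw [map_sub, map_smul]
    exact key _ _ _ fun x => rfl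
  · rw [map_sub, map_smul]
    refine key _ _ _ fun x => ?_
    simp only [coe_derivTest]
    rw [show (⇑(η - r • θ) : ℝ → ℝ) = fun x => η x - r * θ x from rfl]
    rw [deriv_fun_sub (test_differentiable η x) ((test_differentiable θ x).const_mul r),
      deriv_const_mul_field]

/-- A functional on `H¹₀` which vanishes on the derivatives of test functions is zero. -/
theorem dual_eq_zero_of_derivTest {ℓ : H10 →L[ℝ] ℝ} (h : ∀ φ, ℓ (testH (derivTest φ)) = 0) :
    ℓ = 0 := by
  obtain ⟨θ, hθ⟩ := exists_test_integral_one
  -- On test functions `ℓ` depends only on the integral, since test functions of integral zero are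
  -- derivatives of test functions.
  have h1 : ∀ η ζ : 𝓓(halfLine, ℝ), ∫ x in Ioi 0, ζ x = 1 →
      ℓ (testH η) = (∫ x in Ioi 0, η x) * ℓ (testH ζ) := by
    intro η ζ hζ
    obtain ⟨Φ, hΦ⟩ := exists_antideriv (η - (∫ x in Ioi 0, η x) • ζ) (by
      simp only [FunLike.coe_sub, FunLike.coe_smul, Pi.sub_apply, Pi.smul_apply, smul_eq_mul]
      rw [integral_sub (test_integrable η).integrableOn
        ((test_integrable ζ).integrableOn.const_mul _), integral_const_mul, hζ]
      simp)
    have h2 := h Φ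
    have e : derivTest Φ = η - (∫ x in Ioi 0, η x) • ζ := TestFunction.ext fun x => by
      rw [coe_derivTest, hΦ]
    rw [e, testH_sub_smul, map_sub, map_smul, smul_eq_mul] at h2
    linarith
  have h2 : ℓ (testH θ) = 0 := by
    have h3 : Tendsto (fun m : ℕ => ℓ (testH (scaleTest θ (m + 1) (by positivity)))) atTop
        (𝓝 0) := by
      have := (ℓ.continuous.tendsto 0).comp (tendsto_testH_scale θ)
      rwa [map_zero] at this
    refine tendsto_nhds_unique (tendsto_const_nhds.congr fun m => ?_) h3
    rw [h1 (scaleTest θ (m + 1) (by positivity)) θ hθ, integral_scaleTest, hθ, one_mul]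
  exact dual_eq_zero_of_test fun φ => by rw [h1 φ θ hθ, h2, mul_zero]

end Density

/-! ### The dual of H¹₀ and the weak form of the system -/

/-- The dual of `H¹₀`. -/
def Dual10 : Type := H10 →L[ℝ] ℝ

instance : NormedAddCommGroup Dual10 := inferInstanceAs (NormedAddCommGroup (H10 →L[ℝ] ℝ))
instance : NormedSpace ℝ Dual10 := inferInstanceAs (NormedSpace ℝ (H10 →L[ℝ] ℝ))
instance : CompleteSpace Dual10 := inferInstanceAs (CompleteSpace (H10 →L[ℝ] ℝ))

/-- The duality pairing. -/
def pair : Dual10 →L[ℝ] H10 →L[ℝ] ℝ := ContinuousLinearMap.id ℝ (H10 →L[ℝ] ℝ)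

theorem abs_pair_le (ℓ : Dual10) (v : H10) : |pair ℓ v| ≤ ‖ℓ‖ * ‖v‖ :=
  ContinuousLinearMap.le_opNorm (show H10 →L[ℝ] ℝ from ℓ) v

theorem tendsto_pair {ι : Type*} {l : Filter ι} {ℓ : ι → Dual10} {ℓ₀ : Dual10} {v : ι → H10}
    {v₀ : H10} (hℓ : Tendsto ℓ l (𝓝 ℓ₀)) (hv : Tendsto v l (𝓝 v₀)) :
    Tendsto (fun i => pair (ℓ i) (v i)) l (𝓝 (pair ℓ₀ v₀)) :=
  (isBoundedBilinearMap_apply.continuous.tendsto (pair ℓ₀, v₀)).comp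
    (((pair.continuous.tendsto _).comp hℓ).prodMk_nhds hv)

/-- The functional `⟨y, L ·⟩` on `H¹₀`, as a function of `y`. -/
def functional (L : H10 →L[ℝ] L2) : L2 →L[ℝ] Dual10 :=
  LinearMap.mkContinuous₂
    (LinearMap.mk₂ ℝ (fun (y : L2) (v : H10) => inner ℝ y (L v))
      (fun y y' v => inner_add_left _ _ _) (fun r y v => real_inner_smul_left _ _ _)
      (fun y v v' => by rw [map_add, inner_add_right])
      (fun r y v => by rw [map_smul, real_inner_smul_right, smul_eq_mul])) ‖L‖
    (fun y v => by
      have h1 : ‖(inner ℝ y (L v) : ℝ)‖ ≤ ‖y‖ * ‖L v‖ := norm_inner_le_norm _ _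
      have h2 := mul_le_mul_of_nonneg_left (L.le_opNorm v) (norm_nonneg y)
      exact h1.trans (h2.trans (le_of_eq (by ring))))

/-- The pairing `⟨y, v⟩` as a functional of `v ∈ H¹₀`. -/
def J : L2 →L[ℝ] Dual10 := functional H10.val

/-- The pairing `⟨y, v'⟩` as a functional of `v ∈ H¹₀`. -/
def JD : L2 →L[ℝ] Dual10 := functional H10.D

@[simp] theorem J_apply (y : L2) (v : H10) : pair (J y) v = inner ℝ y (H10.val v) := rfl
@[simp] theorem JD_apply (y : L2) (v : H10) : pair (JD y) v = inner ℝ y (H10.D v) := rfl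
theorem pair_add (ℓ ℓ' : Dual10) (v : H10) : pair (ℓ + ℓ') v = pair ℓ v + pair ℓ' v := rfl
theorem pair_sub (ℓ ℓ' : Dual10) (v : H10) : pair (ℓ - ℓ') v = pair ℓ v - pair ℓ' v := rfl
theorem pair_neg (ℓ : Dual10) (v : H10) : pair (-ℓ) v = -pair ℓ v := rfl
theorem pair_smul (r : ℝ) (ℓ : Dual10) (v : H10) : pair (r • ℓ) v = r * pair ℓ v := rfl

/-- The density `|u|²` of `u = a + i b`. -/
def dens (a b : H10) : H10 := prodV a a + prodV b b

theorem val_dens (a b : H10) : H10.val (dens a b) = mulV a (H10.val a) + mulV b (H10.val b) := rfl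

theorem D_dens (a b : H10) :
    H10.D (dens a b) = (2 : ℝ) • (mulV a (H10.D a) + mulV b (H10.D b)) := by
  rw [dens, map_add, D_prodV, D_prodV, two_smul]; abel

theorem ContinuousOn.prodV {S : Set ℝ} {f g : ℝ → H10} (hf : ContinuousOn f S)
    (hg : ContinuousOn g S) : ContinuousOn (fun s => prodV (f s) (g s)) S := by
  fun_prop

theorem continuous_prodV : Continuous fun q : H10 × H10 => prodV q.1 q.2 := prodV.continuous₂

theorem tendsto_prodV {ι : Type*} {l : Filter ι} {v w : ι → H10} {v₀ w₀ : H10}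
    (hv : Tendsto v l (𝓝 v₀)) (hw : Tendsto w l (𝓝 w₀)) :
    Tendsto (fun i => prodV (v i) (w i)) l (𝓝 (prodV v₀ w₀)) := by
  have := (continuous_prodV.tendsto (v₀, w₀)).comp (hv.prodMk_nhds hw)
  exact this

theorem ContinuousOn.mulV {S : Set ℝ} {f : ℝ → H10} {g : ℝ → L2} (hf : ContinuousOn f S)
    (hg : ContinuousOn g S) : ContinuousOn (fun s => mulV (f s) (g s)) S := by
  fun_prop

theorem ContinuousOn.dens {S : Set ℝ} {f g : ℝ → H10} (hf : ContinuousOn f S)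
    (hg : ContinuousOn g S) : ContinuousOn (fun s => dens (f s) (g s)) S :=
  (ContinuousOn.prodV hf hf).add (ContinuousOn.prodV hg hg)

theorem ContinuousOn.pair {S : Set ℝ} {f : ℝ → Dual10} {g : ℝ → H10} (hf : ContinuousOn f S)
    (hg : ContinuousOn g S) : ContinuousOn (fun s => pair (f s) (g s)) S := by
  fun_prop

/-- Solutions `u = a + i b`, `n`, with `n_t = p_x`, of the Zakharov system with zero boundary value
for `u`, tested against elements of `H¹₀`. -/
structure IsSystem (T : ℝ) (a b : ℝ → H10) (n p : ℝ → L2) : Prop where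
  a_cont : ContinuousOn a (Icc 0 T)
  b_cont : ContinuousOn b (Icc 0 T)
  n_cont : ContinuousOn n (Icc 0 T)
  p_cont : ContinuousOn p (Icc 0 T)
  a_deriv : ∀ t ∈ Icc 0 T, HasDerivWithinAt (fun s => J (H10.val (a s)))
    (J (mulV (b t) (n t)) + JD (H10.D (b t))) (Icc 0 T) t
  b_deriv : ∀ t ∈ Icc 0 T, HasDerivWithinAt (fun s => J (H10.val (b s)))
    (-(J (mulV (a t) (n t)) + JD (H10.D (a t)))) (Icc 0 T) t
  n_deriv : ∀ t ∈ Icc 0 T, HasDerivWithinAt (fun s => J (n s)) (-JD (p t)) (Icc 0 T) t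
  p_deriv : ∀ t ∈ Icc 0 T, HasDerivWithinAt (fun s => J (p s))
    (-JD (n t + H10.val (dens (a t) (b t)))) (Icc 0 T) t

theorem IsSystem.mono {T τ : ℝ} {a b : ℝ → H10} {n p : ℝ → L2} (h : IsSystem T a b n p)
    (hτ : τ ≤ T) : IsSystem τ a b n p := by
  have hs : Icc 0 τ ⊆ Icc 0 T := Icc_subset_Icc_right hτ
  exact ⟨h.a_cont.mono hs, h.b_cont.mono hs, h.n_cont.mono hs, h.p_cont.mono hs,
    fun t ht => (h.a_deriv t (hs ht)).mono hs, fun t ht => (h.b_deriv t (hs ht)).mono hs,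
    fun t ht => (h.n_deriv t (hs ht)).mono hs, fun t ht => (h.p_deriv t (hs ht)).mono hs⟩

/-! ### Calculus for curves that are differentiable in the dual -/

section Calculus

theorem sub_eq_integral_of_hasDerivWithinAt {E : Type*} [NormedAddCommGroup E] [NormedSpace ℝ E]
    [CompleteSpace E] {τ : ℝ} (hτ : 0 ≤ τ) {f g : ℝ → E}
    (hd : ∀ s ∈ Icc 0 τ, HasDerivWithinAt f (g s) (Icc 0 τ) s) (hg : ContinuousOn g (Icc 0 τ)) :
    f τ - f 0 = ∫ s in 0..τ, g s := by
  refine (intervalIntegral.integral_eq_sub_of_hasDerivAt_of_le hτ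
    (fun s hs => (hd s hs).continuousWithinAt) (fun s hs => ?_) ?_).symm
  · exact (hd s (Ioo_subset_Icc_self hs)).hasDerivAt (Icc_mem_nhds hs.1 hs.2)
  · exact ContinuousOn.intervalIntegrable (by rwa [uIcc_of_le hτ])

theorem sub_eq_integral_of_approx {τ : ℝ} (hτ : 0 ≤ τ) {f g : ℕ → ℝ → ℝ} {F G : ℝ → ℝ}
    (hd : ∀ j, ∀ s ∈ Icc 0 τ, HasDerivWithinAt (f j) (g j s) (Icc 0 τ) s)
    (hg : ∀ j, ContinuousOn (g j) (Icc 0 τ))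
    (C : ℝ) (hC : ∀ j, ∀ s ∈ Icc 0 τ, |g j s| ≤ C)
    (hG : ∀ s ∈ Icc 0 τ, Tendsto (fun j => g j s) atTop (𝓝 (G s)))
    (hF : ∀ s ∈ Icc 0 τ, Tendsto (fun j => f j s) atTop (𝓝 (F s))) :
    F τ - F 0 = ∫ s in 0..τ, G s := by
  have h1 : Tendsto (fun j => f j τ - f j 0) atTop (𝓝 (F τ - F 0)) :=
    (hF τ ⟨hτ, le_rfl⟩).sub (hF 0 ⟨le_rfl, hτ⟩)
  have hI : ∀ s ∈ uIoc 0 τ, s ∈ Icc 0 τ := fun s hs => by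
    rw [uIoc_of_le hτ] at hs; exact Ioc_subset_Icc_self hs
  have h2 : Tendsto (fun j => ∫ s in 0..τ, g j s) atTop (𝓝 (∫ s in 0..τ, G s)) := by
    refine intervalIntegral.tendsto_integral_filter_of_dominated_convergence (fun _ => C)
      (Eventually.of_forall fun j => ?_)
      (Eventually.of_forall fun j => Eventually.of_forall fun s hs => hC j s (hI s hs))
      intervalIntegrable_const (Eventually.of_forall fun s hs => hG s (hI s hs))
    rw [uIoc_of_le hτ]
    exact ((hg j).mono Ioc_subset_Icc_self).aestronglyMeasurable measurableSet_Ioc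
  refine tendsto_nhds_unique h1 (h2.congr fun j => ?_)
  exact (sub_eq_integral_of_hasDerivWithinAt hτ (hd j) (hg j)).symm

/-- Product rule for curves which are differentiable in the dual of `H¹₀`. -/
theorem hasDerivWithinAt_pair {α β : ℝ → H10} {α' β' : Dual10} {S : Set ℝ} {t : ℝ}
    (hα : HasDerivWithinAt (fun s => J (H10.val (α s))) α' S t)
    (hβ : HasDerivWithinAt (fun s => J (H10.val (β s))) β' S t)
    (hc : ContinuousWithinAt β S t) (A B : H10 →L[ℝ] H10)
    (hAB : ∀ v w, inner ℝ (H10.val v) (H10.val (A w)) = inner ℝ (H10.val w) (H10.val (B v))) :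
    HasDerivWithinAt (fun s => inner ℝ (H10.val (α s)) (H10.val (A (β s))))
      (pair α' (A (β t)) + pair β' (B (α t))) S t := by
  rw [hasDerivWithinAt_iff_tendsto_slope] at hα hβ ⊢
  have hc' : Tendsto (fun s => A (β s)) (𝓝[S \ {t}] t) (𝓝 (A (β t))) :=
    (A.continuous.tendsto _).comp (hc.mono sdiff_subset)
  have h1 : Tendsto (fun s => pair (slope (fun s => J (H10.val (α s))) t s) (A (β s)))
      (𝓝[S \ {t}] t) (𝓝 (pair α' (A (β t)))) :=
    tendsto_pair hα hc'
  have h2 : Tendsto (fun s => pair (slope (fun s => J (H10.val (β s))) t s) (B (α t)))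
      (𝓝[S \ {t}] t) (𝓝 (pair β' (B (α t)))) :=
    tendsto_pair hβ tendsto_const_nhds
  -- The increment is ⟨α(s) - α(t), A β(s)⟩ + ⟨α(t), A(β(s) - β(t))⟩, and `hAB` turns the second
  -- term into ⟨β(s) - β(t), B α(t)⟩.
  refine (h1.add h2).congr fun s => ?_
  simp only [slope_def_module, pair_smul, pair_sub, J_apply, smul_eq_mul]
  rw [← mul_add, ← hAB, ← hAB]
  ring

theorem exists_norm_bound {E : Type*} [NormedAddCommGroup E] {τ : ℝ} {f : ℝ → E}
    (hf : ContinuousOn f (Icc 0 τ)) : ∃ C, 0 ≤ C ∧ ∀ s ∈ Icc 0 τ, ‖f s‖ ≤ C := by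
  obtain ⟨C, hC⟩ := isCompact_Icc.exists_bound_of_continuousOn hf
  exact ⟨max C 0, le_max_right _ _, fun s hs => (hC s hs).trans (le_max_left _ _)⟩

end Calculus

/-! ### Mass and energy of the Schrödinger component -/

namespace IsSystem

variable {T : ℝ} {a b : ℝ → H10} {n p : ℝ → L2}

theorem mass_conservation (h : IsSystem T a b n p) (hT : 0 ≤ T) :
    ‖H10.val (a T)‖ ^ 2 + ‖H10.val (b T)‖ ^ 2 = ‖H10.val (a 0)‖ ^ 2 + ‖H10.val (b 0)‖ ^ 2 := by
  have hd : ∀ t ∈ Icc 0 T, HasDerivWithinAt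
      (fun s => inner ℝ (H10.val (a s)) (H10.val (a s)) + inner ℝ (H10.val (b s)) (H10.val (b s)))
      0 (Icc 0 T) t := by
    intro t ht
    have h1 := hasDerivWithinAt_pair (h.a_deriv t ht) (h.a_deriv t ht) (h.a_cont t ht)
      (ContinuousLinearMap.id ℝ H10) (ContinuousLinearMap.id ℝ H10)
      (fun v w => real_inner_comm _ _)
    have h2 := hasDerivWithinAt_pair (h.b_deriv t ht) (h.b_deriv t ht) (h.b_cont t ht)
      (ContinuousLinearMap.id ℝ H10) (ContinuousLinearMap.id ℝ H10)
      (fun v w => real_inner_comm _ _)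
    refine (h1.fun_add h2).congr_deriv ?_
    simp only [ContinuousLinearMap.id_apply, pair_add,
      pair_neg, J_apply, JD_apply]
    rw [mulV_eq, mulV_eq, inner_mulL, inner_mulL, ← mulV_eq, ← mulV_eq, mulV_val_comm (b t) (a t),
      real_inner_comm (H10.D (a t))]
    ring
  have := sub_eq_integral_of_hasDerivWithinAt hT hd continuousOn_const
  simp only [intervalIntegral.integral_zero, real_inner_self_eq_norm_sq] at this
  linarith

/-- The part of the energy which contains `u`. -/
def energyU (a b : H10) (n : L2) : ℝ :=
  ‖H10.D a‖ ^ 2 + ‖H10.D b‖ ^ 2 + inner ℝ n (H10.val (dens a b))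

-- The quantity -η⁻¹ Im ∫ u(s+η) ū(s) converges to the energy of u as η → 0, by the equation for
-- u_t. In its time derivative the terms with u_xx cancel by symmetry and only the difference
-- quotient of n, paired with Re u(s+η) ū(s), remains; its limit is the pairing of n_t = p_x with
-- |u|². The forward shift in time is the reason for τ < T.
set_option maxHeartbeats 1000000 in
theorem energyU_increment (h : IsSystem T a b n p) {τ : ℝ} (hτ : 0 ≤ τ) (hτT : τ < T) :
    energyU (a τ) (b τ) (n τ) - energyU (a 0) (b 0) (n 0) =
      ∫ s in 0..τ, -inner ℝ (p s) (H10.D (dens (a s) (b s))) := by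
  set η : ℕ → ℝ := fun j => (T - τ) / (j + 1) with hη
  have hη0 : ∀ j, 0 < η j := fun j => by
    have : 0 < T - τ := by linarith
    simp only [hη]; positivity
  have hη1 : ∀ j, η j ≤ T - τ := fun j => by
    simp only [hη]
    exact div_le_self (by linarith) (by simp)
  have hη2 : Tendsto η atTop (𝓝 0) := by
    have := (tendsto_one_div_add_atTop_nhds_zero_nat (𝕜 := ℝ)).const_mul (T - τ)
    rw [mul_zero] at this
    refine this.congr fun j => ?_
    simp only [hη]; ring
  have hmem : ∀ s ∈ Icc 0 τ, s ∈ Icc 0 T := fun s hs => ⟨hs.1, by linarith [hs.2]⟩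
  have hmem' : ∀ j, ∀ s ∈ Icc 0 τ, s + η j ∈ Icc 0 T := fun j s hs =>
    ⟨by linarith [hs.1, hη0 j], by linarith [hs.2, hη1 j]⟩
  have hmaps : ∀ j, MapsTo (fun s => s + η j) (Icc 0 τ) (Icc 0 T) := fun j s hs => hmem' j s hs
  have hshift : ∀ {E : Type} [NormedAddCommGroup E] [NormedSpace ℝ E] (f : ℝ → E) (f' : E) j,
      ∀ s ∈ Icc 0 τ, HasDerivWithinAt f f' (Icc 0 T) (s + η j) →
      HasDerivWithinAt (fun s => f (s + η j)) f' (Icc 0 τ) s := by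
    intro E _ _ f f' j s hs hf
    have := hf.scomp s ((hasDerivWithinAt_id s (Icc 0 τ)).add_const (η j)) (hmaps j)
    rw [one_smul] at this
    exact this
  have hcs : ∀ {E : Type} [TopologicalSpace E] (f : ℝ → E) j, ContinuousOn f (Icc 0 T) →
      ContinuousOn (fun s => f (s + η j)) (Icc 0 τ) := fun f j hf =>
    hf.comp (by fun_prop) (hmaps j)
  have hslope : ∀ s ∈ Icc 0 τ, ∀ {f : ℝ → Dual10} {f' : Dual10},
      HasDerivWithinAt f f' (Icc 0 T) s →
      Tendsto (fun j => (η j)⁻¹ • (f (s + η j) - f s)) atTop (𝓝 f') := by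
    intro s hs f f' hf
    rw [hasDerivWithinAt_iff_tendsto_slope] at hf
    have : Tendsto (fun j => s + η j) atTop (𝓝[Icc 0 T \ {s}] s) := by
      refine tendsto_nhdsWithin_iff.2 ⟨by simpa using hη2.const_add s,
        Eventually.of_forall fun j => ⟨hmem' j s hs, ?_⟩⟩
      simp [(hη0 j).ne']
    refine (hf.comp this).congr fun j => ?_
    simp [slope_def_module]
  set G : ℕ → ℝ → H10 := fun j s =>
    prodV (a (s + η j)) (a s) + prodV (b (s + η j)) (b s) with hGdef
  obtain ⟨Ca, hCa0, hCa⟩ := exists_norm_bound h.a_cont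
  obtain ⟨Cb, hCb0, hCb⟩ := exists_norm_bound h.b_cont
  obtain ⟨Cp, hCp0, hCp⟩ := exists_norm_bound (f := fun t => -JD (p t)) (τ := T) (by
    have := h.p_cont; fun_prop)
  have hGc : ∀ j, ContinuousOn (G j) (Icc 0 τ) := fun j => by
    have h1 := hcs a j h.a_cont
    have h2 := hcs b j h.b_cont
    have h3 := h.a_cont.mono hmem
    have h4 := h.b_cont.mono hmem
    exact (ContinuousOn.prodV h1 h3).add (ContinuousOn.prodV h2 h4)
  have hGb : ∀ j, ∀ s ∈ Icc 0 τ, ‖G j s‖ ≤ ‖prodV‖ * Ca * Ca + ‖prodV‖ * Cb * Cb := by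
    intro j s hs
    have key : ∀ {v w : H10} {C : ℝ}, ‖v‖ ≤ C → ‖w‖ ≤ C → ‖prodV v w‖ ≤ ‖prodV‖ * C * C := by
      intro v w C h1 h2
      refine (prodV.le_opNorm₂ v w).trans ?_
      have := (norm_nonneg v).trans h1
      gcongr
    exact (norm_add_le _ _).trans (add_le_add (key (hCa _ (hmem' j s hs)) (hCa _ (hmem s hs)))
      (key (hCb _ (hmem' j s hs)) (hCb _ (hmem s hs))))
  have hlip : ∀ j, ∀ s ∈ Icc 0 τ, ‖J (n (s + η j)) - J (n s)‖ ≤ Cp * η j := by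
    intro j s hs
    have := (convex_Icc 0 T).norm_image_sub_le_of_norm_hasDerivWithin_le (f := fun s => J (n s))
      (fun t ht => h.n_deriv t ht) hCp (hmem s hs) (hmem' j s hs)
    rwa [add_sub_cancel_left, Real.norm_of_nonneg (hη0 j).le] at this
  refine sub_eq_integral_of_approx hτ
    (f := fun j s => (η j)⁻¹ * (inner ℝ (H10.val (a (s + η j))) (H10.val (b s)) -
      inner ℝ (H10.val (b (s + η j))) (H10.val (a s))))
    (g := fun j s => (η j)⁻¹ * pair (J (n (s + η j)) - J (n s)) (G j s))
    (F := fun s => energyU (a s) (b s) (n s)) ?_ ?_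
    (Cp * (‖prodV‖ * Ca * Ca + ‖prodV‖ * Cb * Cb)) ?_ ?_ ?_
  · intro j s hs
    have hcb := (h.b_cont.mono hmem) s hs
    have hca := (h.a_cont.mono hmem) s hs
    have h1 := hasDerivWithinAt_pair
      (hshift _ _ j s hs (h.a_deriv _ (hmem' j s hs)))
      ((h.b_deriv s (hmem s hs)).mono hmem) hcb
      (ContinuousLinearMap.id ℝ H10) (ContinuousLinearMap.id ℝ H10)
      (fun v w => real_inner_comm _ _)
    have h2 := hasDerivWithinAt_pair
      (hshift _ _ j s hs (h.b_deriv _ (hmem' j s hs)))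
      ((h.a_deriv s (hmem s hs)).mono hmem) hca
      (ContinuousLinearMap.id ℝ H10) (ContinuousLinearMap.id ℝ H10)
      (fun v w => real_inner_comm _ _)
    refine ((h1.fun_sub h2).const_mul (η j)⁻¹).congr_deriv ?_
    congr 1
    simp only [hGdef, ContinuousLinearMap.id_apply, pair_add,
      pair_neg, pair_sub, J_apply, JD_apply]
    simp only [map_add, val_prodV, inner_add_right]
    have e : ∀ (v w : H10) (y : L2), inner ℝ (mulV v y) (H10.val w) =
        inner ℝ y (mulV v (H10.val w)) := fun v w y => inner_mulL _ _ _
    simp only [e]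
    rw [mulV_val_comm (a s) (a (s + η j)), mulV_val_comm (b s) (b (s + η j)),
      real_inner_comm (H10.D (a s)), real_inner_comm (H10.D (b s))]
    ring
  · intro j
    have h1 := hcs n j h.n_cont
    have h2 := h.n_cont.mono hmem
    have h3 := hGc j
    exact (ContinuousOn.pair ((J.continuous.comp_continuousOn h1).sub
      (J.continuous.comp_continuousOn h2)) h3).const_smul (η j)⁻¹
  · intro j s hs
    rw [abs_mul, abs_of_pos (inv_pos.2 (hη0 j)), inv_mul_le_iff₀ (hη0 j)]
    refine (abs_pair_le _ _).trans ?_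
    refine (mul_le_mul (hlip j s hs) (hGb j s hs) (norm_nonneg _)
      (mul_nonneg hCp0 (hη0 j).le)).trans (le_of_eq (by ring))
  · intro s hs
    have h1 := hslope s hs (h.n_deriv s (hmem s hs))
    have hsh : Tendsto (fun j => s + η j) atTop (𝓝[Icc 0 T] s) :=
      tendsto_nhdsWithin_iff.2 ⟨by simpa using hη2.const_add s,
        Eventually.of_forall fun j => hmem' j s hs⟩
    have h2 : Tendsto (fun j => G j s) atTop (𝓝 (dens (a s) (b s))) := by
      have ha : Tendsto (fun j => a (s + η j)) atTop (𝓝 (a s)) :=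
        (h.a_cont s (hmem s hs)).tendsto.comp hsh
      have hb : Tendsto (fun j => b (s + η j)) atTop (𝓝 (b s)) :=
        (h.b_cont s (hmem s hs)).tendsto.comp hsh
      exact (tendsto_prodV ha tendsto_const_nhds).add (tendsto_prodV hb tendsto_const_nhds)
    exact (tendsto_pair h1 h2).congr fun j => by rw [pair_smul]
  · intro s hs
    have h1 := tendsto_pair (hslope s hs (h.a_deriv s (hmem s hs)))
      (tendsto_const_nhds (x := b s))
    have h2 := tendsto_pair (hslope s hs (h.b_deriv s (hmem s hs)))
      (tendsto_const_nhds (x := a s))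
    have e : energyU (a s) (b s) (n s) =
        pair (J (mulV (b s) (n s)) + JD (H10.D (b s))) (b s) -
        pair (-(J (mulV (a s) (n s)) + JD (H10.D (a s)))) (a s) := by
      simp only [pair_add, pair_neg, J_apply, JD_apply]
      rw [mulV_eq, mulV_eq, inner_mulL, inner_mulL, energyU, val_dens, inner_add_right,
        real_inner_self_eq_norm_sq, real_inner_self_eq_norm_sq, mulV_eq, mulV_eq]
      ring
    rw [e]
    refine (h1.sub h2).congr fun j => ?_
    simp only [pair_smul, pair_sub, J_apply]
    rw [real_inner_comm (H10.val (a s)) (H10.val (b s))]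
    ring

end IsSystem

/-! ### The weighted momentum of the Schrödinger component -/

section Momentum

/-- The operator adjoint to `v ↦ χ Ra v`. -/
def KX (k j : ℕ) : H10 →L[ℝ] H10 := (K j).comp ((X k).comp H10.val)

theorem KX_apply (k j : ℕ) (v : H10) : KX k j v = K j (H10.val (XV k v)) := rfl

/-- The operator `v ↦ χ Ra v` on `H¹₀`. -/
def XRaV (k j : ℕ) : H10 →L[ℝ] H10 := (XRa k j).comp H10.val

theorem XRaV_apply (k j : ℕ) (v : H10) : XRaV k j v = XRa k j (H10.val v) := rfl

theorem inner_XRaV (k j : ℕ) (v w : H10) :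
    inner ℝ (H10.val v) (H10.val (XRaV k j w)) = inner ℝ (H10.val w) (H10.val (KX k j v)) := by
  rw [XRaV_apply, val_XRa, KX_apply, val_K, val_XV, ← inner_X, real_inner_comm, inner_Ra]

theorem val_XRaV_sub_KX (k j : ℕ) (v : H10) :
    H10.val (XRaV k j v) - H10.val (KX k j v) =
      del j • (X k (Ra j (H10.D v)) + R j (H10.D (XV k v))) := by
  rw [XRaV_apply, val_XRa, KX_apply, val_K, R_val, Ra_val, map_add, map_smul, val_XV, smul_add]
  abel

/-- `KX k j` is the adjoint of `XRaV k j`. The leading terms of the two derivatives agree against v'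
(`h1`), so the difference carries a factor δ, which the quotient defining the regularized momentum
removes. -/
theorem inner_D_XRaV_sub_KX (k j : ℕ) (v : H10) :
    inner ℝ (H10.D v) (H10.D (XRaV k j v)) - inner ℝ (H10.D v) (H10.D (KX k j v)) =
      del j * (inner ℝ (H10.D v) (dX k (Ra j (H10.D v))) +
        inner ℝ (Ra j (H10.D v)) (H10.D (dXV k v))) := by
  have h1 : inner ℝ (H10.D v) (X k (Ra j (H10.D v))) = inner ℝ (H10.D v) (R j (X k (H10.D v))) := by
    rw [← inner_X, real_inner_comm, inner_Ra, real_inner_comm, inner_R]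
  have h2 := R_val j (dXV k v)
  rw [val_dXV] at h2
  rw [XRaV_apply, D_XRa_val, KX_apply, D_K_val, D_XV, map_add (R j), Ra_val, map_add (dX k),
    map_smul (dX k), inner_add_right, inner_add_right, inner_add_right, h1, h2, inner_sub_right,
    real_inner_smul_right, real_inner_smul_right, inner_Ra]
  ring

/-- The contribution of one component of `u` to the regularized momentum flux. -/
def momentumFluxAux (k j : ℕ) (v : H10) (n : L2) : ℝ :=
  inner ℝ (mulV v n) (X k (Ra j (H10.D v)) + R j (H10.D (XV k v))) +
    (inner ℝ (H10.D v) (dX k (Ra j (H10.D v))) + inner ℝ (Ra j (H10.D v)) (H10.D (dXV k v)))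

theorem momentumFluxAux_eq (k j : ℕ) (v : H10) (n : L2) :
    (del j)⁻¹ * ((inner ℝ (mulV v n) (H10.val (XRaV k j v)) +
      inner ℝ (H10.D v) (H10.D (XRaV k j v))) - (inner ℝ (mulV v n) (H10.val (KX k j v)) +
      inner ℝ (H10.D v) (H10.D (KX k j v)))) = momentumFluxAux k j v n := by
  have h1 := inner_D_XRaV_sub_KX k j v
  have h2 : inner ℝ (mulV v n) (H10.val (XRaV k j v)) - inner ℝ (mulV v n) (H10.val (KX k j v)) =
      del j * inner ℝ (mulV v n) (X k (Ra j (H10.D v)) + R j (H10.D (XV k v))) := by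
    rw [← inner_sub_right, val_XRaV_sub_KX, real_inner_smul_right]
  rw [inv_mul_eq_iff_eq_mul₀ (del_pos j).ne', momentumFluxAux, mul_add, ← h1, ← h2]
  ring

theorem abs_inner_le {y z : L2} {A B : ℝ} (hy : ‖y‖ ≤ A) (hz : ‖z‖ ≤ B) :
    |inner ℝ y z| ≤ A * B :=
  (abs_real_inner_le_norm y z).trans (mul_le_mul hy hz (norm_nonneg _) ((norm_nonneg _).trans hy))

theorem norm_dX_le (k : ℕ) (y : L2) : ‖dX k y‖ ≤ rate k * ‖y‖ := by
  rw [dX_apply, norm_smul, Real.norm_of_nonneg (rate_pos k).le]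
  exact mul_le_mul_of_nonneg_left (norm_W_le k y) (rate_pos k).le

theorem abs_momentumFluxAux_le (k j : ℕ) {v : H10} {n : L2} {A B : ℝ} (hv : ‖v‖ ≤ A)
    (hB : ‖mulV v n‖ ≤ B) :
    |momentumFluxAux k j v n| ≤
      B * (A + (‖H10.D.comp (XV k)‖ * A)) +
        (A * (rate k * A) + A * (‖H10.D.comp (dXV k)‖ * A)) := by
  have hD : ‖H10.D v‖ ≤ A := v.norm_D_le.trans hv
  have hRa : ‖Ra j (H10.D v)‖ ≤ A := (norm_Ra_le _ _).trans hD
  have h1 : ‖X k (Ra j (H10.D v))‖ ≤ A := (norm_X_le _ _).trans hRa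
  have h2 : ‖H10.D (XV k v)‖ ≤ ‖H10.D.comp (XV k)‖ * A :=
    (ContinuousLinearMap.le_opNorm (H10.D.comp (XV k)) v).trans
      (mul_le_mul_of_nonneg_left hv (norm_nonneg _))
  have h3 : ‖H10.D (dXV k v)‖ ≤ ‖H10.D.comp (dXV k)‖ * A :=
    (ContinuousLinearMap.le_opNorm (H10.D.comp (dXV k)) v).trans
      (mul_le_mul_of_nonneg_left hv (norm_nonneg _))
  have h4 : ‖dX k (Ra j (H10.D v))‖ ≤ rate k * A :=
    (norm_dX_le _ _).trans (mul_le_mul_of_nonneg_left hRa (rate_pos k).le)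
  refine (abs_add_le _ _).trans (add_le_add (abs_inner_le hB ?_)
    ((abs_add_le _ _).trans (add_le_add (abs_inner_le hD h4) (abs_inner_le hRa h3))))
  exact (norm_add_le _ _).trans (add_le_add h1 ((norm_R_le _ _).trans h2))

theorem tendsto_momentumFluxAux (k : ℕ) (v : H10) (n : L2) :
    Tendsto (fun j => momentumFluxAux k j v n) atTop
      (𝓝 (inner ℝ (mulV v n) (X k (H10.D v) + H10.D (XV k v)) +
        (inner ℝ (H10.D v) (dX k (H10.D v)) + inner ℝ (H10.D v) (H10.D (dXV k v))))) := by
  have h1 := tendsto_Ra (H10.D v)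
  have h2 := tendsto_R (H10.D (XV k v))
  have hX : Tendsto (fun j => X k (Ra j (H10.D v))) atTop (𝓝 (X k (H10.D v))) :=
    ((X k).continuous.tendsto _).comp h1
  have hdX : Tendsto (fun j => dX k (Ra j (H10.D v))) atTop (𝓝 (dX k (H10.D v))) :=
    ((dX k).continuous.tendsto _).comp h1
  exact (tendsto_const_nhds.inner (hX.add h2)).add
    ((tendsto_const_nhds.inner hdX).add (h1.inner tendsto_const_nhds))

/-- The weighted momentum `Im ∫ χ ū uₓ` of `u = a + i b`. -/
def momentum (k : ℕ) (a b : H10) : ℝ :=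
  inner ℝ (X k (H10.val a)) (H10.D b) - inner ℝ (X k (H10.val b)) (H10.D a)

namespace IsSystem

variable {T : ℝ} {a b : ℝ → H10} {n p : ℝ → L2}

/-- Since Ra w = w + δ Ra w', the quotient δ⁻¹ (⟨a, χ Ra b⟩ - ⟨b, χ Ra a⟩) tends to the momentum:
the terms of order zero cancel by symmetry of χ. Its time derivative involves only the difference of
χ Ra and its adjoint, which is of order δ. -/
theorem momentum_increment (h : IsSystem T a b n p) (hT : 0 ≤ T) (k : ℕ) :
    momentum k (a T) (b T) - momentum k (a 0) (b 0) =
      ∫ s in 0..T, ((inner ℝ (mulV (a s) (n s)) (X k (H10.D (a s)) + H10.D (XV k (a s))) +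
        (inner ℝ (H10.D (a s)) (dX k (H10.D (a s))) +
          inner ℝ (H10.D (a s)) (H10.D (dXV k (a s))))) +
        (inner ℝ (mulV (b s) (n s)) (X k (H10.D (b s)) + H10.D (XV k (b s))) +
        (inner ℝ (H10.D (b s)) (dX k (H10.D (b s))) +
          inner ℝ (H10.D (b s)) (H10.D (dXV k (b s)))))) := by
  have ha := h.a_cont
  have hb := h.b_cont
  have hn := h.n_cont
  have han := ContinuousOn.mulV ha hn
  have hbn := ContinuousOn.mulV hb hn
  obtain ⟨A, hA0, hA⟩ := exists_norm_bound ha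
  obtain ⟨B, hB0, hB⟩ := exists_norm_bound hb
  obtain ⟨A', hA0', hA'⟩ := exists_norm_bound han
  obtain ⟨B', hB0', hB'⟩ := exists_norm_bound hbn
  refine sub_eq_integral_of_approx hT
    (f := fun j s => (del j)⁻¹ * (inner ℝ (H10.val (a s)) (H10.val (XRaV k j (b s))) -
      inner ℝ (H10.val (b s)) (H10.val (XRaV k j (a s)))))
    (g := fun j s => momentumFluxAux k j (a s) (n s) + momentumFluxAux k j (b s) (n s))
    (F := fun s => momentum k (a s) (b s)) ?_ ?_
    ((A' * (A + (‖H10.D.comp (XV k)‖ * A)) +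
        (A * (rate k * A) + A * (‖H10.D.comp (dXV k)‖ * A))) +
      (B' * (B + (‖H10.D.comp (XV k)‖ * B)) +
        (B * (rate k * B) + B * (‖H10.D.comp (dXV k)‖ * B)))) ?_ ?_ ?_
  · intro j s hs
    have h1 := hasDerivWithinAt_pair (h.a_deriv s hs) (h.b_deriv s hs) (hb s hs) (XRaV k j)
      (KX k j) (inner_XRaV k j)
    have h2 := hasDerivWithinAt_pair (h.b_deriv s hs) (h.a_deriv s hs) (ha s hs) (XRaV k j)
      (KX k j) (inner_XRaV k j)
    refine ((h1.fun_sub h2).const_mul (del j)⁻¹).congr_deriv ?_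
    simp only [pair_add, pair_neg, J_apply, JD_apply]
    rw [← momentumFluxAux_eq, ← momentumFluxAux_eq]
    ring
  · intro j
    unfold momentumFluxAux
    fun_prop
  · intro j s hs
    exact (abs_add_le _ _).trans (add_le_add
      (abs_momentumFluxAux_le k j (hA s hs) (hA' s hs))
      (abs_momentumFluxAux_le k j (hB s hs) (hB' s hs)))
  · intro s hs
    exact (tendsto_momentumFluxAux k _ _).add (tendsto_momentumFluxAux k _ _)
  · intro s hs
    have key : ∀ v w : H10, ∀ j, (del j)⁻¹ * (inner ℝ (H10.val v) (H10.val (XRaV k j w)) -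
        inner ℝ (H10.val v) (X k (H10.val w))) = inner ℝ (X k (H10.val v)) (Ra j (H10.D w)) := by
      intro v w j
      rw [XRaV_apply, val_XRa, Ra_val, map_add, map_smul, inner_add_right, real_inner_smul_right,
        add_sub_cancel_left, inv_mul_cancel_left₀ (del_pos j).ne', inner_X]
    have h1 : Tendsto (fun j => inner ℝ (X k (H10.val (a s))) (Ra j (H10.D (b s))) -
        inner ℝ (X k (H10.val (b s))) (Ra j (H10.D (a s)))) atTop
        (𝓝 (momentum k (a s) (b s))) :=
      (tendsto_const_nhds.inner (tendsto_Ra _)).sub (tendsto_const_nhds.inner (tendsto_Ra _))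
    refine h1.congr fun j => ?_
    rw [← key, ← key, ← inner_X k (H10.val (b s)) (H10.val (a s)),
      real_inner_comm (H10.val (a s)) (X k (H10.val (b s)))]
    ring

/-- The momentum of `u` grows at least at the rate given by the coupling with `n`. -/
theorem momentum_increment_ge (h : IsSystem T a b n p) (hT : 0 ≤ T) (k : ℕ) :
    ∫ s in 0..T, (inner ℝ (X k (n s)) (H10.D (dens (a s) (b s))) +
      inner ℝ (n s) (dX k (H10.val (dens (a s) (b s))))) ≤
    momentum k (a T) (b T) - momentum k (a 0) (b 0) := by
  have ha := h.a_cont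
  have hb := h.b_cont
  have hn := h.n_cont
  have han := ContinuousOn.mulV ha hn
  have hbn := ContinuousOn.mulV hb hn
  have hd := ContinuousOn.dens ha hb
  rw [h.momentum_increment hT]
  refine intervalIntegral.integral_mono_on hT ?_ ?_ fun s hs => ?_
  · refine ContinuousOn.intervalIntegrable ?_
    rw [uIcc_of_le hT]
    fun_prop
  · refine ContinuousOn.intervalIntegrable ?_
    rw [uIcc_of_le hT]
    fun_prop
  · have h1 := momentum_flux_nonneg k (a s)
    have h2 := momentum_flux_nonneg k (b s)
    rw [real_inner_comm, real_inner_comm (H10.D (a s)) (H10.D (dXV k (a s)))] at h1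
    rw [real_inner_comm, real_inner_comm (H10.D (b s)) (H10.D (dXV k (b s)))] at h2
    have key : ∀ v : H10, inner ℝ (mulV v (n s)) (X k (H10.D v) + H10.D (XV k v)) =
        2 * inner ℝ (X k (n s)) (mulV v (H10.D v)) +
          inner ℝ (n s) (dX k (mulV v (H10.val v))) := by
      intro v
      rw [mulV_eq, inner_mulL, ← mulV_eq, D_XV, map_add, map_add, ← X_mulV, ← dX_mulV,
        inner_add_right, inner_add_right, inner_X]
      ring
    rw [key, key, D_dens, val_dens, map_add (dX k), inner_add_right, real_inner_smul_right,
      inner_add_right]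
    linarith

end IsSystem

end Momentum

/-! ### Weighted energy and momentum of the wave component -/

section Wave

/-- The space derivative of `Ra y`. -/
def dRa (j : ℕ) (y : L2) : L2 := (del j)⁻¹ • (Ra j y - y)

/-- Integration by parts in ∫ χ (Ra y · Ra z)_x; no boundary value appears because `X k (Ra j y)`
vanishes at 0. -/
theorem inner_X_dRa (k j : ℕ) (y z : L2) :
    inner ℝ (X k (Ra j y)) (dRa j z) + inner ℝ (X k (Ra j z)) (dRa j y) =
      -inner ℝ (dX k (Ra j y)) (Ra j z) := by
  obtain ⟨c, hc⟩ := Ra_hasPrim j z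
  have h := hc.inner_D (XRa k j y)
  rw [D_XRa, val_XRa, inner_add_right] at h
  rw [inner_X k (Ra j z), real_inner_comm (dRa j z), real_inner_comm (Ra j z)]
  unfold dRa
  linarith

/-- Regularization of the dual of `H¹₀`. -/
def regDual (j : ℕ) : Dual10 →L[ℝ] L2 :=
  LinearMap.mkContinuous
    { toFun := fun ℓ => (InnerProductSpace.toDual ℝ L2).symm ((pair ℓ).comp (K j))
      map_add' := fun ℓ ℓ' => by
        rw [map_add, ContinuousLinearMap.add_comp, map_add]
      map_smul' := fun r ℓ => by
        rw [map_smul, ContinuousLinearMap.smul_comp, map_smulₛₗ]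
        rfl } (‖K j‖) fun ℓ => by
      change ‖(InnerProductSpace.toDual ℝ L2).symm ((pair ℓ).comp (K j))‖ ≤ _
      rw [LinearIsometryEquiv.norm_map]
      refine ContinuousLinearMap.opNorm_le_bound _ (by positivity) fun y => ?_
      refine (abs_pair_le ℓ (K j y)).trans ?_
      refine (mul_le_mul_of_nonneg_left ((K j).le_opNorm y) (norm_nonneg ℓ)).trans (le_of_eq ?_)
      ring

theorem inner_regDual (j : ℕ) (ℓ : Dual10) (y : L2) : inner ℝ (regDual j ℓ) y = pair ℓ (K j y) :=
  InnerProductSpace.toDual_symm_apply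

theorem regDual_J (j : ℕ) (y : L2) : regDual j (J y) = Ra j y := by
  refine ext_inner_right ℝ fun z => ?_
  rw [inner_regDual, J_apply, val_K, inner_Ra]

/-- The distributional derivative of `y` is regularized to a function. Hence `Ra j (n s)` and `Ra j
(p s)` solve a first order wave system in L², where the product rule is available. -/
theorem regDual_neg_JD (j : ℕ) (y : L2) : regDual j (-JD y) = dRa j y := by
  refine ext_inner_right ℝ fun z => ?_
  rw [inner_regDual, pair_neg, JD_apply, D_K, dRa, real_inner_smul_left, real_inner_smul_right,
    inner_sub_left, inner_sub_right, inner_Ra]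
  ring

theorem dRa_add_val (j : ℕ) (y : L2) (v : H10) :
    dRa j (y + H10.val v) = dRa j y + Ra j (H10.D v) := by
  rw [← Ra_hasPrim_val, dRa, dRa, map_add, ← smul_add]
  congr 1; abel

namespace IsSystem

variable {T : ℝ} {a b : ℝ → H10} {n p : ℝ → L2}

theorem hasDerivWithinAt_Ra_n (h : IsSystem T a b n p) (j : ℕ) {t : ℝ} (ht : t ∈ Icc 0 T) :
    HasDerivWithinAt (fun s => Ra j (n s)) (dRa j (p t)) (Icc 0 T) t := by
  have := (regDual j).hasFDerivAt.comp_hasDerivWithinAt t (h.n_deriv t ht)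
  rw [regDual_neg_JD] at this
  refine this.congr_of_mem (fun s _ => ?_) ht
  rw [← regDual_J]; rfl

theorem hasDerivWithinAt_Ra_p (h : IsSystem T a b n p) (j : ℕ) {t : ℝ} (ht : t ∈ Icc 0 T) :
    HasDerivWithinAt (fun s => Ra j (p s))
      (dRa j (n t) + Ra j (H10.D (dens (a t) (b t)))) (Icc 0 T) t := by
  have := (regDual j).hasFDerivAt.comp_hasDerivWithinAt t (h.p_deriv t ht)
  rw [regDual_neg_JD, dRa_add_val] at this
  refine this.congr_of_mem (fun s _ => ?_) ht
  rw [← regDual_J]; rfl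

theorem hasDerivWithinAt_inner_X {k : ℕ} {f g : ℝ → L2} {f' g' : L2} {S : Set ℝ} {t : ℝ}
    (hf : HasDerivWithinAt f f' S t) (hg : HasDerivWithinAt g g' S t) :
    HasDerivWithinAt (fun s => inner ℝ (X k (f s)) (g s))
      (inner ℝ (X k (f t)) g' + inner ℝ (X k (g t)) f') S t := by
  have h1 := (X k).hasFDerivAt.comp_hasDerivWithinAt t hf
  have h2 := h1.inner ℝ hg
  refine h2.congr_deriv ?_
  rw [inner_X k f', real_inner_comm f']
  rfl

theorem tendsto_inner_Ra (L : L2 →L[ℝ] L2) (y z : L2) :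
    Tendsto (fun j => inner ℝ (L (Ra j y)) (Ra j z)) atTop (𝓝 (inner ℝ (L y) z)) :=
  (((L.continuous.tendsto _).comp (tendsto_Ra y))).inner (tendsto_Ra z)

theorem abs_inner_Ra_le {L : L2 →L[ℝ] L2} {j : ℕ} {y z : L2} {A B : ℝ} (hy : ‖y‖ ≤ A)
    (hz : ‖z‖ ≤ B) : |inner ℝ (L (Ra j y)) (Ra j z)| ≤ ‖L‖ * A * B := by
  refine abs_inner_le ((L.le_opNorm _).trans ?_) ((norm_Ra_le _ _).trans hz)
  exact mul_le_mul_of_nonneg_left ((norm_Ra_le _ _).trans hy) (norm_nonneg _)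

theorem wave_energy_increment (h : IsSystem T a b n p) (hT : 0 ≤ T) (k : ℕ) :
    (inner ℝ (X k (n T)) (n T) + inner ℝ (X k (p T)) (p T)) / 2 -
      (inner ℝ (X k (n 0)) (n 0) + inner ℝ (X k (p 0)) (p 0)) / 2 =
      ∫ s in 0..T, (-inner ℝ (dX k (n s)) (p s) +
        inner ℝ (X k (p s)) (H10.D (dens (a s) (b s)))) := by
  have hn := h.n_cont
  have hp := h.p_cont
  have hd := H10.D.continuous.comp_continuousOn (ContinuousOn.dens h.a_cont h.b_cont)
  obtain ⟨A, hA0, hA⟩ := exists_norm_bound hn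
  obtain ⟨B, hB0, hB⟩ := exists_norm_bound hp
  obtain ⟨C, hC0, hC⟩ := exists_norm_bound hd
  refine sub_eq_integral_of_approx hT
    (f := fun j s => (inner ℝ (X k (Ra j (n s))) (Ra j (n s)) +
      inner ℝ (X k (Ra j (p s))) (Ra j (p s))) / 2)
    (g := fun j s => -inner ℝ (dX k (Ra j (n s))) (Ra j (p s)) +
      inner ℝ (X k (Ra j (p s))) (Ra j (H10.D (dens (a s) (b s)))))
    (F := fun s => (inner ℝ (X k (n s)) (n s) + inner ℝ (X k (p s)) (p s)) / 2) ?_ ?_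
    (‖dX k‖ * A * B + ‖X k‖ * B * C) ?_ ?_ ?_
  · intro j s hs
    have h1 := h.hasDerivWithinAt_Ra_n j hs
    have h2 := h.hasDerivWithinAt_Ra_p j hs
    refine (((hasDerivWithinAt_inner_X (k := k) h1 h1).fun_add
      (hasDerivWithinAt_inner_X (k := k) h2 h2)).div_const 2).congr_deriv ?_
    rw [← inner_X_dRa, inner_add_right]
    ring
  · intro j
    have h3 : ContinuousOn (fun s => H10.D (dens (a s) (b s))) (Icc 0 T) := hd
    fun_prop
  · intro j s hs
    refine (abs_add_le _ _).trans (add_le_add ?_ (abs_inner_Ra_le (hB s hs) (hC s hs)))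
    rw [abs_neg]
    exact abs_inner_Ra_le (hA s hs) (hB s hs)
  · intro s hs
    exact (tendsto_inner_Ra _ _ _).neg.add (tendsto_inner_Ra _ _ _)
  · intro s hs
    exact ((tendsto_inner_Ra _ _ _).add (tendsto_inner_Ra _ _ _)).div_const 2

theorem wave_momentum_increment (h : IsSystem T a b n p) (hT : 0 ≤ T) (k : ℕ) :
    inner ℝ (X k (n T)) (p T) - inner ℝ (X k (n 0)) (p 0) =
      ∫ s in 0..T, (-(inner ℝ (dX k (n s)) (n s) + inner ℝ (dX k (p s)) (p s)) / 2 +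
        inner ℝ (X k (n s)) (H10.D (dens (a s) (b s)))) := by
  have hn := h.n_cont
  have hp := h.p_cont
  have hd := H10.D.continuous.comp_continuousOn (ContinuousOn.dens h.a_cont h.b_cont)
  obtain ⟨A, hA0, hA⟩ := exists_norm_bound hn
  obtain ⟨B, hB0, hB⟩ := exists_norm_bound hp
  obtain ⟨C, hC0, hC⟩ := exists_norm_bound hd
  refine sub_eq_integral_of_approx hT
    (f := fun j s => inner ℝ (X k (Ra j (n s))) (Ra j (p s)))
    (g := fun j s => -(inner ℝ (dX k (Ra j (n s))) (Ra j (n s)) +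
      inner ℝ (dX k (Ra j (p s))) (Ra j (p s))) / 2 +
      inner ℝ (X k (Ra j (n s))) (Ra j (H10.D (dens (a s) (b s)))))
    (F := fun s => inner ℝ (X k (n s)) (p s)) ?_ ?_
    ((‖dX k‖ * A * A + ‖dX k‖ * B * B) / 2 + ‖X k‖ * A * C) ?_ ?_ ?_
  · intro j s hs
    have h1 := h.hasDerivWithinAt_Ra_n j hs
    have h2 := h.hasDerivWithinAt_Ra_p j hs
    refine (hasDerivWithinAt_inner_X (k := k) h1 h2).congr_deriv ?_
    have h3 := inner_X_dRa k j (n s) (n s)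
    have h4 := inner_X_dRa k j (p s) (p s)
    rw [inner_add_right]
    linarith
  · intro j
    have h3 : ContinuousOn (fun s => H10.D (dens (a s) (b s))) (Icc 0 T) := hd
    fun_prop
  · intro j s hs
    refine (abs_add_le _ _).trans (add_le_add ?_ (abs_inner_Ra_le (hA s hs) (hC s hs)))
    rw [abs_div, abs_neg, abs_two]
    refine div_le_div_of_nonneg_right ((abs_add_le _ _).trans (add_le_add
      (abs_inner_Ra_le (hA s hs) (hA s hs)) (abs_inner_Ra_le (hB s hs) (hB s hs)))) zero_le_two
  · intro s hs
    exact (((tendsto_inner_Ra _ _ _).add (tendsto_inner_Ra _ _ _)).neg.div_const 2).add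
      (tendsto_inner_Ra _ _ _)
  · intro s hs
    exact tendsto_inner_Ra _ _ _

end IsSystem

end Wave

/-! ### Removal of the weight and the energy inequality -/

theorem tendsto_rate : Tendsto rate atTop atTop :=
  tendsto_atTop_add_const_right _ _ tendsto_natCast_atTop_atTop

theorem tendsto_W (y : L2) : Tendsto (fun k => W k y) atTop (𝓝 0) := by
  rw [tendsto_zero_iff_norm_tendsto_zero]
  have h : Tendsto (fun k => ∫ x in Ioi 0, (W k y x) ^ 2) atTop (𝓝 (∫ _ in Ioi (0 : ℝ), (0 : ℝ))) := by
    have hW : ∀ᵐ x ∂hlMeasure, ∀ k, W k y x = Real.exp (-(rate k * x)) * y x :=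
      ae_all_iff.2 fun k => coeFn_W k y
    have hle : ∀ᵐ x ∂hlMeasure, ∀ k, ‖Real.exp (-(rate k * x))‖ ≤ 1 :=
      ae_all_iff.2 ae_expWeight_le
    refine tendsto_integral_of_dominated_convergence (fun x => (y x) ^ 2)
      (fun k => (Lp.aestronglyMeasurable _).pow 2) (Lp.memLp y).integrable_sq ?_ ?_
    · intro k
      filter_upwards [hW, hle] with x h1 h2
      rw [h1, norm_pow, norm_mul, mul_pow, Real.norm_eq_abs (y x), sq_abs]
      exact mul_le_of_le_one_left (sq_nonneg _) (pow_le_one₀ (norm_nonneg _) (h2 k))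
    · filter_upwards [hW, ae_restrict_mem measurableSet_Ioi] with x h1 hx
      have h2 : Tendsto (fun k => Real.exp (-(rate k * x))) atTop (𝓝 0) :=
        Real.tendsto_exp_neg_atTop_nhds_zero.comp (tendsto_rate.atTop_mul_const hx)
      have h3 := (h2.mul_const (y x)).pow 2
      simp only [zero_mul, ne_eq, OfNat.ofNat_ne_zero, not_false_eq_true, zero_pow] at h3
      exact h3.congr fun k => by rw [h1]
  have h2 := h.sqrt
  simp only [integral_zero, Real.sqrt_zero] at h2
  refine h2.congr fun k => ?_
  rw [← L2.norm_sq, Real.sqrt_sq (norm_nonneg _)]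

/-- `W k v` is in H¹₀, hence orthogonal to its derivative W v' - r W v. This gives r ‖W v‖² = ⟨W v,
W v'⟩, a Hardy type bound: χ' v tends to zero although χ' itself has integral one. -/
theorem norm_dX_val_le (k : ℕ) (v : H10) : ‖dX k (H10.val v)‖ ≤ ‖W k (H10.D v)‖ := by
  have hmem := (mem_h10_iff _ _).2 (v.hasPrim.W k)
  have h := H10.inner_val_D_self (H10.mk _ _ hmem)
  rw [H10.val_mk, H10.D_mk, inner_sub_right, real_inner_smul_right,
    real_inner_self_eq_norm_sq] at h
  have h2 := real_inner_le_norm (W k (H10.val v)) (W k (H10.D v))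
  rw [dX_apply, norm_smul, Real.norm_of_nonneg (rate_pos k).le]
  rcases (norm_nonneg (W k (H10.val v))).eq_or_lt with h0 | h0
  · rw [← h0, mul_zero]; exact norm_nonneg _
  · refine le_of_mul_le_mul_left ?_ h0
    nlinarith

theorem tendsto_X (y : L2) : Tendsto (fun k => X k y) atTop (𝓝 y) := by
  have := (tendsto_W y).const_sub y
  rw [sub_zero] at this
  exact this

theorem tendsto_integral_of_bound {τ : ℝ} (hτ : 0 ≤ τ) {g : ℕ → ℝ → ℝ} {G : ℝ → ℝ}
    (hg : ∀ j, ContinuousOn (g j) (Icc 0 τ)) (C : ℝ) (hC : ∀ j, ∀ s ∈ Icc 0 τ, |g j s| ≤ C)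
    (hG : ∀ s ∈ Icc 0 τ, Tendsto (fun j => g j s) atTop (𝓝 (G s))) :
    Tendsto (fun j => ∫ s in 0..τ, g j s) atTop (𝓝 (∫ s in 0..τ, G s)) := by
  have hI : ∀ s ∈ uIoc 0 τ, s ∈ Icc 0 τ := fun s hs => by
    rw [uIoc_of_le hτ] at hs; exact Ioc_subset_Icc_self hs
  refine intervalIntegral.tendsto_integral_filter_of_dominated_convergence (fun _ => C)
    (Eventually.of_forall fun j => ?_)
    (Eventually.of_forall fun j => Eventually.of_forall fun s hs => hC j s (hI s hs))
    intervalIntegrable_const (Eventually.of_forall fun s hs => hG s (hI s hs))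
  rw [uIoc_of_le hτ]
  exact ((hg j).mono Ioc_subset_Icc_self).aestronglyMeasurable measurableSet_Ioc

/-- The energy of the system. -/
def energy (a b : H10) (n p : L2) : ℝ := IsSystem.energyU a b n + (‖n‖ ^ 2 + ‖p‖ ^ 2) / 2

/-- A bound for the momentum of the system. -/
def momentumBound (a b : H10) (n p : L2) : ℝ :=
  ‖n‖ * ‖p‖ + (‖H10.val a‖ * ‖H10.D b‖ + ‖H10.val b‖ * ‖H10.D a‖)

theorem abs_momentum_add_le (k : ℕ) (a b : H10) (n p : L2) :
    |inner ℝ (X k n) p| + |momentum k a b| ≤ momentumBound a b n p := by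
  refine add_le_add (abs_inner_le (norm_X_le _ _) le_rfl) ((abs_sub _ _).trans (add_le_add
    (abs_inner_le (norm_X_le _ _) le_rfl) (abs_inner_le (norm_X_le _ _) le_rfl)))

theorem norm_mulV_self_sq_le (v : H10) :
    ‖mulV v (H10.val v)‖ ^ 2 ≤ 2 * ‖H10.val v‖ ^ 3 * ‖H10.D v‖ := by
  rw [L2.norm_sq (mulV v (H10.val v))]
  have h1 : ∫ x in Ioi 0, (mulV v (H10.val v) x) ^ 2 ≤
      ∫ x in Ioi 0, (2 * ‖H10.val v‖ * ‖H10.D v‖) * (H10.val v x) ^ 2 := by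
    refine integral_mono_ae (Lp.memLp _).integrable_sq
      ((Lp.memLp _).integrable_sq.const_mul _) ?_
    filter_upwards [coeFn_mulV v (H10.val v), v.ae_sq_le] with x h1 h2
    rw [h1, mul_pow]
    exact mul_le_mul_of_nonneg_right h2 (sq_nonneg _)
  rw [integral_const_mul, ← L2.norm_sq (H10.val v)] at h1
  refine h1.trans (le_of_eq (by ring))

/-- The fractions 1/4 and 1/2 leave part of ‖n‖²/2 and of ‖u_x‖² in the energy; the remainder
involves only the conserved mass. -/
theorem abs_inner_dens_le (a b : H10) (n : L2) :
    |inner ℝ n (H10.val (dens a b))| ≤ ‖n‖ ^ 2 / 4 + (‖H10.D a‖ ^ 2 + ‖H10.D b‖ ^ 2) / 2 +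
      8 * (‖H10.val a‖ ^ 2 + ‖H10.val b‖ ^ 2) ^ 3 := by
  have h0 := abs_real_inner_le_norm n (H10.val (dens a b))
  have h1 : ‖H10.val (dens a b)‖ ≤ ‖mulV a (H10.val a)‖ + ‖mulV b (H10.val b)‖ := norm_add_le _ _
  have h2 := norm_mulV_self_sq_le a
  have h3 := norm_mulV_self_sq_le b
  set x := ‖mulV a (H10.val a)‖
  set y := ‖mulV b (H10.val b)‖
  set A := ‖H10.val a‖
  set B := ‖H10.val b‖
  set A' := ‖H10.D a‖
  set B' := ‖H10.D b‖
  have hA : 0 ≤ A ^ 2 := sq_nonneg _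
  have hB : 0 ≤ B ^ 2 := sq_nonneg _
  have h4 : ‖n‖ * ‖H10.val (dens a b)‖ ≤ ‖n‖ * (x + y) :=
    mul_le_mul_of_nonneg_left h1 (norm_nonneg _)
  have h5 : ‖n‖ * (x + y) ≤ ‖n‖ ^ 2 / 4 + 2 * (x ^ 2 + y ^ 2) := by
    nlinarith [sq_nonneg (‖n‖ / 2 - (x + y)), sq_nonneg (x - y)]
  have h6 : 4 * A ^ 3 * A' ≤ A' ^ 2 / 2 + 8 * A ^ 6 := by nlinarith [sq_nonneg (A' - 4 * A ^ 3)]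
  have h7 : 4 * B ^ 3 * B' ≤ B' ^ 2 / 2 + 8 * B ^ 6 := by nlinarith [sq_nonneg (B' - 4 * B ^ 3)]
  have h8 : A ^ 6 + B ^ 6 ≤ (A ^ 2 + B ^ 2) ^ 3 := by
    have e : (A ^ 2 + B ^ 2) ^ 3 = A ^ 6 + B ^ 6 + 3 * (A ^ 2 * B ^ 2 * (A ^ 2 + B ^ 2)) := by ring
    rw [e]
    have : 0 ≤ A ^ 2 * B ^ 2 * (A ^ 2 + B ^ 2) := by positivity
    linarith
  linarith

namespace IsSystem

variable {T : ℝ} {a b : ℝ → H10} {n p : ℝ → L2}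

/-- The energy inequality before passing to the limit in the weight. -/
theorem weighted_energy_le (h : IsSystem T a b n p) {τ : ℝ} (hτ : 0 ≤ τ) (hτT : τ < T) (k : ℕ) :
    energyU (a τ) (b τ) (n τ) + (inner ℝ (X k (n τ)) (n τ) + inner ℝ (X k (p τ)) (p τ)) / 2 ≤
      energyU (a 0) (b 0) (n 0) + (inner ℝ (X k (n 0)) (n 0) + inner ℝ (X k (p 0)) (p 0)) / 2 +
      4 * (∫ s in 0..τ, inner ℝ (dX k (n s)) (n s)) +
      (momentumBound (a τ) (b τ) (n τ) (p τ) + momentumBound (a 0) (b 0) (n 0) (p 0) -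
        ∫ s in 0..τ, inner ℝ (n s) (dX k (H10.val (dens (a s) (b s))))) / 8 -
      ∫ s in 0..τ, inner ℝ (W k (p s)) (H10.D (dens (a s) (b s))) := by
  have h' := h.mono hτT.le
  have e1 := h.energyU_increment hτ hτT
  have e2 := h'.wave_energy_increment hτ k
  have e3 := h'.wave_momentum_increment hτ k
  have e4 := h'.momentum_increment_ge hτ k
  have hn := h'.n_cont
  have hp := h'.p_cont
  have hd := ContinuousOn.dens h'.a_cont h'.b_cont
  have ii : ∀ {f : ℝ → ℝ}, ContinuousOn f (Icc 0 τ) → IntervalIntegrable f volume 0 τ :=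
    fun hf => ContinuousOn.intervalIntegrable (by rwa [uIcc_of_le hτ])
  have iN : IntervalIntegrable (fun s => inner ℝ (dX k (n s)) (n s)) volume 0 τ :=
    ii (by fun_prop)
  have iP : IntervalIntegrable (fun s => inner ℝ (dX k (p s)) (p s)) volume 0 τ :=
    ii (by fun_prop)
  have iNP : IntervalIntegrable (fun s => inner ℝ (dX k (n s)) (p s)) volume 0 τ :=
    ii (by fun_prop)
  have i1 : IntervalIntegrable (fun s => inner ℝ (p s) (H10.D (dens (a s) (b s)))) volume 0 τ :=
    ii (by fun_prop)
  have i2 : IntervalIntegrable (fun s => inner ℝ (X k (p s)) (H10.D (dens (a s) (b s))))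
    volume 0 τ := ii (by fun_prop)
  have i3 : IntervalIntegrable (fun s => inner ℝ (X k (n s)) (H10.D (dens (a s) (b s))))
    volume 0 τ := ii (by fun_prop)
  have i4 : IntervalIntegrable (fun s => inner ℝ (n s) (dX k (H10.val (dens (a s) (b s)))))
    volume 0 τ := ii (by fun_prop)
  have iNPn : IntervalIntegrable (fun s => -inner ℝ (dX k (n s)) (p s)) volume 0 τ := iNP.neg
  have iNPP : IntervalIntegrable
      (fun s => -(inner ℝ (dX k (n s)) (n s) + inner ℝ (dX k (p s)) (p s)) / 2) volume 0 τ :=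
    (iN.add iP).neg.div_const 2
  rw [intervalIntegral.integral_neg] at e1
  rw [intervalIntegral.integral_add iNPn i2, intervalIntegral.integral_neg] at e2
  rw [intervalIntegral.integral_add iNPP i3,
    intervalIntegral.integral_div, intervalIntegral.integral_neg,
    intervalIntegral.integral_add iN iP] at e3
  rw [intervalIntegral.integral_add i3 i4] at e4
  have eW : ∫ s in 0..τ, inner ℝ (W k (p s)) (H10.D (dens (a s) (b s))) =
      (∫ s in 0..τ, inner ℝ (p s) (H10.D (dens (a s) (b s)))) -
      ∫ s in 0..τ, inner ℝ (X k (p s)) (H10.D (dens (a s) (b s))) := by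
    rw [← intervalIntegral.integral_sub i1 i2]
    congr 1; ext s
    rw [← inner_sub_left, X_apply, sub_sub_cancel]
  -- This is the nonnegativity of the weighted square of 8 n + p, divided by 16.
  have eNP : -(∫ s in 0..τ, inner ℝ (dX k (n s)) (p s)) ≤
      4 * (∫ s in 0..τ, inner ℝ (dX k (n s)) (n s)) +
      (1 / 16) * ∫ s in 0..τ, inner ℝ (dX k (p s)) (p s) := by
    rw [← intervalIntegral.integral_neg, ← intervalIntegral.integral_const_mul,
      ← intervalIntegral.integral_const_mul,
      ← intervalIntegral.integral_add (iN.const_mul _) (iP.const_mul _)]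
    refine intervalIntegral.integral_mono_on hτ iNPn ((iN.const_mul _).add (iP.const_mul _))
      fun s _ => ?_
    have hs := inner_dX_self_nonneg k ((8 : ℝ) • n s + p s)
    simp only [map_add, map_smul, inner_add_left, inner_add_right, real_inner_smul_left,
      real_inner_smul_right] at hs
    rw [inner_dX k (p s) (n s), real_inner_comm (dX k (n s)) (p s)] at hs
    linarith
  have eN0 : 0 ≤ ∫ s in 0..τ, inner ℝ (dX k (n s)) (n s) :=
    intervalIntegral.integral_nonneg hτ fun s _ => inner_dX_self_nonneg k _
  have m1 := abs_momentum_add_le k (a τ) (b τ) (n τ) (p τ)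
  have m0 := abs_momentum_add_le k (a 0) (b 0) (n 0) (p 0)
  have q1 := neg_abs_le (inner ℝ (X k (n τ)) (p τ))
  have q2 := le_abs_self (inner ℝ (X k (n 0)) (p 0))
  have q3 := le_abs_self (momentum k (a τ) (b τ))
  have q4 := neg_abs_le (momentum k (a 0) (b 0))
  -- In the difference of `e3` and `e4` the couplings through `X k (n s)` cancel, which bounds half
  -- of the weighted flux of p² by the momenta at the two end times. The share 1/16 of this flux in
  -- `eNP` therefore costs 1/8 of the momentum bounds.
  linarith

/-- As k → ∞ the terms coupling the weight to u vanish by dominated convergence, and the only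
boundary contribution left is the flux of n², bounded by `Φ`. -/
theorem energy_le_of_lt (h : IsSystem T a b n p) {Φ : ℝ}
    (hΦ : ∀ η > 0, ∀ᶠ k in atTop, ∫ s in 0..T, inner ℝ (dX k (n s)) (n s) ≤ Φ + η)
    {τ : ℝ} (hτ : 0 ≤ τ) (hτT : τ < T) :
    energy (a τ) (b τ) (n τ) (p τ) ≤ energy (a 0) (b 0) (n 0) (p 0) + 4 * Φ +
      (momentumBound (a τ) (b τ) (n τ) (p τ) + momentumBound (a 0) (b 0) (n 0) (p 0)) / 8 := by
  have h' := h.mono hτT.le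
  have hn := h'.n_cont
  have hp := h'.p_cont
  have hd := ContinuousOn.dens h'.a_cont h'.b_cont
  obtain ⟨A, hA0, hA⟩ := exists_norm_bound hn
  obtain ⟨B, hB0, hB⟩ := exists_norm_bound hp
  obtain ⟨C, hC0, hC⟩ := exists_norm_bound hd
  have hDC : ∀ s ∈ Icc 0 τ, ‖H10.D (dens (a s) (b s))‖ ≤ C := fun s hs =>
    (H10.norm_D_le _).trans (hC s hs)
  have l1 : Tendsto (fun k => ∫ s in 0..τ, inner ℝ (n s) (dX k (H10.val (dens (a s) (b s)))))
      atTop (𝓝 (∫ s in 0..τ, (0 : ℝ))) := by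
    refine tendsto_integral_of_bound hτ (fun k => by fun_prop) (A * C)
      (fun k s hs => abs_inner_le (hA s hs) ?_) fun s hs => ?_
    · exact (norm_dX_val_le _ _).trans ((norm_W_le _ _).trans (hDC s hs))
    · have : Tendsto (fun k => dX k (H10.val (dens (a s) (b s)))) atTop (𝓝 0) :=
        squeeze_zero_norm (fun k => norm_dX_val_le _ _)
          (tendsto_zero_iff_norm_tendsto_zero.1 (tendsto_W _))
      simpa using (tendsto_const_nhds (x := n s)).inner this
  have l2 : Tendsto (fun k => ∫ s in 0..τ, inner ℝ (W k (p s)) (H10.D (dens (a s) (b s))))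
      atTop (𝓝 (∫ s in 0..τ, (0 : ℝ))) := by
    refine tendsto_integral_of_bound hτ (fun k => by fun_prop) (B * C)
      (fun k s hs => abs_inner_le ((norm_W_le _ _).trans (hB s hs)) (hDC s hs)) fun s hs => ?_
    simpa using (tendsto_W (p s)).inner (tendsto_const_nhds (x := H10.D (dens (a s) (b s))))
  rw [intervalIntegral.integral_zero] at l1 l2
  have lX : ∀ y : L2, Tendsto (fun k => inner ℝ (X k y) y) atTop (𝓝 (‖y‖ ^ 2)) := fun y => by
    rw [← real_inner_self_eq_norm_sq]
    exact (tendsto_X y).inner tendsto_const_nhds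
  refine le_of_forall_pos_le_add fun η hη => ?_
  have key : ∀ᶠ k in atTop, energyU (a τ) (b τ) (n τ) +
      (inner ℝ (X k (n τ)) (n τ) + inner ℝ (X k (p τ)) (p τ)) / 2 ≤
      energyU (a 0) (b 0) (n 0) + (inner ℝ (X k (n 0)) (n 0) + inner ℝ (X k (p 0)) (p 0)) / 2 +
      4 * (Φ + η / 4) +
      (momentumBound (a τ) (b τ) (n τ) (p τ) + momentumBound (a 0) (b 0) (n 0) (p 0) -
        ∫ s in 0..τ, inner ℝ (n s) (dX k (H10.val (dens (a s) (b s))))) / 8 -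
      ∫ s in 0..τ, inner ℝ (W k (p s)) (H10.D (dens (a s) (b s))) := by
    filter_upwards [hΦ (η / 4) (by positivity)] with k hk
    have h1 := h.weighted_energy_le hτ hτT k
    have h2 : ∫ s in 0..τ, inner ℝ (dX k (n s)) (n s) ≤
        ∫ s in 0..T, inner ℝ (dX k (n s)) (n s) := by
      have hnT := h.n_cont
      have hi : IntervalIntegrable (fun s => inner ℝ (dX k (n s)) (n s)) volume 0 T :=
        ContinuousOn.intervalIntegrable (by rw [uIcc_of_le (hτ.trans hτT.le)]; fun_prop)
      exact intervalIntegral.integral_mono_interval le_rfl hτ hτT.le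
        (Eventually.of_forall fun s => inner_dX_self_nonneg k _) hi
    linarith
  have lim1 := (((lX (n τ)).add (lX (p τ))).div_const 2).const_add (energyU (a τ) (b τ) (n τ))
  have lim2 := ((((((lX (n 0)).add (lX (p 0))).div_const 2).const_add
    (energyU (a 0) (b 0) (n 0))).add_const (4 * (Φ + η / 4))).add
    ((l1.const_sub (momentumBound (a τ) (b τ) (n τ) (p τ) +
      momentumBound (a 0) (b 0) (n 0) (p 0))).div_const 8)).sub l2
  have := le_of_tendsto_of_tendsto lim1 lim2 key
  unfold energy
  linarith

theorem energy_le (h : IsSystem T a b n p) {Φ : ℝ}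
    (hΦ : ∀ η > 0, ∀ᶠ k in atTop, ∫ s in 0..T, inner ℝ (dX k (n s)) (n s) ≤ Φ + η)
    (hT : 0 < T) {t : ℝ} (ht : t ∈ Icc 0 T) :
    energy (a t) (b t) (n t) (p t) ≤ energy (a 0) (b 0) (n 0) (p 0) + 4 * Φ +
      (momentumBound (a t) (b t) (n t) (p t) + momentumBound (a 0) (b 0) (n 0) (p 0)) / 8 := by
  have ha := h.a_cont
  have hb := h.b_cont
  have hn := h.n_cont
  have hp := h.p_cont
  have hd := ContinuousOn.dens ha hb
  have c1 : ContinuousOn (fun t => energy (a t) (b t) (n t) (p t)) (Icc 0 T) := by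
    unfold energy energyU
    fun_prop
  have c2 : ContinuousOn (fun t => energy (a 0) (b 0) (n 0) (p 0) + 4 * Φ +
      (momentumBound (a t) (b t) (n t) (p t) + momentumBound (a 0) (b 0) (n 0) (p 0)) / 8)
      (Icc 0 T) := by
    unfold momentumBound
    fun_prop
  -- The end time T, excluded by the forward shift, is recovered by continuity.
  have hcl : Icc 0 T = closure (Ico 0 T) := (closure_Ico hT.ne).symm
  rw [hcl] at c1 c2 ht
  exact ContinuousWithinAt.closure_le ht ((c1 t ht).mono subset_closure)
    ((c2 t ht).mono subset_closure) fun s hs => h.energy_le_of_lt hΦ hs.1 hs.2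

/-- The energy dominates ‖u_x‖²/2 + ‖n‖²/4 + ‖p‖²/2 up to the cube of the mass, while the momentum
term takes at most 1/16 of each square. A share of at least 3/16 of ‖u_x‖², ‖n‖² and ‖p‖² remains on
the left. -/
theorem norm_sq_bound (h : IsSystem T a b n p) {Φ : ℝ}
    (hΦ : ∀ η > 0, ∀ᶠ k in atTop, ∫ s in 0..T, inner ℝ (dX k (n s)) (n s) ≤ Φ + η)
    (hT : 0 < T) {t : ℝ} (ht : t ∈ Icc 0 T) :
    (‖H10.val (a t)‖ ^ 2 + ‖H10.val (b t)‖ ^ 2 + (‖H10.D (a t)‖ ^ 2 + ‖H10.D (b t)‖ ^ 2)) +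
      ‖n t‖ ^ 2 + ‖p t‖ ^ 2 ≤
      20 * ((‖H10.val (a 0)‖ ^ 2 + ‖H10.val (b 0)‖ ^ 2 +
        (‖H10.D (a 0)‖ ^ 2 + ‖H10.D (b 0)‖ ^ 2)) + ‖n 0‖ ^ 2 + ‖p 0‖ ^ 2) +
      100 * (‖H10.val (a 0)‖ ^ 2 + ‖H10.val (b 0)‖ ^ 2 +
        (‖H10.D (a 0)‖ ^ 2 + ‖H10.D (b 0)‖ ^ 2)) ^ 3 + 24 * Φ := by
  have hm := (h.mono ht.2).mass_conservation ht.1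
  have he := h.energy_le hΦ hT ht
  have f1 := abs_le.1 (abs_inner_dens_le (a t) (b t) (n t))
  have f0 := abs_le.1 (abs_inner_dens_le (a 0) (b 0) (n 0))
  have q : ∀ (a b : H10) (n p : L2), momentumBound a b n p ≤ (‖n‖ ^ 2 + ‖p‖ ^ 2) / 2 +
      (‖H10.val a‖ ^ 2 + ‖H10.val b‖ ^ 2 + (‖H10.D a‖ ^ 2 + ‖H10.D b‖ ^ 2)) / 2 := by
    intro a b n p
    unfold momentumBound
    nlinarith [sq_nonneg (‖n‖ - ‖p‖), sq_nonneg (‖H10.val a‖ - ‖H10.D b‖),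
      sq_nonneg (‖H10.val b‖ - ‖H10.D a‖)]
  have q1 := q (a t) (b t) (n t) (p t)
  have q0 := q (a 0) (b 0) (n 0) (p 0)
  rw [hm] at f1 q1 ⊢
  unfold energy energyU at he
  have hcube : (‖H10.val (a 0)‖ ^ 2 + ‖H10.val (b 0)‖ ^ 2) ^ 3 ≤ (‖H10.val (a 0)‖ ^ 2 +
      ‖H10.val (b 0)‖ ^ 2 + (‖H10.D (a 0)‖ ^ 2 + ‖H10.D (b 0)‖ ^ 2)) ^ 3 :=
    pow_le_pow_left₀ (by positivity) (le_add_of_nonneg_right (by positivity)) 3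
  have p1 := sq_nonneg ‖H10.val (a 0)‖
  have p2 := sq_nonneg ‖H10.val (b 0)‖
  have p3 := sq_nonneg ‖H10.D (a 0)‖
  have p4 := sq_nonneg ‖H10.D (b 0)‖
  have p5 := sq_nonneg ‖n 0‖
  have p6 := sq_nonneg ‖p 0‖
  have p7 := sq_nonneg ‖n t‖
  have p8 := sq_nonneg ‖p t‖
  have p9 := sq_nonneg ‖H10.D (a t)‖
  have p10 := sq_nonneg ‖H10.D (b t)‖
  linarith

end IsSystem

/-! ### Norms and continuity in terms of L² and H¹₀ -/

section Norms

theorem l2Norm_sq {E : Type*} [NormedAddCommGroup E] {w : ℝ → E} (hw : MemLp w 2 hlMeasure) :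
    l2Norm w ^ 2 = ∫ x in Ioi 0, ‖w x‖ ^ 2 := by
  unfold l2Norm
  rw [hw.eLpNorm_eq_integral_rpow_norm two_ne_zero ENNReal.ofNat_ne_top]
  have h0 : 0 ≤ ∫ x in Ioi 0, ‖w x‖ ^ 2 := integral_nonneg fun x => sq_nonneg _
  simp only [ENNReal.toReal_ofNat, Real.rpow_two]
  rw [ENNReal.toReal_ofReal (by positivity), ← Real.rpow_two, ← Real.rpow_mul h0]
  norm_num

theorem l2Norm_coeFn (y : L2) : l2Norm y = ‖y‖ := (Lp.norm_def y).symm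

theorem l2Norm_congr {E : Type*} [NormedAddCommGroup E] {w z : ℝ → E} (h : w =ᵐ[hlMeasure] z) :
    l2Norm w = l2Norm z := by
  unfold l2Norm; rw [eLpNorm_congr_ae h]

/-- The complex valued function `w` has real part `y` and imaginary part `z`. -/
def HasParts (w : ℝ → ℂ) (y z : L2) : Prop :=
  w =ᵐ[hlMeasure] fun x => (y x : ℂ) + (z x : ℂ) * Complex.I

theorem exists_hasParts {w : ℝ → ℂ} (hw : MemL2 w) : ∃ y z, HasParts w y z := by
  have h1 : MemLp (fun x => (w x).re) 2 hlMeasure := hw.re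
  have h2 : MemLp (fun x => (w x).im) 2 hlMeasure := hw.im
  refine ⟨h1.toLp _, h2.toLp _, ?_⟩
  filter_upwards [h1.coeFn_toLp, h2.coeFn_toLp] with x e1 e2
  rw [e1, e2, Complex.re_add_im]

namespace HasParts

variable {w w' : ℝ → ℂ} {y z y' z' : L2}

theorem sub (h : HasParts w y z) (h' : HasParts w' y' z') :
    HasParts (w - w') (y - y') (z - z') := by
  unfold HasParts at *
  filter_upwards [h, h', Lp.coeFn_sub y y', Lp.coeFn_sub z z'] with x h1 h2 h3 h4
  rw [Pi.sub_apply, h1, h2, h3, h4, Pi.sub_apply, Pi.sub_apply]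
  push_cast; ring

theorem memL2 (h : HasParts w y z) : MemL2 w := by
  have h1 : MemLp (fun x => (y x : ℂ)) 2 hlMeasure := (Lp.memLp y).ofReal
  have h2 : MemLp (fun x => (z x : ℂ) * Complex.I) 2 hlMeasure := (Lp.memLp z).ofReal.mul_const _
  exact (memLp_congr_ae h).2 (h1.add h2)

theorem l2Norm_sq (h : HasParts w y z) : l2Norm w ^ 2 = ‖y‖ ^ 2 + ‖z‖ ^ 2 := by
  rw [Zakharov.l2Norm_sq h.memL2, L2.norm_sq, L2.norm_sq,
    ← integral_add (Lp.memLp y).integrable_sq (Lp.memLp z).integrable_sq]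
  refine integral_congr_ae ?_
  filter_upwards [h] with x hx
  rw [hx, Complex.sq_norm, Complex.normSq_add_mul_I]

theorem integral_smul (h : HasParts w y z) (φ : 𝓓(halfLine, ℝ)) :
    ∫ x in Ioi 0, φ x • w x = (inner ℝ y (testL2 φ) : ℂ) + (inner ℝ z (testL2 φ) : ℂ) * Complex.I := by
  rw [inner_testL2, inner_testL2]
  have e : ∀ᵐ x ∂hlMeasure, φ x • w x =
      ((y x * φ x : ℝ) : ℂ) + ((z x * φ x : ℝ) : ℂ) * Complex.I := by
    filter_upwards [h] with x hx
    rw [hx, Complex.real_smul]; push_cast; ring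
  have i : ∀ y : L2, Integrable (fun x => ((y x * φ x : ℝ) : ℂ)) hlMeasure := fun y =>
    ((Lp.memLp y).integrable_mul (test_memL2 φ)).ofReal
  rw [integral_congr_ae e, integral_add (i y) ((i z).mul_const _), integral_mul_const,
    integral_complex_ofReal, integral_complex_ofReal]

theorem hasWeakDeriv_iff (h : HasParts w y z) (h' : HasParts w' y' z') : HasWeakDeriv w w' ↔
    ∀ φ : 𝓓(halfLine, ℝ), inner ℝ y (testL2 (derivTest φ)) = -inner ℝ y' (testL2 φ) ∧
      inner ℝ z (testL2 (derivTest φ)) = -inner ℝ z' (testL2 φ) := by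
  refine forall_congr' fun φ => ?_
  have e1 := h.integral_smul (derivTest φ)
  rw [coe_derivTest] at e1
  rw [e1, h'.integral_smul φ, Complex.ext_iff]
  simp

end HasParts

/-- Such a `y` is constant, and a square integrable constant on a set of infinite measure is zero.
This is the uniqueness of primitives behind `hatHm1Norm`. -/
theorem L2.eq_zero_of_inner_derivTest {y : L2}
    (h : ∀ φ : 𝓓(halfLine, ℝ), inner ℝ y (testL2 (derivTest φ)) = 0) : y = 0 := by
  obtain ⟨c, hc⟩ := exists_hasPrim (z := y) (z' := 0) fun φ => by
    rw [D_testH, h φ, inner_zero_left, neg_zero]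
  have h0 : IsPrim c (fun x => c + ∫ t in 0..x, (0 : L2) t) (fun _ => 0) :=
    (L2.isPrim c 0).congr_deriv (Lp.coeFn_zero _ _ _)
  have hy : y =ᵐ[hlMeasure] fun _ => c := by
    filter_upwards [hc, ae_restrict_mem measurableSet_Ioi] with x hx hx0
    have := h0.eq x (le_of_lt hx0)
    rw [hx, this]; simp
  have hm := (memLp_congr_ae hy).1 (Lp.memLp y)
  rw [memLp_const_iff two_ne_zero ENNReal.ofNat_ne_top] at hm
  have hc0 : c = 0 := by
    rcases hm with h | h
    · exact h
    · simp at h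
  rw [hc0] at hy
  exact Lp.ext (hy.trans (Lp.coeFn_zero _ _ _).symm)

theorem L2.eq_zero_of_inner_test {y : L2}
    (h : ∀ φ : 𝓓(halfLine, ℝ), inner ℝ y (testL2 φ) = 0) : y = 0 :=
  L2.eq_zero_of_inner_derivTest fun _ => h _

/-- The complex valued function `w` has real part `a` and imaginary part `b`, both in `H¹₀`. -/
def Represents (w : ℝ → ℂ) (a b : H10) : Prop := HasParts w (H10.val a) (H10.val b)

theorem Represents.sub {w w' : ℝ → ℂ} {a b a' b' : H10} (h : Represents w a b)
    (h' : Represents w' a' b') : Represents (w - w') (a - a') (b - b') := by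
  unfold Represents at *
  rw [map_sub, map_sub]
  exact HasParts.sub h h'

theorem Represents.h1Norm_sq {w : ℝ → ℂ} {a b : H10} (h : Represents w a b) :
    h1Norm w ^ 2 = ‖H10.val a‖ ^ 2 + ‖H10.val b‖ ^ 2 + (‖H10.D a‖ ^ 2 + ‖H10.D b‖ ^ 2) := by
  have hw : HasParts w (H10.val a) (H10.val b) := h
  have hset : {r | ∃ w' : ℝ → ℂ, MemL2 w' ∧ HasWeakDeriv w w' ∧
      r = √(l2Norm w ^ 2 + l2Norm w' ^ 2)} =
      {√(‖H10.val a‖ ^ 2 + ‖H10.val b‖ ^ 2 + (‖H10.D a‖ ^ 2 + ‖H10.D b‖ ^ 2))} := by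
    ext r
    constructor
    · rintro ⟨w', hw', hd, rfl⟩
      obtain ⟨y, z, hp⟩ := exists_hasParts hw'
      have hd' := (hw.hasWeakDeriv_iff hp).1 hd
      have hy : y - H10.D a = 0 := L2.eq_zero_of_inner_test fun φ => by
        have h1 := (hd' φ).1
        have h2 := a.hasPrim.inner_D (testH φ)
        rw [D_testH, val_testH] at h2
        rw [inner_sub_left]; linarith
      have hz : z - H10.D b = 0 := L2.eq_zero_of_inner_test fun φ => by
        have h1 := (hd' φ).2
        have h2 := b.hasPrim.inner_D (testH φ)
        rw [D_testH, val_testH] at h2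
        rw [inner_sub_left]; linarith
      rw [mem_singleton_iff, hw.l2Norm_sq, hp.l2Norm_sq, sub_eq_zero.1 hy, sub_eq_zero.1 hz]
    · rintro rfl
      have hp : HasParts (fun x => (H10.D a x : ℂ) + (H10.D b x : ℂ) * Complex.I)
        (H10.D a) (H10.D b) := EventuallyEq.rfl
      refine ⟨_, hp.memL2, (hw.hasWeakDeriv_iff hp).2 fun φ =>
        ⟨a.hasPrim.inner_D (testH φ), b.hasPrim.inner_D (testH φ)⟩, ?_⟩
      rw [hw.l2Norm_sq, hp.l2Norm_sq]
  unfold h1Norm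
  rw [hset, csInf_singleton, Real.sq_sqrt (by positivity)]

theorem h1Norm_nonneg {E : Type*} [NormedAddCommGroup E] [NormedSpace ℝ E] (w : ℝ → E) :
    0 ≤ h1Norm w :=
  Real.sInf_nonneg fun _ ⟨_, _, _, hr⟩ => hr ▸ Real.sqrt_nonneg _

/-- The continuous function `f` agrees everywhere on [0, ∞) with the primitive, so the constant is
`f 0 = 0`. -/
theorem mem_h10_of_continuousOn {f : ℝ → ℝ} (hf : ContinuousOn f (Ici 0)) (h0 : f 0 = 0)
    {z z' : L2} (hz : z =ᵐ[hlMeasure] f)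
    (h : ∀ φ : 𝓓(halfLine, ℝ), inner ℝ z (testL2 (derivTest φ)) = -inner ℝ z' (testL2 φ)) :
    (z, z') ∈ h10 := by
  obtain ⟨c, hc⟩ := exists_hasPrim (z := z) (z' := z') h
  have hE : EqOn f (fun x => c + ∫ y in 0..x, z' y) (Ici 0) := by
    refine Measure.eqOn_of_ae_eq (μ := volume) ?_ hf (L2.isPrim c z').continuousOn ?_
    · rw [← restrict_Ioi_eq_restrict_Ici]
      exact hz.symm.trans hc
    · rw [interior_Ici, closure_Ioi]
  have hc0 : c = 0 := by
    have := hE (self_mem_Ici (a := (0 : ℝ)))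
    simpa [h0] using this.symm
  rw [hc0] at hc
  exact (mem_h10_iff _ _).2 hc

theorem exists_represents {w : ℝ → ℂ} (hw : MemH1 w) (hc : ContinuousOn w (Ici 0)) (h0 : w 0 = 0) :
    ∃ q : H10 × H10, Represents w q.1 q.2 := by
  obtain ⟨hw, w', hw', hd⟩ := hw
  obtain ⟨y, z, hp⟩ := exists_hasParts hw
  obtain ⟨y', z', hp'⟩ := exists_hasParts hw'
  have hd' := (hp.hasWeakDeriv_iff hp').1 hd
  have m1 : (y, y') ∈ h10 := mem_h10_of_continuousOn (f := fun x => (w x).re)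
    (Complex.continuous_re.comp_continuousOn hc) (by simp [h0])
    (by unfold HasParts at hp; filter_upwards [hp] with x hx; rw [hx]; simp) fun φ => (hd' φ).1
  have m2 : (z, z') ∈ h10 := mem_h10_of_continuousOn (f := fun x => (w x).im)
    (Complex.continuous_im.comp_continuousOn hc) (by simp [h0])
    (by unfold HasParts at hp; filter_upwards [hp] with x hx; rw [hx]; simp) fun φ => (hd' φ).2
  exact ⟨(H10.mk _ _ m1, H10.mk _ _ m2), hp⟩

theorem Represents.continuousOn {I : Set ℝ} {u : ℝ → ℝ → ℂ} {q : ℝ → H10 × H10}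
    (hu : ContinuousInNorm h1Norm I u) (h : ∀ t ∈ I, Represents (u t) (q t).1 (q t).2) :
    ContinuousOn q I := by
  intro t₀ ht₀
  rw [ContinuousWithinAt, tendsto_iff_norm_sub_tendsto_zero]
  refine squeeze_zero' (Eventually.of_forall fun _ => norm_nonneg _) ?_ (hu t₀ ht₀)
  filter_upwards [self_mem_nhdsWithin] with t ht
  have e := ((h t ht).sub (h t₀ ht₀)).h1Norm_sq
  have k : ∀ {x : ℝ}, x ^ 2 ≤ h1Norm (u t - u t₀) ^ 2 → x ≤ h1Norm (u t - u t₀) := fun hx =>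
    (abs_le_of_sq_le_sq' hx (h1Norm_nonneg _)).2
  have p1 := sq_nonneg ‖H10.val ((q t).1 - (q t₀).1)‖
  have p2 := sq_nonneg ‖H10.val ((q t).2 - (q t₀).2)‖
  have p3 := sq_nonneg ‖H10.D ((q t).1 - (q t₀).1)‖
  have p4 := sq_nonneg ‖H10.D ((q t).2 - (q t₀).2)‖
  refine max_le (H10.norm_le_of (k ?_) (k ?_)) (H10.norm_le_of (k ?_) (k ?_)) <;>
  · rw [e]
    simp only [Prod.fst_sub, Prod.snd_sub]
    linarith

/-- The distribution `S` is the derivative of `y ∈ L²`. -/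
def HasPrimitive (S : 𝓓'(halfLine, ℝ)) (y : L2) : Prop :=
  ∀ φ : 𝓓(halfLine, ℝ), S φ = -inner ℝ y (testL2 (derivTest φ))

theorem IsL2Primitive.hasPrimitive {p : ℝ → ℝ} {S : 𝓓'(halfLine, ℝ)} (h : IsL2Primitive p S) :
    HasPrimitive S (MemLp.toLp p h.1) := by
  intro φ
  rw [h.2 φ, inner_testL2]
  congr 1
  refine integral_congr_ae ?_
  filter_upwards [MemLp.coeFn_toLp h.1] with x hx
  rw [hx, coe_derivTest]

theorem HasPrimitive.sub {S S' : 𝓓'(halfLine, ℝ)} {y y' : L2} (h : HasPrimitive S y)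
    (h' : HasPrimitive S' y') : HasPrimitive (S - S') (y - y') := by
  intro φ
  have : (S - S') φ = S φ - S' φ := rfl
  rw [this, h φ, h' φ, inner_sub_left]; ring

theorem HasPrimitive.norm_eq {S : 𝓓'(halfLine, ℝ)} {y : L2} (h : HasPrimitive S y) :
    hatHm1Norm S = ‖y‖ := by
  have hset : {r | ∃ p : ℝ → ℝ, IsL2Primitive p S ∧ r = l2Norm p} = {‖y‖} := by
    ext r
    constructor
    · rintro ⟨p, hp, rfl⟩
      have hz : MemLp.toLp p hp.1 - y = 0 := L2.eq_zero_of_inner_derivTest fun φ => by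
        have h1 := hp.hasPrimitive φ
        rw [h φ] at h1
        rw [inner_sub_left]; linarith
      rw [mem_singleton_iff, ← sub_eq_zero.1 hz]
      exact (Lp.norm_toLp p hp.1).symm
    · rintro rfl
      exact ⟨y, ⟨Lp.memLp y, fun φ => by rw [h φ, inner_testL2, coe_derivTest]⟩,
        (l2Norm_coeFn y).symm⟩
  unfold hatHm1Norm
  rw [hset, csInf_singleton]

theorem HasPrimitive.continuousOn {I : Set ℝ} {S : ℝ → 𝓓'(halfLine, ℝ)} {p : ℝ → L2}
    (hS : ContinuousInNorm hatHm1Norm I S) (h : ∀ t ∈ I, HasPrimitive (S t) (p t)) :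
    ContinuousOn p I := by
  intro t₀ ht₀
  rw [ContinuousWithinAt, tendsto_iff_norm_sub_tendsto_zero]
  refine (hS t₀ ht₀).congr' ?_
  filter_upwards [self_mem_nhdsWithin] with t ht
  exact ((h t ht).sub (h t₀ ht₀)).norm_eq

theorem continuousOn_of_continuousInNorm {I : Set ℝ} {n : ℝ → ℝ → ℝ} {N : ℝ → L2}
    (hn : ContinuousInNorm l2Norm I n) (h : ∀ t ∈ I, N t =ᵐ[hlMeasure] n t) :
    ContinuousOn N I := by
  intro t₀ ht₀
  rw [ContinuousWithinAt, tendsto_iff_norm_sub_tendsto_zero]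
  refine (hn t₀ ht₀).congr' ?_
  filter_upwards [self_mem_nhdsWithin] with t ht
  rw [← l2Norm_coeFn]
  refine l2Norm_congr ?_
  filter_upwards [h t ht, h t₀ ht₀, Lp.coeFn_sub (N t) (N t₀)] with x h1 h2 h3
  rw [h3, Pi.sub_apply, Pi.sub_apply, h1, h2]

end Norms

/-! ### From distributional solutions to the weak system -/

section Translation

/-- A curve in the dual of `H¹₀` is differentiable if it is so when tested against the elements of a
separating set. -/
theorem hasDerivWithinAt_of_pair {T : ℝ} (hT : 0 < T) {x Y : ℝ → Dual10}
    (hY : ContinuousOn Y (Icc 0 T)) {S : Set H10}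
    (hS : ∀ ℓ : Dual10, (∀ v ∈ S, pair ℓ v = 0) → ℓ = 0)
    (h : ∀ v ∈ S, ∀ t ∈ Icc 0 T,
      HasDerivWithinAt (fun s => pair (x s) v) (pair (Y t) v) (Icc 0 T) t) :
    ∀ t ∈ Icc 0 T, HasDerivWithinAt x (Y t) (Icc 0 T) t := by
  set Z : ℝ → Dual10 := IccExtend hT.le ((Icc 0 T).domRestrict Y) with hZ
  have hZc : Continuous Z := (continuousOn_iff_continuous_domRestrict.1 hY).Icc_extend'
  have hZY : ∀ t ∈ Icc 0 T, Z t = Y t := fun t ht => by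
    rw [hZ, IccExtend_of_mem _ _ ht]; rfl
  -- The integrated equation holds in the dual, as it can be checked on the separating set;
  -- continuity of `Y` then gives differentiability in norm.
  have key : ∀ t ∈ Icc 0 T, x t = x 0 + ∫ s in 0..t, Z s := by
    intro t ht
    refine sub_eq_zero.1 (hS _ fun v hv => ?_)
    have h1 := sub_eq_integral_of_hasDerivWithinAt ht.1 (f := fun s => pair (x s) v)
      (g := fun s => pair (Z s) v) (fun s hs => ?_) (by fun_prop)
    · have h2 := (pair.flip v).intervalIntegral_comp_comm (hZc.intervalIntegrable 0 t (μ := volume))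
      simp only [ContinuousLinearMap.flip_apply] at h2
      rw [pair_sub, pair_add, ← h2, ← h1]
      ring
    · have hs' : s ∈ Icc 0 T := ⟨hs.1, hs.2.trans ht.2⟩
      rw [hZY s hs']
      exact (h v hv s hs').mono (Icc_subset_Icc_right ht.2)
  intro t ht
  have hd : HasDerivAt (fun t => x 0 + ∫ s in 0..t, Z s) (Z t) t :=
    (intervalIntegral.integral_hasDerivAt_right (hZc.intervalIntegrable _ _)
      (hZc.stronglyMeasurableAtFilter _ _) hZc.continuousAt).const_add _
  rw [hZY t ht] at hd
  exact hd.hasDerivWithinAt.congr key (key t ht)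

theorem dual_eq_zero_of_range_test (ℓ : Dual10) (h : ∀ v ∈ range testH, pair ℓ v = 0) : ℓ = 0 :=
  dual_eq_zero_of_test (ℓ := (show H10 →L[ℝ] ℝ from ℓ)) fun φ => h _ ⟨φ, rfl⟩

theorem dual_eq_zero_of_range_derivTest (ℓ : Dual10)
    (h : ∀ v ∈ range fun φ => testH (derivTest φ), pair ℓ v = 0) : ℓ = 0 :=
  dual_eq_zero_of_derivTest (ℓ := (show H10 →L[ℝ] ℝ from ℓ)) fun φ => h _ ⟨φ, rfl⟩

theorem Represents.mul {w : ℝ → ℂ} {n : ℝ → ℝ} {a b : H10} {N : L2} (h : Represents w a b)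
    (hN : N =ᵐ[hlMeasure] n) : HasParts (fun x => (n x : ℂ) * w x) (mulV a N) (mulV b N) := by
  unfold Represents HasParts at *
  filter_upwards [h, hN, coeFn_mulV a N, coeFn_mulV b N] with x h1 h2 h3 h4
  rw [h1, h3, h4, h2]; push_cast; ring

theorem Represents.norm_sq {w : ℝ → ℂ} {a b : H10} (h : Represents w a b) :
    H10.val (dens a b) =ᵐ[hlMeasure] fun x => ‖w x‖ ^ 2 := by
  rw [val_dens]
  unfold Represents HasParts at h
  filter_upwards [h, coeFn_mulV a (H10.val a), coeFn_mulV b (H10.val b),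
    Lp.coeFn_add (mulV a (H10.val a)) (mulV b (H10.val b))] with x h1 h2 h3 h4
  rw [h4, Pi.add_apply, h1, h2, h3, Complex.sq_norm, Complex.normSq_add_mul_I]
  ring

theorem inner_testL2_of_ae {y : L2} {w : ℝ → ℝ} (h : y =ᵐ[hlMeasure] w) (φ : 𝓓(halfLine, ℝ)) :
    ∫ x in Ioi 0, w x * φ x = inner ℝ y (testL2 φ) := by
  rw [inner_testL2]
  refine integral_congr_ae ?_
  filter_upwards [h] with x hx
  rw [hx]

theorem H10.inner_val_testL2_deriv (v : H10) (φ : 𝓓(halfLine, ℝ)) :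
    inner ℝ (H10.val v) (testL2 (derivTest (derivTest φ))) =
      -inner ℝ (H10.D v) (testL2 (derivTest φ)) :=
  v.hasPrim.inner_D (testH (derivTest φ))

theorem Represents.schrodinger_rhs {w : ℝ → ℂ} {n : ℝ → ℝ} {a b : H10} {N : L2}
    (h : Represents w a b) (hN : N =ᵐ[hlMeasure] n) (φ : 𝓓(halfLine, ℝ)) :
    (∫ x in Ioi 0, (n x : ℂ) * w x * (φ x : ℂ)) -
        ∫ x in Ioi 0, w x * ((deriv (deriv φ) x : ℝ) : ℂ) =
      (pair (J (mulV a N) + JD (H10.D a)) (testH φ) : ℂ) +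
        (pair (J (mulV b N) + JD (H10.D b)) (testH φ) : ℂ) * Complex.I := by
  have e1 := (h.mul hN).integral_smul φ
  have e2 := HasParts.integral_smul h (derivTest (derivTest φ))
  rw [a.inner_val_testL2_deriv, b.inner_val_testL2_deriv, coe_derivTest, coe_derivTest] at e2
  simp only [Complex.real_smul, mul_comm (Complex.ofReal (φ _)),
    mul_comm (Complex.ofReal (deriv (deriv _) _))] at e1 e2
  rw [e1, e2]
  simp only [pair_add, J_apply, JD_apply, val_testH, D_testH]
  push_cast
  ring

theorem Represents.schrodinger_lhs {w : ℝ → ℂ} {a b : H10} (h : Represents w a b)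
    (φ : 𝓓(halfLine, ℝ)) : Complex.I * ∫ x in Ioi 0, w x * (φ x : ℂ) =
      ((-pair (J (H10.val b)) (testH φ) : ℝ) : ℂ) +
        (pair (J (H10.val a)) (testH φ) : ℂ) * Complex.I := by
  have e1 := HasParts.integral_smul h φ
  simp only [Complex.real_smul, mul_comm (Complex.ofReal (φ _))] at e1
  rw [e1]
  simp only [J_apply, val_testH]
  push_cast
  linear_combination (inner ℝ (H10.val b) (testL2 φ) : ℂ) * Complex.I_mul_I

theorem hasDerivWithinAt_parts {f g : ℝ → ℝ} {f' g' : ℝ} {I : Set ℝ} {t : ℝ}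
    (h : HasDerivWithinAt (fun s => (f s : ℂ) + (g s : ℂ) * Complex.I)
      ((f' : ℂ) + (g' : ℂ) * Complex.I) I t) :
    HasDerivWithinAt f f' I t ∧ HasDerivWithinAt g g' I t := by
  have h1 := (Complex.reCLM.hasFDerivAt (x := (f t : ℂ) + (g t : ℂ) * Complex.I)).comp_hasDerivWithinAt t h
  have h2 := (Complex.imCLM.hasFDerivAt (x := (f t : ℂ) + (g t : ℂ) * Complex.I)).comp_hasDerivWithinAt t h
  constructor
  · simpa [Function.comp_def] using h1
  · simpa [Function.comp_def] using h2

theorem IsEnergySolution.isSystem {g : ℝ → ℂ} {n₀ : ℝ → ℝ} {n₁ : 𝓓'(halfLine, ℝ)} {h : ℝ → ℂ}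
    {f : ℝ → ℝ} {T : ℝ} {u : ℝ → ℝ → ℂ} {n : ℝ → ℝ → ℝ} {nt : ℝ → 𝓓'(halfLine, ℝ)} (hT : 0 < T)
    (hs : IsEnergySolution g n₀ n₁ h f T u n nt) {q : ℝ → H10 × H10} {N P : ℝ → L2}
    (hq : ∀ t ∈ Icc 0 T, Represents (u t) (q t).1 (q t).2)
    (hN : ∀ t ∈ Icc 0 T, N t =ᵐ[hlMeasure] n t) (hP : ∀ t ∈ Icc 0 T, HasPrimitive (nt t) (P t)) :
    IsSystem T (fun t => (q t).1) (fun t => (q t).2) N P := by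
  have cq := Represents.continuousOn hs.u_cont hq
  have ca : ContinuousOn (fun t => (q t).1) (Icc 0 T) := cq.fst
  have cb : ContinuousOn (fun t => (q t).2) (Icc 0 T) := cq.snd
  have cN := continuousOn_of_continuousInNorm hs.n_cont hN
  have cP := HasPrimitive.continuousOn hs.nt_cont hP
  have cd := ContinuousOn.dens ca cb
  have hsch : ∀ φ : 𝓓(halfLine, ℝ), ∀ t ∈ Icc 0 T, _ := fun φ t ht =>
    hasDerivWithinAt_parts (((hs.schrodinger t ht φ).congr
      (fun s hs' => ((hq s hs').schrodinger_lhs φ).symm)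
      ((hq t ht).schrodinger_lhs φ).symm).congr_deriv ((hq t ht).schrodinger_rhs (hN t ht) φ))
  refine ⟨ca, cb, cN, cP, ?_, ?_, ?_, ?_⟩
  · refine hasDerivWithinAt_of_pair hT (by fun_prop) dual_eq_zero_of_range_test ?_
    rintro _ ⟨φ, rfl⟩ t ht
    exact (hsch φ t ht).2
  · refine hasDerivWithinAt_of_pair hT (by fun_prop) dual_eq_zero_of_range_test ?_
    rintro _ ⟨φ, rfl⟩ t ht
    have := (hsch φ t ht).1.fun_neg
    simp only [neg_neg] at this
    exact this
  · refine hasDerivWithinAt_of_pair hT (by fun_prop) dual_eq_zero_of_range_test ?_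
    rintro _ ⟨φ, rfl⟩ t ht
    exact ((hs.nt_eq t ht φ).congr (fun s hs' => (inner_testL2_of_ae (hN s hs') φ).symm)
      (inner_testL2_of_ae (hN t ht) φ).symm).congr_deriv (hP t ht φ)
  -- The distribution n_t determines p only through its pairings with derivatives φ', so the density
  -- of these in H¹₀ is needed.
  · refine hasDerivWithinAt_of_pair hT (by fun_prop) dual_eq_zero_of_range_derivTest ?_
    rintro _ ⟨φ, rfl⟩ t ht
    have e := fun s hs' => neg_eq_iff_eq_neg.2 (hP s hs' φ)
    refine ((hs.wave t ht φ).fun_neg.congr (fun s hs' => (e s hs').symm) (e t ht).symm).congr_deriv ?_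
    have e1 := inner_testL2_of_ae (hN t ht) (derivTest (derivTest φ))
    have e2 := inner_testL2_of_ae (hq t ht).norm_sq (derivTest (derivTest φ))
    rw [coe_derivTest, coe_derivTest] at e1 e2
    rw [e1, e2, pair_neg, JD_apply, D_testH, inner_add_left]

end Translation

/-! ### The boundary flux of n -/

section Trace

theorem integral_rate_exp (k : ℕ) : ∫ x in Ioi 0, rate k * Real.exp (-(rate k * x)) = 1 := by
  have := integral_exp_mul_Ioi (neg_lt_zero.2 (rate_pos k)) 0
  simp only [neg_mul, mul_zero, Real.exp_zero] at this
  rw [integral_const_mul, this]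
  have := (rate_pos k).ne'
  field_simp

theorem integrable_rate_exp (k : ℕ) :
    Integrable (fun x => rate k * Real.exp (-(rate k * x))) hlMeasure := by
  have := (integrableOn_exp_mul_Ioi (neg_lt_zero.2 (rate_pos k)) 0).const_mul (rate k)
  simpa only [neg_mul] using this

theorem tendsto_rate_exp {δ : ℝ} (hδ : 0 < δ) :
    Tendsto (fun k => rate k * Real.exp (-(rate k * δ))) atTop (𝓝 0) := by
  have h := (Real.tendsto_pow_mul_exp_neg_atTop_nhds_zero 1).comp
    (tendsto_rate.atTop_mul_const hδ)
  have h2 := h.div_const δ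
  rw [zero_div] at h2
  refine h2.congr fun k => ?_
  simp only [Function.comp_apply, pow_one]
  field_simp

/-- The weights `rate k * exp (- rate k * x)` concentrate at `0`. -/
theorem eventually_integral_weight_le {m : ℝ → ℝ} (hm : Integrable m hlMeasure)
    (hm0 : ∀ x, 0 ≤ m x) {Φ : ℝ} (hlim : ∀ η > 0, ∃ δ > 0, ∀ x ∈ Ioo 0 δ, m x ≤ Φ + η)
    {η : ℝ} (hη : 0 < η) :
    ∀ᶠ k in atTop, ∫ x in Ioi 0, rate k * Real.exp (-(rate k * x)) * m x ≤ Φ + η := by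
  obtain ⟨δ, hδ, hd⟩ := hlim (η / 2) (by positivity)
  have hΦ : 0 ≤ Φ + η / 2 := (hm0 (δ / 2)).trans (hd _ ⟨by positivity, by linarith⟩)
  have ht := (tendsto_rate_exp hδ).mul_const (∫ x in Ioi 0, m x)
  rw [zero_mul] at ht
  filter_upwards [ht.eventually_le_const (show 0 < η / 2 by positivity)] with k hk
  have hi : Integrable (fun x => (Φ + η / 2) * (rate k * Real.exp (-(rate k * x))) +
      rate k * Real.exp (-(rate k * δ)) * m x) hlMeasure :=
    ((integrable_rate_exp k).const_mul _).add (hm.const_mul _)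
  have h1 : ∫ x in Ioi 0, rate k * Real.exp (-(rate k * x)) * m x ≤
      ∫ x in Ioi 0, ((Φ + η / 2) * (rate k * Real.exp (-(rate k * x))) +
      rate k * Real.exp (-(rate k * δ)) * m x) := by
    refine integral_mono_of_nonneg (Eventually.of_forall fun x =>
      mul_nonneg (mul_nonneg (rate_pos k).le (Real.exp_pos _).le) (hm0 x)) hi ?_
    filter_upwards [ae_restrict_mem measurableSet_Ioi] with x hx
    have r := rate_pos k
    have hw : 0 ≤ rate k * Real.exp (-(rate k * x)) := by positivity
    have hwδ : 0 ≤ rate k * Real.exp (-(rate k * δ)) := by positivity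
    -- Near 0 the function `m` is small enough and the weight has integral one; beyond `δ` the
    -- weight is at most its value at `δ`, which tends to zero.
    rcases lt_or_ge x δ with hxδ | hxδ
    · have := mul_le_mul_of_nonneg_left (hd x ⟨hx, hxδ⟩) hw
      have := mul_nonneg hwδ (hm0 x)
      linarith
    · have : rate k * Real.exp (-(rate k * x)) ≤ rate k * Real.exp (-(rate k * δ)) := by
        gcongr
      have := mul_le_mul_of_nonneg_right this (hm0 x)
      have := mul_nonneg hΦ hw
      linarith
  rw [integral_add ((integrable_rate_exp k).const_mul _) (hm.const_mul _),
    integral_const_mul (Φ + η / 2), integral_rate_exp, integral_const_mul, mul_one] at h1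
  linarith

theorem toReal_eLpNorm_sq {α : Type*} {mα : MeasurableSpace α} {μ : Measure α} {w : α → ℝ}
    (hw : MemLp w 2 μ) : (eLpNorm w 2 μ).toReal ^ 2 = ∫ x, w x ^ 2 ∂μ := by
  rw [hw.eLpNorm_eq_integral_rpow_norm two_ne_zero ENNReal.ofNat_ne_top]
  have h0 : 0 ≤ ∫ x, w x ^ 2 ∂μ := integral_nonneg fun x => sq_nonneg _
  simp only [ENNReal.toReal_ofNat, Real.rpow_two, Real.norm_eq_abs, sq_abs]
  rw [ENNReal.toReal_ofReal (by positivity), ← Real.rpow_two, ← Real.rpow_mul h0]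
  norm_num

namespace IsEnergySolution

variable {g : ℝ → ℂ} {n₀ : ℝ → ℝ} {n₁ : 𝓓'(halfLine, ℝ)} {h : ℝ → ℂ} {f : ℝ → ℝ} {T : ℝ}
  {u : ℝ → ℝ → ℂ} {n : ℝ → ℝ → ℝ} {nt : ℝ → 𝓓'(halfLine, ℝ)} {N : ℝ → L2}

theorem integrable_sq (hs : IsEnergySolution g n₀ n₁ h f T u n nt)
    (hN : ∀ t ∈ Icc 0 T, N t =ᵐ[hlMeasure] n t) :
    Integrable (fun z : ℝ × ℝ => n z.1 z.2 ^ 2) ((volume.restrict (Ioo 0 T)).prod hlMeasure) := by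
  have hm : AEStronglyMeasurable (fun z : ℝ × ℝ => n z.1 z.2 ^ 2)
      ((volume.restrict (Ioo 0 T)).prod hlMeasure) := by
    rw [Measure.prod_restrict, ← Measure.volume_eq_prod]
    exact hs.n_meas.pow 2
  have cN := continuousOn_of_continuousInNorm hs.n_cont hN
  rw [integrable_prod_iff hm]
  constructor
  · filter_upwards [ae_restrict_mem measurableSet_Ioo] with s hs'
    exact (hs.n_mem s (Ioo_subset_Icc_self hs')).integrable_sq
  · have hi : IntegrableOn (fun s => ‖N s‖ ^ 2) (Ioo 0 T) := by
      refine (ContinuousOn.integrableOn_compact isCompact_Icc ?_).mono_set Ioo_subset_Icc_self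
      fun_prop
    refine hi.congr_fun_ae ?_
    filter_upwards [ae_restrict_mem measurableSet_Ioo] with s hs'
    rw [L2.norm_sq]
    refine integral_congr_ae ?_
    filter_upwards [hN s (Ioo_subset_Icc_self hs')] with x hx
    rw [hx, Real.norm_of_nonneg (sq_nonneg _)]

/-- Continuity in x with values in L²(0, T) at x = 0, where the norm is at most that of `f` on the
whole half line; this removes the dependence on T. -/
theorem trace_limit (hs : IsEnergySolution g n₀ n₁ h f T u n nt) (hf : MemL2 f) {η : ℝ}
    (hη : 0 < η) : ∃ δ > 0, ∀ x ∈ Ioo 0 δ, ∫ s in Ioo 0 T, n s x ^ 2 ≤ l2Norm f ^ 2 + η := by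
  have h0 : (0 : ℝ) ∈ Ici (0 : ℝ) := self_mem_Ici
  have hf0 : (eLpNorm (fun s => n s 0) 2 (volume.restrict (Ioo 0 T))).toReal ≤ l2Norm f := by
    rw [eLpNorm_congr_ae hs.n_boundary]
    exact ENNReal.toReal_mono hf.eLpNorm_ne_top
      (eLpNorm_mono_measure _ (Measure.restrict_mono Ioo_subset_Ioi_self le_rfl))
  have hl := ((hs.n_trace_cont 0 h0).const_add (l2Norm f)).pow 2
  rw [add_zero] at hl
  have he := hl.eventually_le_const (show l2Norm f ^ 2 < l2Norm f ^ 2 + η by linarith)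
  obtain ⟨δ, hδ, hd⟩ := Metric.mem_nhdsWithin_iff.1 he
  refine ⟨δ, hδ, fun x hx => ?_⟩
  have hx0 : x ∈ Ici (0 : ℝ) := hx.1.le
  have h1 := hd ⟨by rw [Metric.mem_ball, Real.dist_0_eq_abs, abs_of_pos hx.1]; exact hx.2, hx0⟩
  rw [mem_ofPred_eq] at h1
  rw [← toReal_eLpNorm_sq (hs.n_trace_mem x hx0)]
  refine le_trans (pow_le_pow_left₀ ENNReal.toReal_nonneg ?_ 2) h1
  have m0 := hs.n_trace_mem 0 h0
  have mx := (hs.n_trace_mem x hx0).sub m0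
  have h2 := eLpNorm_add_le m0.1 mx.1 (p := 2) one_le_two
  have h3 := ENNReal.toReal_mono (ENNReal.add_ne_top.2 ⟨m0.eLpNorm_ne_top, mx.eLpNorm_ne_top⟩) h2
  rw [ENNReal.toReal_add m0.eLpNorm_ne_top mx.eLpNorm_ne_top, add_sub_cancel] at h3
  exact h3.trans (add_le_add_left hf0 _)

/-- By Fubini the flux is the average over x, with the weight r exp(-r x), of the time integral of
n(·, x)². -/
theorem flux_le (hs : IsEnergySolution g n₀ n₁ h f T u n nt) (hT : 0 < T) (hf : MemL2 f)
    (hN : ∀ t ∈ Icc 0 T, N t =ᵐ[hlMeasure] n t) {η : ℝ} (hη : 0 < η) :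
    ∀ᶠ k in atTop, ∫ s in 0..T, inner ℝ (dX k (N s)) (N s) ≤ l2Norm f ^ 2 + η := by
  have hi := hs.integrable_sq hN
  have hm : Integrable (fun x => ∫ s in Ioo 0 T, n s x ^ 2) hlMeasure := hi.integral_prod_right
  filter_upwards [eventually_integral_weight_le hm (fun x => integral_nonneg fun s => sq_nonneg _)
    (fun η hη => hs.trace_limit hf hη) hη] with k hk
  refine le_trans (le_of_eq ?_) hk
  have e1 : ∫ s in 0..T, inner ℝ (dX k (N s)) (N s) = ∫ s in Ioo 0 T, ∫ x in Ioi 0,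
      rate k * Real.exp (-(rate k * x)) * n s x ^ 2 := by
    rw [intervalIntegral.integral_of_le hT.le, integral_Ioc_eq_integral_Ioo]
    refine setIntegral_congr_fun measurableSet_Ioo fun s hs' => ?_
    rw [dX_apply, real_inner_smul_left, inner_W_eq, ← integral_const_mul]
    refine integral_congr_ae ?_
    filter_upwards [hN s (Ioo_subset_Icc_self hs')] with x hx
    rw [hx]; ring
  rw [e1]
  have hw : Integrable (Function.uncurry fun s x : ℝ =>
      rate k * Real.exp (-(rate k * x)) * n s x ^ 2)
      ((volume.restrict (Ioo 0 T)).prod hlMeasure) := by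
    refine hi.bdd_mul (c := rate k) (Continuous.aestronglyMeasurable (by fun_prop)) ?_
    have hae : ∀ᵐ z : ℝ × ℝ ∂((volume.restrict (Ioo 0 T)).prod hlMeasure), 0 < z.2 := by
      rw [Measure.prod_restrict]
      filter_upwards [ae_restrict_mem (measurableSet_Ioo.prod measurableSet_Ioi)] with z hz
      exact hz.2
    filter_upwards [hae] with z hz
    have r := rate_pos k
    rw [Real.norm_of_nonneg (by positivity)]
    refine mul_le_of_le_one_right r.le (Real.exp_le_one_iff.2 ?_)
    have := mul_pos r hz
    linarith
  rw [integral_integral_swap hw]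
  simp only [integral_const_mul]

end IsEnergySolution

end Trace

end Zakharov

end

/-! ### Conclusion -/

theorem proposition6p1 :
    ∃ C : ℝ → ℝ → ℝ → ℝ → ℝ,
      (∀ a a' b b' c c' d d' : ℝ, a ≤ a' → b ≤ b' → c ≤ c' → d ≤ d' →
        C a b c d ≤ C a' b' c' d') ∧
      ∀ (g : ℝ → ℂ) (n₀ : ℝ → ℝ) (n₁ : 𝓓'(Zakharov.halfLine, ℝ)) (f : ℝ → ℝ) (T : ℝ)
        (u : ℝ → ℝ → ℂ) (n : ℝ → ℝ → ℝ) (nt : ℝ → 𝓓'(Zakharov.halfLine, ℝ)),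
        Zakharov.MemH1 g → Zakharov.MemL2 n₀ → Zakharov.MemHatHm1 n₁ → Zakharov.MemL2 f →
        0 < T →
        Zakharov.IsEnergySolution g n₀ n₁ (fun _ => 0) f T u n nt →
        ∀ t ∈ Icc 0 T,
          Zakharov.h1Norm (u t) + Zakharov.l2Norm (n t) + Zakharov.hatHm1Norm (nt t) ≤
            C (Zakharov.h1Norm g) (Zakharov.l2Norm n₀) (Zakharov.hatHm1Norm n₁)
              (Zakharov.l2Norm f) := by
  -- The maxima with 0 make the squares monotone on all of ℝ; the constant 3 comes from r ≤ 1 + r²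
  -- for each of the three norms on the left.
  refine ⟨fun a b c d => 3 + 20 * (max a 0 ^ 2 + max b 0 ^ 2 + max c 0 ^ 2) +
    100 * (max a 0 ^ 2) ^ 3 + 24 * max d 0 ^ 2, ?_, ?_⟩
  · intro a a' b b' c c' d d' ha hb hc hd
    have h : ∀ {x y : ℝ}, x ≤ y → max x 0 ^ 2 ≤ max y 0 ^ 2 := fun hxy =>
      pow_le_pow_left₀ (le_max_right _ _) (max_le_max_right 0 hxy) 2
    have h3 := pow_le_pow_left₀ (sq_nonneg _) (h ha) 3
    have := h ha
    have := h hb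
    have := h hc
    have := h hd
    linarith
  · intro g n₀ n₁ f T u n nt _ _ _ hf hT hs t ht
    have h0 : (0 : ℝ) ∈ Icc 0 T := ⟨le_rfl, hT.le⟩
    have ex : ∀ t ∈ Icc 0 T, ∃ q : Zakharov.H10 × Zakharov.H10,
        Zakharov.Represents (u t) q.1 q.2 := fun t ht =>
      Zakharov.exists_represents (hs.u_mem t ht) (hs.u_space_cont t ht) (hs.u_boundary t ht)
    have eN : ∀ t ∈ Icc 0 T, ∃ N : Zakharov.L2, N =ᵐ[Zakharov.hlMeasure] n t := fun t ht =>
      ⟨MemLp.toLp (n t) (hs.n_mem t ht), MemLp.coeFn_toLp (hs.n_mem t ht)⟩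
    have eP : ∀ t ∈ Icc 0 T, ∃ P : Zakharov.L2, Zakharov.HasPrimitive (nt t) P := fun t ht =>
      (hs.nt_mem t ht).elim fun _ hp => ⟨_, hp.hasPrimitive⟩
    choose! q hq using ex
    choose! N hN using eN
    choose! P hP using eP
    have key := (hs.isSystem hT hq hN hP).norm_sq_bound
      (fun η hη => hs.flux_le hT hf hN hη) hT ht
    have hg : Zakharov.Represents g (q 0).1 (q 0).2 := hs.u_init.symm.trans (hq 0 h0)
    have n0 : Zakharov.l2Norm n₀ = ‖N 0‖ := by
      rw [← Zakharov.l2Norm_coeFn]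
      exact Zakharov.l2Norm_congr ((hN 0 h0).trans hs.n_init).symm
    have nT : Zakharov.l2Norm (n t) = ‖N t‖ := by
      rw [← Zakharov.l2Norm_coeFn]
      exact Zakharov.l2Norm_congr (hN t ht).symm
    have p0 : Zakharov.hatHm1Norm n₁ = ‖P 0‖ := by
      rw [← hs.nt_init]
      exact (hP 0 h0).norm_eq
    have f0 : 0 ≤ Zakharov.l2Norm f := ENNReal.toReal_nonneg
    rw [← hg.h1Norm_sq, ← (hq t ht).h1Norm_sq] at key
    beta_reduce
    rw [n0, nT, p0, (hP t ht).norm_eq, max_eq_left (Zakharov.h1Norm_nonneg g),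
      max_eq_left (norm_nonneg _), max_eq_left (norm_nonneg _), max_eq_left f0]
    nlinarith [sq_nonneg (Zakharov.h1Norm (u t) - 1), sq_nonneg (‖N t‖ - 1),
      sq_nonneg (‖P t‖ - 1), sq_nonneg (Zakharov.h1Norm (u t)), sq_nonneg ‖N t‖, sq_nonneg ‖P t‖]
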